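/- There are an absolute constant $C$ and a deterministic black-box algorithm with the following property. Let $n\ge 2$, let $q$ be an odd prime power, and let $\omega$ be a primitive element of $\mathbb F_q$. Let $\mathrm{Sp}(2n,q)$ be the isometry group of a non-degenerate symplectic form on $\mathbb F_q^{2n}$ with a basis $e_1,\dots,e_n,f_n,\dots,f_1$ consisting of hyperbolic pairs $(e_i,f_i)$, with matrices acting on row vectors from the right. Let $\bar s,\bar t,\bar\delta,\bar u,\bar v,\bar x\in\mathrm{Sp}(2n,q)$ be the standard generators, where basis vectors whose images are not listed are fixed: $$\bar s: e_1\mapsto f_1,\ f_1\mapsto -e_1;\qquad \bar t: e_1\mapsto e_1+f_1;\qquad \bar\delta: e_1\mapsto\omega e_1,\ f_1\mapsto\omega^{-1}f_1;$$ $$\bar u: e_1\leftrightarrow e_2,\ f_1\leftrightarrow f_2;\qquad \bar v: e_1\mapsto e_2\mapsto\cdots\mapsto e_n\mapsto e_1,\ f_1\mapsto f_2\mapsto\cdots\mapsto f_n\mapsto f_1;\qquad \bar x: f_1\mapsto f_1+e_2,\ f_2\mapsto f_2+e_1 .$$ Let $G$ be a black-box group: its elements are represented, not necessarily uniquely, by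 bit strings of uniform length, and there are oracles for multiplying two elements, for inverting an element, and for testing whether two strings represent the same element. Suppose that elements $s,t,\delta,u,v,x$ of $G$ are given such that $\bar s\mapsto s$, $\bar t\mapsto t$, $\bar\delta\mapsto\delta$, $\bar u\mapsto u$, $\bar v\mapsto v$, $\bar x\mapsto x$ extends to an isomorphism $\mathrm{Sp}(2n,q)\to G$. Then for every $g\in G$ the algorithm, given $n$, $q$, the field $\mathbb F_q$ (by its addition and multiplication tables), $\omega$, and strings for $s,t,\delta,u,v,x$ and $g$, and accessing $G$ only through the three oracles, uses at most $C n^2 q$ black-box operations (multiplications, inversions and equality tests) and outputs a straight-line program in $s,t,\delta,u,v,x$ of length at most $C n^2\log q$ that evaluates to an element $z$ with $z^{-1}g\in Z(G)$. Here a straight-line program is a list of instructions, each of which fetches a generator, multiplies two earlier entries or inverts an earlier entry; its length is the number of instructions, and its value is the last entry. Computations that do not involve elements of $G$ are not counted. -/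

import Mathlib

/-! ## Straight-line programs -/

/-- An instruction of a straight-line program over `k` generators: fetch a generator, multiply two
entries that were computed before, or invert an entry that was computed before. -/
inductive SLPInstr (k : ℕ) : Type
  | gen (a : Fin k)
  | mul (i j : ℕ)
  | inv (i : ℕ)

/-- A straight-line program is the list of its instructions, and its length is their number. -/
abbrev SLP (k : ℕ) : Type := List (SLPInstr k)

namespace SLPInstr

/-- The value of an instruction, where `x` are the generators and `w` lists the entries computed so
far; it is `none` if the instruction refers to an entry that has not been computed yet. -/
def eval {k : ℕ} {G : Type*} [Group G] (x : Fin k → G) (w : List G) : SLPInstr k → Option G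
  | gen a => some (x a)
  | mul i j => w[i]?.bind fun a => w[j]?.map fun b => a * b
  | inv i => w[i]?.map fun a => a⁻¹

/-- Instructions as plain data. -/
def equivSum (k : ℕ) : SLPInstr k ≃ Fin k ⊕ (ℕ × ℕ) ⊕ ℕ where
  toFun
    | gen a => .inl a
    | mul i j => .inr (.inl (i, j))
    | inv i => .inr (.inr i)
  invFun
    | .inl a => gen a
    | .inr (.inl (i, j)) => mul i j
    | .inr (.inr i) => inv i
  left_inv I := by cases I <;> rfl
  right_inv I := by rcases I with a | ⟨i, j⟩ | i <;> rfl

instance instPrimcodable (k : ℕ) : Primcodable (SLPInstr k) := Primcodable.ofEquiv _ (equivSum k)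

end SLPInstr

namespace SLP

/-- Run the instructions one after the other, appending each value to the entries `w` computed
so far. -/
def values {k : ℕ} {G : Type*} [Group G] (x : Fin k → G) : List G → SLP k → Option (List G)
  | w, [] => some w
  | w, I :: p => (I.eval x w).bind fun a => values x (w ++ [a]) p

/-- The element of `G` that a straight-line program evaluates to in the generators `x`: its last
entry. It is `none` if the program is empty or not well formed. -/
def eval {k : ℕ} {G : Type*} [Group G] (x : Fin k → G) (p : SLP k) : Option G :=
  (values x [] p).bind List.getLast?

end SLP

/-! ## Black-box groups and black-box algorithms -/

/-- A black-box group: the elements of `G` are represented, not necessarily uniquely, by bit strings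
of a uniform length `len`, and there are oracles that multiply, invert, and decide whether two
strings represent the same element. -/
structure BlackBoxGroup (G : Type*) [Group G] where
  /-- the length of the strings -/
  len : ℕ
  /-- the strings that represent an element -/
  IsElt : (Fin len → Bool) → Prop
  /-- the element that a string represents -/
  val : {w : Fin len → Bool // IsElt w} → G
  val_surjective : Function.Surjective val
  /-- the multiplication oracle -/
  mul (a b : {w : Fin len → Bool // IsElt w}) : {w : Fin len → Bool // IsElt w}
  val_mul : ∀ a b, val (mul a b) = val a * val b
  /-- the inversion oracle -/
  inv (a : {w : Fin len → Bool // IsElt w}) : {w : Fin len → Bool // IsElt w}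
  val_inv : ∀ a, val (inv a) = (val a)⁻¹
  /-- the equality oracle -/
  eqTest (a b : {w : Fin len → Bool // IsElt w}) : Bool
  eqTest_iff : ∀ a b, eqTest a b = true ↔ val a = val b

/-- The strings that represent the elements of a black-box group. -/
abbrev BlackBoxGroup.Code {G : Type*} [Group G] (B : BlackBoxGroup G) : Type :=
  {w : Fin B.len → Bool // B.IsElt w}

/-- A move of a black-box algorithm: multiply the contents of two registers, invert the content of
a register, test whether two registers represent the same element, or stop and output a
straight-line program over `k` generators. -/
inductive Move (k : ℕ) : Type
  | mul (i j : ℕ)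
  | inv (i : ℕ)
  | eqTest (i j : ℕ)
  | output (p : SLP k)

namespace Move

/-- Moves as plain data. -/
def equivSum (k : ℕ) : Move k ≃ (ℕ × ℕ) ⊕ ℕ ⊕ (ℕ × ℕ) ⊕ SLP k where
  toFun
    | mul i j => .inl (i, j)
    | inv i => .inr (.inl i)
    | eqTest i j => .inr (.inr (.inl (i, j)))
    | output p => .inr (.inr (.inr p))
  invFun
    | .inl (i, j) => mul i j
    | .inr (.inl i) => inv i
    | .inr (.inr (.inl (i, j))) => eqTest i j
    | .inr (.inr (.inr p)) => output p
  left_inv I := by cases I <;> rfl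
  right_inv I := by rcases I with ⟨i, j⟩ | i | ⟨i, j⟩ | p <;> rfl

instance instPrimcodable (k : ℕ) : Primcodable (Move k) := Primcodable.ofEquiv _ (equivSum k)

end Move

/-- A (deterministic, uniform) black-box algorithm with parameters of type `I` that outputs
straight-line programs over `k` generators. The next move is a computable function of the parameters
and of the replies to the operations made so far: `some b` is the answer `b` of an equality test,
and `none` stands for a product or an inverse, whose result goes into a new register. The algorithm
never sees the strings that represent the group elements. -/
structure BlackBoxAlgorithm (I : Type) [Primcodable I] (k : ℕ) where
  next : I → List (Option Bool) → Move k
  computable_next : Computable₂ next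

/-- Play the strategy `A` in the black-box group `B`, starting from the replies `h` and the register
contents `r`, for at most `N` black-box operations. The result is the straight-line program that `A`
outputs, or `none` if `A` has not stopped after `N` operations or uses an empty register. -/
def runStrategy {k : ℕ} {G : Type*} [Group G] (B : BlackBoxGroup G)
    (A : List (Option Bool) → Move k) :
    (N : ℕ) → (h : List (Option Bool)) → (r : List B.Code) → Option (SLP k)
  | 0, h, _ =>
    match A h with
    | .output p => some p
    | _ => none
  | N + 1, h, r =>
    match A h with
    | .output p => some p
    | .mul i j => r[i]?.bind fun a => r[j]?.bind fun b =>
        runStrategy B A N (h ++ [none]) (r ++ [B.mul a b])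
    | .inv i => r[i]?.bind fun a => runStrategy B A N (h ++ [none]) (r ++ [B.inv a])
    | .eqTest i j => r[i]?.bind fun a => r[j]?.bind fun b =>
        runStrategy B A N (h ++ [some (B.eqTest a b)]) r

/-- On parameters `i`, on strings `c` for the generators and on a string `w` for the input element,
the algorithm `A` outputs `p` after at most `N` black-box operations. The registers initially hold
the generators and, after them, the input element. -/
def BlackBoxAlgorithm.OutputsWithin {I : Type} [Primcodable I] {k : ℕ} {G : Type*} [Group G]
    (A : BlackBoxAlgorithm I k) (i : I) (B : BlackBoxGroup G) (c : Fin k → B.Code) (w : B.Code)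
    (N : ℕ) (p : SLP k) : Prop :=
  runStrategy B (A.next i) N [] (List.ofFn c ++ [w]) = some p

/-! ## The parameters of the algorithm -/

/-- The number `n`, the order `q` of a field with elements numbered `0, …, q - 1`, its addition and
multiplication tables, and the number of a primitive element. -/
abbrev SpParams : Type := ℕ × ℕ × List (List ℕ) × List (List ℕ) × ℕ

/-- The parameters that belong to `n`, to a field `F` whose elements are numbered by `e`, and to
`ω`. -/
def spParams {F : Type*} [Field F] {q : ℕ} (n : ℕ) (e : F ≃ Fin q) (ω : Fˣ) : SpParams :=
  (n, q,
    List.ofFn fun i => List.ofFn fun j => (e (e.symm i + e.symm j) : ℕ),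
    List.ofFn fun i => List.ofFn fun j => (e (e.symm i * e.symm j) : ℕ),
    (e (ω : F) : ℕ))

/-! ## The standard generators of `Sp(2n, q)`

Vectors are rows and matrices act from the right, so the rows of a matrix are the images of the
basis vectors `e_1, …, e_n, f_1, …, f_n`. The group `Matrix.symplecticGroup (Fin n) F` consists of
the matrices `A` with `A J Aᵀ = J`; that is, they preserve a form for which the `(e_i, f_i)` are,
up to a common sign, mutually orthogonal hyperbolic pairs. The index `i : Fin n` stands for
`i + 1` in the usual numbering. -/

namespace SpGen

open Matrix

/-- The basis vector `e_i`. -/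
def e {n : ℕ} (F : Type*) [Field F] (i : Fin n) : Fin n ⊕ Fin n → F := Pi.single (Sum.inl i) 1

/-- The basis vector `f_i`. -/
def f {n : ℕ} (F : Type*) [Field F] (i : Fin n) : Fin n ⊕ Fin n → F := Pi.single (Sum.inr i) 1

section General

variable {n : ℕ} {F : Type*} [Field F]

/-- The matrix of the linear map `e_i ↦ E i`, `f_i ↦ E' i`. -/
def ofImages (E E' : Fin n → (Fin n ⊕ Fin n → F)) : Matrix (Fin n ⊕ Fin n) (Fin n ⊕ Fin n) F :=
  Matrix.of (Sum.elim E E')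

/-- The alternating form `x J yᵀ`. -/
def form (x y : Fin n ⊕ Fin n → F) : F := x ⬝ᵥ J (Fin n) F *ᵥ y

theorem form_add_left (x y z : Fin n ⊕ Fin n → F) : form (x + y) z = form x z + form y z := by
  simp [form]

theorem form_add_right (x y z : Fin n ⊕ Fin n → F) : form x (y + z) = form x y + form x z := by
  simp [form, mulVec_add]

theorem form_neg_left (x y : Fin n ⊕ Fin n → F) : form (-x) y = -form x y := by
  simp [form]

theorem form_neg_right (x y : Fin n ⊕ Fin n → F) : form x (-y) = -form x y := by
  simp [form, mulVec_neg]

theorem form_smul_left (a : F) (x y : Fin n ⊕ Fin n → F) : form (a • x) y = a * form x y := by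
  simp [form]

theorem form_smul_right (a : F) (x y : Fin n ⊕ Fin n → F) : form x (a • y) = a * form x y := by
  simp [form, mulVec_smul]

theorem form_e_e (i j : Fin n) : form (e F i) (e F j) = 0 := by
  simp [form, e, J]

theorem form_f_f (i j : Fin n) : form (f F i) (f F j) = 0 := by
  simp [form, f, J]

theorem form_e_f (i j : Fin n) : form (e F i) (f F j) = if i = j then -1 else 0 := by
  simp [form, e, f, J, Matrix.one_apply, apply_ite]

theorem form_f_e (i j : Fin n) : form (f F i) (e F j) = if i = j then 1 else 0 := by
  simp [form, e, f, J, Matrix.one_apply]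

theorem ofImages_mem {E E' : Fin n → (Fin n ⊕ Fin n → F)}
    (h₁ : ∀ i j, form (E i) (E j) = 0) (h₂ : ∀ i j, form (E' i) (E' j) = 0)
    (h₃ : ∀ i j, form (E i) (E' j) = if i = j then -1 else 0)
    (h₄ : ∀ i j, form (E' i) (E j) = if i = j then 1 else 0) :
    ofImages E E' ∈ symplecticGroup (Fin n) F := by
  rw [SymplecticGroup.mem_iff]
  have key : ∀ a b, (ofImages E E' * J (Fin n) F * (ofImages E E')ᵀ) a b =
      form (Sum.elim E E' a) (Sum.elim E E' b) := by
    intro a b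
    rw [Matrix.mul_assoc]
    rfl
  ext a b
  rw [key]
  rcases a with i | i <;> rcases b with j | j <;>
    simp [h₁, h₂, h₃, h₄, J, Matrix.one_apply] <;> split_ifs <;> simp

/-- The index of `e_1` and `f_1`. -/
def i₁ (hn : 2 ≤ n) : Fin n := ⟨0, by omega⟩

/-- The index of `e_2` and `f_2`. -/
def i₂ (hn : 2 ≤ n) : Fin n := ⟨1, by omega⟩

theorem i₁_ne_i₂ (hn : 2 ≤ n) : i₁ hn ≠ i₂ hn := by
  simp [i₁, i₂]

end General

/-- `s : e_1 ↦ f_1, f_1 ↦ -e_1`. -/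
def s {n : ℕ} (F : Type*) [Field F] (hn : 2 ≤ n) : symplecticGroup (Fin n) F :=
  ⟨ofImages (fun i => if i = i₁ hn then f F i else e F i)
      (fun i => if i = i₁ hn then -e F i else f F i), by
    apply ofImages_mem <;> intro i j <;>
      grind [form_add_left, form_add_right, form_neg_left, form_neg_right, form_smul_left,
        form_smul_right, form_e_e, form_f_f, form_e_f, form_f_e]⟩

/-- `t : e_1 ↦ e_1 + f_1`. -/
def t {n : ℕ} (F : Type*) [Field F] (hn : 2 ≤ n) : symplecticGroup (Fin n) F :=
  ⟨ofImages (fun i => if i = i₁ hn then e F i + f F i else e F i) (fun i => f F i), by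
    apply ofImages_mem <;> intro i j <;>
      grind [form_add_left, form_add_right, form_neg_left, form_neg_right, form_smul_left,
        form_smul_right, form_e_e, form_f_f, form_e_f, form_f_e]⟩

/-- `δ : e_1 ↦ ω e_1, f_1 ↦ ω⁻¹ f_1`. -/
def δ {n : ℕ} {F : Type*} [Field F] (ω : Fˣ) (hn : 2 ≤ n) : symplecticGroup (Fin n) F :=
  ⟨ofImages (fun i => if i = i₁ hn then (ω : F) • e F i else e F i)
      (fun i => if i = i₁ hn then (ω : F)⁻¹ • f F i else f F i), by
    have h := ω.ne_zero
    apply ofImages_mem <;> intro i j <;>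
      grind [form_add_left, form_add_right, form_neg_left, form_neg_right, form_smul_left,
        form_smul_right, form_e_e, form_f_f, form_e_f, form_f_e]⟩

/-- `u : e_1 ↔ e_2, f_1 ↔ f_2`. -/
def u {n : ℕ} (F : Type*) [Field F] (hn : 2 ≤ n) : symplecticGroup (Fin n) F :=
  ⟨ofImages (fun i => e F (Equiv.swap (i₁ hn) (i₂ hn) i))
      (fun i => f F (Equiv.swap (i₁ hn) (i₂ hn) i)), by
    apply ofImages_mem <;> intro i j <;> simp [form_e_e, form_f_f, form_e_f, form_f_e]⟩

/-- `v : e_1 ↦ e_2 ↦ ⋯ ↦ e_n ↦ e_1, f_1 ↦ f_2 ↦ ⋯ ↦ f_n ↦ f_1`. -/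
def v (n : ℕ) (F : Type*) [Field F] : symplecticGroup (Fin n) F :=
  ⟨ofImages (fun i => e F (finRotate n i)) (fun i => f F (finRotate n i)), by
    apply ofImages_mem <;> intro i j <;> simp [form_e_e, form_f_f, form_e_f, form_f_e]⟩

/-- `x : f_1 ↦ f_1 + e_2, f_2 ↦ f_2 + e_1`. -/
def x {n : ℕ} (F : Type*) [Field F] (hn : 2 ≤ n) : symplecticGroup (Fin n) F :=
  ⟨ofImages (fun i => e F i)
      (fun i => if i = i₁ hn then f F (i₁ hn) + e F (i₂ hn)
        else if i = i₂ hn then f F (i₂ hn) + e F (i₁ hn) else f F i), by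
    have h := i₁_ne_i₂ hn
    apply ofImages_mem <;> intro i j <;>
      grind [form_add_left, form_add_right, form_neg_left, form_neg_right, form_smul_left,
        form_smul_right, form_e_e, form_f_f, form_e_f, form_f_e]⟩

end SpGen

/-- The standard generators `s, t, δ, u, v, x` of `Sp(2n, q)`, in this order, with respect to the
primitive element `ω`. -/
def stdGen {n : ℕ} (hn : 2 ≤ n) {F : Type*} [Field F] (ω : Fˣ) :
    Fin 6 → Matrix.symplecticGroup (Fin n) F :=
  ![SpGen.s F hn, SpGen.t F hn, SpGen.δ ω hn, SpGen.u F hn, SpGen.v n F, SpGen.x F hn]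

/-!
The argument has a group theoretic part, which shows that a good strategy exists for each `n`, `q`
and each symplectic group, and a computability part, which produces these strategies uniformly.

*Short programs.* Every non-zero vector can be moved to `f₁` with `O(n log q)` multiplications and
inversions of the generators (`SpGen.reach_f₁`), so every transvection `y ↦ y + (w, y) w`, being a
conjugate of `t`, is that cheap; the transvections `y ↦ y + a (w, y) w` follow, because `a` is a sum
of two squares. Four transvections suffice to move a hyperbolic pair to another one inside the
orthogonal complement of the preceding pairs. Hence every element has a program of length
`O(n² log q)` (`SpGen.cost_le`).

*Identification.* Let `g` be the unknown element. For transvections `T`, `T'` with centres `y`, `w`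
the elements `g⁻¹ T g` and `T'` commute if and only if `(y g, w) = 0`
(`SpGen.win_of_form_eq_zero`), which is a test with three black-box operations. With `O(n² q)`
operations one computes a table of transvections whose centres represent all points `⟨b⟩` and
`⟨b + a b'⟩` for basis vectors `b`, `b'` (`SpGen.obtains_table`). Now `⟨y g⟩` is found with `O(n q)`
tests (`SpGen.separates_act`), and doing so for `O(n)` vectors `y` determines `g` up to a scalar.
Then the program for any remaining candidate can be output. Algorithms of this kind are treated as
winning positions of a game, `Win`, in which the registers are functions of the unknown element and
the knowledge about it is a set of candidates; `SpGen.win_univ` is the result.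

*Uniformity.* Computations that do not involve group elements are free, so that it is enough to find
a good strategy by exhaustive search. A strategy that stops is a finite table. Whether such a table
works for all elements of the symplectic group can be decided by simulation in the matrix group over
the field given by its tables, which is a primitive recursive computation
(`SpParams.primrecRel_check`, `SpParams.primrecPred_valid`). The first part shows that some table
passes (`SpParams.exists_check`), so an unbounded search defines a computable function
(`PrimrecRel.exists_computable`). As a strategy sees nothing but the answers of the equality tests,
it takes the same course in the matrix group and in every black-box group isomorphic to it
(`play_map`).
-/

/-! ### Straight-line computations in a group -/

/-- `Obtains S c T`: with at most `c` multiplications and inversions, each applied to elements that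
are in `S` or were computed before, all elements of `T` can be computed. -/
inductive Obtains {K : Type*} [Group K] : Set K → ℕ → Set K → Prop
  | of_subset {S T : Set K} (c : ℕ) (h : T ⊆ S) : Obtains S c T
  | mul {S T : Set K} {c : ℕ} {a b : K} (ha : a ∈ S) (hb : b ∈ S)
      (h : Obtains (insert (a * b) S) c T) : Obtains S (c + 1) T
  | inv {S T : Set K} {c : ℕ} {a : K} (ha : a ∈ S)
      (h : Obtains (insert a⁻¹ S) c T) : Obtains S (c + 1) T

namespace Obtains

variable {K : Type*} [Group K] {S T U : Set K} {c d : ℕ} {a b : K}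

theorem mono_left (h : Obtains S c T) : ∀ {S' : Set K}, S ⊆ S' → Obtains S' c T := by
  induction h with
  | of_subset c h => exact fun hS => of_subset c (h.trans hS)
  | mul ha hb _ ih => exact fun hS => mul (hS ha) (hS hb) (ih (Set.insert_subset_insert hS))
  | inv ha _ ih => exact fun hS => inv (hS ha) (ih (Set.insert_subset_insert hS))

theorem mono_right (h : Obtains S c T) : U ⊆ T → Obtains S c U := by
  induction h with
  | of_subset c h => exact fun hS => of_subset c (hS.trans h)
  | mul ha hb _ ih => exact fun hS => mul ha hb (ih hS)
  | inv ha _ ih => exact fun hS => inv ha (ih hS)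

theorem mono_cost (h : Obtains S c T) : ∀ {d : ℕ}, c ≤ d → Obtains S d T := by
  induction h with
  | of_subset c h => exact fun _ => of_subset _ h
  | mul ha hb _ ih =>
    rintro (_ | d) hd
    · omega
    · exact mul ha hb (ih (by omega))
  | inv ha _ ih =>
    rintro (_ | d) hd
    · omega
    · exact inv ha (ih (by omega))

theorem keep (h : Obtains S c T) : Obtains S c (S ∪ T) := by
  induction h with
  | of_subset c h => exact of_subset _ (Set.union_subset subset_rfl h)
  | mul ha hb _ ih =>
    exact mul ha hb (ih.mono_right (Set.union_subset_union_left _ (Set.subset_insert _ _)))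
  | inv ha _ ih =>
    exact inv ha (ih.mono_right (Set.union_subset_union_left _ (Set.subset_insert _ _)))

theorem trans (h : Obtains S c T) : Obtains (S ∪ T) d U → Obtains S (c + d) U := by
  induction h with
  | of_subset c h =>
    exact fun h' => (h'.mono_left (Set.union_subset subset_rfl h)).mono_cost (by omega)
  | mul ha hb _ ih =>
    intro h'
    have := mul ha hb (ih (h'.mono_left (Set.union_subset_union_left _ (Set.subset_insert _ _))))
    exact this.mono_cost (by omega)
  | inv ha _ ih =>
    intro h'
    have := inv ha (ih (h'.mono_left (Set.union_subset_union_left _ (Set.subset_insert _ _))))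
    exact this.mono_cost (by omega)

theorem union (h : Obtains S c T) (h' : Obtains S d U) : Obtains S (c + d) (T ∪ U) := by
  refine h.keep.trans ?_
  have := (h'.mono_left (Set.subset_union_left (t := T))).keep
  refine (this.mono_left Set.subset_union_right).mono_right ?_
  intro z hz
  rcases hz with hz | hz
  · exact .inl (.inr hz)
  · exact .inr hz

theorem map {K' : Type*} [Group K'] (f : K →* K') (h : Obtains S c T) :
    Obtains (f '' S) c (f '' T) := by
  induction h with
  | of_subset c h => exact of_subset _ (Set.image_mono h)
  | mul ha hb _ ih =>
    refine mul (Set.mem_image_of_mem f ha) (Set.mem_image_of_mem f hb) ?_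
    rwa [← map_mul, ← Set.image_insert_eq]
  | inv ha _ ih =>
    refine inv (Set.mem_image_of_mem f ha) ?_
    rwa [← map_inv, ← Set.image_insert_eq]

theorem mul_of_mem (ha : a ∈ S) (hb : b ∈ S) : Obtains S 1 {a * b} :=
  mul (c := 0) ha hb (of_subset _ (by simp))

theorem inv_of_mem (ha : a ∈ S) : Obtains S 1 {a⁻¹} :=
  inv (c := 0) ha (of_subset _ (by simp))

theorem mul_single (ha : Obtains S c {a}) (hb : Obtains S d {b}) :
    Obtains S (c + d + 1) {a * b} :=
  (ha.union hb).trans (mul_of_mem (by simp) (by simp))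

theorem inv_single (ha : Obtains S c {a}) : Obtains S (c + 1) {a⁻¹} :=
  ha.trans (inv_of_mem (by simp))

theorem one_of_mem (ha : a ∈ S) : Obtains S 2 {(1 : K)} := by
  have := (of_subset 0 (Set.singleton_subset_iff.2 ha)).mul_single (inv_of_mem ha)
  simpa using this

/-- Powers by repeated squaring. -/
theorem pow_of_mem (ha : a ∈ S) {k : ℕ} (hk : k ≠ 0) : Obtains S (2 * Nat.log 2 k) {a ^ k} := by
  induction k using Nat.strong_induction_on with
  | _ k ih =>
    rcases lt_or_ge k 2 with h2 | h2
    · obtain rfl : k = 1 := by omega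
      exact of_subset _ (by simpa using ha)
    · have hrec := ih (k / 2) (by omega) (by omega)
      have hlog : Nat.log 2 k = Nat.log 2 (k / 2) + 1 := Nat.log_of_one_lt_of_le (by norm_num) h2
      rw [hlog, mul_add]
      refine hrec.trans (d := 2) ?_
      refine mul (c := 1) (a := a ^ (k / 2)) (b := a ^ (k / 2)) (by simp) (by simp) ?_
      rw [← pow_add]
      rcases Nat.even_or_odd k with h | h
      · refine of_subset _ ?_
        have : k / 2 + k / 2 = k := by obtain ⟨m, rfl⟩ := h; omega
        simp [this]
      · refine mul (c := 0) (a := a ^ (k / 2 + k / 2)) (b := a) (by simp) (by simp [ha])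
          (of_subset _ ?_)
        have : k / 2 + k / 2 + 1 = k := by obtain ⟨m, rfl⟩ := h; omega
        rw [← pow_succ, this]
        simp

theorem pow_single (ha : Obtains S c {a}) {k q : ℕ} (hk : k < q) :
    Obtains S (c + (2 * Nat.log 2 q + 2)) {a ^ k} := by
  refine ha.trans ?_
  have ha' : a ∈ S ∪ {a} := by simp
  rcases eq_or_ne k 0 with rfl | h0
  · rw [pow_zero]
    exact (one_of_mem ha').mono_cost (by omega)
  · exact (pow_of_mem ha' h0).mono_cost
      (by have := Nat.log_mono_right (b := 2) hk.le; omega)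

theorem conj_of_mem (ha : a ∈ S) (hb : b ∈ S) : Obtains S 3 {b⁻¹ * a * b} :=
  (((inv_of_mem hb).mul_single (of_subset 0 (by simpa using ha))).mul_single
    (of_subset 0 (by simpa using hb))).mono_cost (by omega)

theorem conj_single (ha : Obtains S c {a}) (hb : Obtains S d {b}) :
    Obtains S (c + d + 3) {b⁻¹ * a * b} :=
  (ha.union hb).trans (conj_of_mem (by simp) (by simp))

end Obtains

/-- The conjugates of the entries of `l` by the powers `b ^ i` with `i < m`. -/
def conjPowers {K : Type*} [Group K] (b : K) (m : ℕ) (l : List K) : List K :=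
  l.flatMap fun a => (List.range m).map fun i => (b ^ i)⁻¹ * a * b ^ i

theorem length_conjPowers {K : Type*} [Group K] (b : K) (m : ℕ) (l : List K) :
    (conjPowers b m l).length = l.length * m := by
  simp [conjPowers, List.length_flatMap]

theorem mem_conjPowers {K : Type*} [Group K] {b : K} {m : ℕ} {l : List K} {a : K} (ha : a ∈ l)
    {i : ℕ} (hi : i < m) : (b ^ i)⁻¹ * a * b ^ i ∈ conjPowers b m l :=
  List.mem_flatMap.2 ⟨a, ha, List.mem_map.2 ⟨i, List.mem_range.2 hi, rfl⟩⟩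

namespace Obtains

variable {K : Type*} [Group K] {S T U : Set K} {c d : ℕ} {a b : K}

/-- The conjugates by consecutive powers are computed one from the other, so each of them costs two
multiplications. -/
theorem conjPowers_of_mem (hb : b ∈ S) (hb' : b⁻¹ ∈ S) (m : ℕ) (l : List K)
    (hl : {a | a ∈ l} ⊆ S) : Obtains S (2 * (l.length * m)) {a | a ∈ conjPowers b m l} := by
  have single : ∀ (a : K), a ∈ S → ∀ m : ℕ,
      Obtains S (2 * m) {z | ∃ i, i ≤ m ∧ z = (b ^ i)⁻¹ * a * b ^ i} := by
    intro a ha m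
    induction m with
    | zero => exact of_subset _ (by rintro z ⟨i, hi, rfl⟩; obtain rfl : i = 0 := by omega
                                    simpa using ha)
    | succ m ih =>
      refine ih.keep.trans (d := 2) ?_
      have h1 : (b ^ m)⁻¹ * a * b ^ m ∈ {z | ∃ i, i ≤ m ∧ z = (b ^ i)⁻¹ * a * b ^ i} :=
        ⟨m, le_rfl, rfl⟩
      refine mul (c := 1) (a := b⁻¹) (b := (b ^ m)⁻¹ * a * b ^ m) (.inl hb') (.inr (.inr h1)) ?_
      refine mul (c := 0) (a := b⁻¹ * ((b ^ m)⁻¹ * a * b ^ m)) (b := b) (.inl rfl)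
        (.inr (.inl hb)) ?_
      refine of_subset _ ?_
      rintro z ⟨i, hi, rfl⟩
      rcases Nat.lt_or_ge i (m + 1) with h | h
      · exact .inr (.inr (.inr (.inr ⟨i, by omega, rfl⟩)))
      · obtain rfl : i = m + 1 := by omega
        left
        simp only [pow_succ, mul_inv_rev, mul_assoc]
  induction l with
  | nil => exact of_subset _ (by simp [conjPowers])
  | cons a l ih =>
    have h1 := single a (hl (by simp)) m
    have h2 := ih (fun z hz => hl (by simp at hz ⊢; exact .inr hz))
    refine ((h1.union h2).mono_cost (by simp; ring_nf; omega)).mono_right ?_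
    intro z hz
    simp only [conjPowers, List.flatMap_cons, List.mem_append, Set.mem_ofPred_eq, List.mem_map,
      List.mem_range] at hz
    rcases hz with ⟨i, hi, rfl⟩ | hz
    · exact .inl ⟨i, hi.le, rfl⟩
    · exact .inr hz

/-- Conjugating all entries of a list by one element, at the cost of two multiplications for each
and one inversion. -/
theorem conj_list (hb : b ∈ S) (l : List K) (hl : {a | a ∈ l} ⊆ S) :
    Obtains S (2 * l.length + 1) {z | ∃ a ∈ l, z = b⁻¹ * a * b} := by
  refine (inv (c := 2 * l.length) hb ?_)
  have : ∀ S : Set K, b ∈ S → b⁻¹ ∈ S → {a | a ∈ l} ⊆ S →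
      Obtains S (2 * l.length) {z | ∃ a ∈ l, z = b⁻¹ * a * b} := by
    clear hl
    induction l with
    | nil => exact fun S _ _ _ => of_subset _ (by simp)
    | cons a l ih =>
      intro S hb hb' hl
      have h1 : Obtains S 2 {b⁻¹ * a * b} :=
        mul (c := 1) hb' (hl (by simp : a ∈ a :: l)) (mul (c := 0) (.inl rfl) (.inr hb)
          (of_subset _ (by simp)))
      have h2 := ih S hb hb' (fun z hz => hl (by simp at hz ⊢; exact .inr hz))
      refine ((h1.union h2).mono_cost (by simp; ring_nf; omega)).mono_right ?_
      rintro z ⟨y, hy, rfl⟩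
      rcases List.mem_cons.1 hy with rfl | hy
      · exact .inl rfl
      · exact .inr ⟨y, hy, rfl⟩
  exact this _ (.inr hb) (.inl rfl) (hl.trans (Set.subset_insert _ _))

/-- A list of elements that can be computed separately. -/
theorem of_forall_mem (l : List K) (h : ∀ a ∈ l, Obtains S c {a}) :
    Obtains S (l.length * c) {a | a ∈ l} := by
  induction l with
  | nil => exact of_subset _ (by simp)
  | cons a l ih =>
    refine (((h a (by simp)).union (ih fun z hz => h z (by simp [hz]))).mono_cost
      (by simp; ring_nf; omega)).mono_right ?_
    intro z hz
    simpa using hz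

end Obtains

namespace SLP

variable {k : ℕ} {G : Type*} [Group G]

theorem values_append (x : Fin k → G) (w : List G) (p p' : SLP k) :
    values x w (p ++ p') = (values x w p).bind fun w' => values x w' p' := by
  induction p generalizing w with
  | nil => rfl
  | cons I p ih =>
    simp only [List.cons_append, values]
    cases I.eval x w <;> simp [ih]

theorem values_map_gen (x : Fin k → G) (w : List G) (l : List (Fin k)) :
    values x w (l.map SLPInstr.gen) = some (w ++ l.map x) := by
  induction l generalizing w with
  | nil => simp [values]
  | cons a l ih => simp [values, SLPInstr.eval, ih]

theorem exists_values_of_obtains (x : Fin k → G) {S T : Set G} {c : ℕ} (h : Obtains S c T)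
    (w : List G) (hw : ∀ a ∈ S, a ∈ w) :
    ∃ (p : SLP k) (w' : List G), p.length ≤ c ∧ values x w p = some w' ∧ ∀ a ∈ T, a ∈ w' := by
  induction h generalizing w with
  | of_subset c h => exact ⟨[], w, by simp, rfl, fun a ha => hw a (h ha)⟩
  | @mul S T c a b ha hb _ ih =>
    obtain ⟨i, hi⟩ := List.mem_iff_getElem?.1 (hw a ha)
    obtain ⟨j, hj⟩ := List.mem_iff_getElem?.1 (hw b hb)
    obtain ⟨p, w', hp, hv, hT⟩ := ih (w ++ [a * b]) (by
      intro z hz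
      rcases hz with rfl | hz
      · simp
      · simp [hw z hz])
    exact ⟨.mul i j :: p, w', by simpa using hp, by simp [values, SLPInstr.eval, hi, hj, hv], hT⟩
  | @inv S T c a ha _ ih =>
    obtain ⟨i, hi⟩ := List.mem_iff_getElem?.1 (hw a ha)
    obtain ⟨p, w', hp, hv, hT⟩ := ih (w ++ [a⁻¹]) (by
      intro z hz
      rcases hz with rfl | hz
      · simp
      · simp [hw z hz])
    exact ⟨.inv i :: p, w', by simpa using hp, by simp [values, SLPInstr.eval, hi, hv], hT⟩

/-- An element that can be computed from the generators with `c` operations is the value of a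
straight-line program of length at most `k + c + 2`: fetch all generators, carry out the operations,
and invert the result twice in order to put it at the end. -/
theorem exists_eval_of_obtains (x : Fin k → G) {c : ℕ} {g : G}
    (h : Obtains (Set.range x) c {g}) :
    ∃ p : SLP k, p.length ≤ k + c + 2 ∧ eval x p = some g := by
  obtain ⟨p, w, hp, hv, hT⟩ := exists_values_of_obtains x h ((List.finRange k).map x) (by
    rintro _ ⟨a, rfl⟩
    simp)
  obtain ⟨i, hi⟩ := List.mem_iff_getElem?.1 (hT g rfl)
  refine ⟨(List.finRange k).map .gen ++ (p ++ [.inv i, .inv w.length]), by simp; omega, ?_⟩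
  simp [eval, values_append, values_map_gen, hv, values, SLPInstr.eval, hi]

/-- Straight-line programs commute with homomorphisms. -/
theorem eval_map {G' : Type*} [Group G'] (f : G →* G') (x : Fin k → G) (p : SLP k) :
    eval (fun i => f (x i)) p = (eval x p).map f := by
  have hI : ∀ (I : SLPInstr k) (w : List G),
      I.eval (fun i => f (x i)) (w.map f) = (I.eval x w).map f := by
    rintro (a | ⟨i, j⟩ | i) w
    · rfl
    · simp only [SLPInstr.eval, List.getElem?_map]
      cases w[i]? <;> cases w[j]? <;> simp
    · simp only [SLPInstr.eval, List.getElem?_map]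
      cases w[i]? <;> simp
  have hv : ∀ (p : SLP k) (w : List G),
      values (fun i => f (x i)) (w.map f) p = (values x w p).map (List.map f) := by
    intro p
    induction p with
    | nil => simp [values]
    | cons I p ih =>
      intro w
      simp only [values, hI]
      cases I.eval x w with
      | none => rfl
      | some a => simpa using ih (w ++ [a])
  have := hv p []
  simp only [List.map_nil] at this
  simp only [eval, this]
  cases values x [] p <;> simp

end SLP

/-! ### Black-box strategies as games -/

/-- Play the strategy `A` on registers with entries in an arbitrary type with a multiplication, an
inversion and an equality test. -/
def play {k : ℕ} {M : Type*} (mul : M → M → M) (inv : M → M) (eq : M → M → Bool)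
    (A : List (Option Bool) → Move k) :
    (N : ℕ) → (h : List (Option Bool)) → (r : List M) → Option (SLP k)
  | 0, h, _ =>
    match A h with
    | .output p => some p
    | _ => none
  | N + 1, h, r =>
    match A h with
    | .output p => some p
    | .mul i j => r[i]?.bind fun a => r[j]?.bind fun b =>
        play mul inv eq A N (h ++ [none]) (r ++ [mul a b])
    | .inv i => r[i]?.bind fun a => play mul inv eq A N (h ++ [none]) (r ++ [inv a])
    | .eqTest i j => r[i]?.bind fun a => r[j]?.bind fun b =>
        play mul inv eq A N (h ++ [some (eq a b)]) r

theorem runStrategy_eq_play {k : ℕ} {G : Type*} [Group G] (B : BlackBoxGroup G)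
    (A : List (Option Bool) → Move k) (N : ℕ) (h : List (Option Bool)) (r : List B.Code) :
    runStrategy B A N h r = play B.mul B.inv B.eqTest A N h r := by
  induction N generalizing h r with
  | zero => rfl
  | succ N ih =>
    simp only [runStrategy, play]
    cases A h <;> simp only [ih]

/-- A strategy sees only the replies, so it takes the same course on two sets of registers that
correspond under a map compatible with the operations. -/
theorem play_map {k : ℕ} {M M' : Type*} {mul : M → M → M} {inv : M → M} {eq : M → M → Bool}
    {mul' : M' → M' → M'} {inv' : M' → M'} {eq' : M' → M' → Bool} (f : M → M')
    (hmul : ∀ a b, mul' (f a) (f b) = f (mul a b)) (hinv : ∀ a, inv' (f a) = f (inv a))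
    (heq : ∀ a b, eq' (f a) (f b) = eq a b)
    (A : List (Option Bool) → Move k) (N : ℕ) (h : List (Option Bool)) (r : List M) :
    play mul' inv' eq' A N h (r.map f) = play mul inv eq A N h r := by
  induction N generalizing h r with
  | zero => rfl
  | succ N ih =>
    simp only [play]
    cases A h with
    | output p => rfl
    | mul i j =>
      simp only [List.getElem?_map]
      cases r[i]? <;> cases r[j]? <;> simp [hmul, ← ih]
    | inv i =>
      simp only [List.getElem?_map]
      cases r[i]? <;> simp [hinv, ← ih]
    | eqTest i j =>
      simp only [List.getElem?_map]
      cases r[i]? <;> cases r[j]? <;> simp [heq, ← ih]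

/-- `Win Good S N C`: if the registers hold the elements `f g`, `f ∈ S`, for an unknown element
`g ∈ C`, then there is a way to find a program `p` with `Good g p` using at most `N` black-box
operations. -/
inductive Win {H : Type*} [Group H] {k : ℕ} (Good : H → SLP k → Prop) :
    Set (H → H) → ℕ → Set H → Prop
  | output {S : Set (H → H)} {C : Set H} (N : ℕ) (p : SLP k) (h : ∀ g ∈ C, Good g p) :
      Win Good S N C
  | mul {S : Set (H → H)} {N : ℕ} {C : Set H} {a b : H → H} (ha : a ∈ S) (hb : b ∈ S)
      (h : Win Good (insert (a * b) S) N C) : Win Good S (N + 1) C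
  | inv {S : Set (H → H)} {N : ℕ} {C : Set H} {a : H → H} (ha : a ∈ S)
      (h : Win Good (insert a⁻¹ S) N C) : Win Good S (N + 1) C
  | test {S : Set (H → H)} {N : ℕ} {C : Set H} {a b : H → H} (ha : a ∈ S) (hb : b ∈ S)
      (h : Win Good S N (C ∩ {g | a g = b g})) (h' : Win Good S N (C ∩ {g | a g ≠ b g})) :
      Win Good S (N + 1) C

namespace Win

variable {H : Type*} [Group H] {k : ℕ} {Good : H → SLP k → Prop} {S : Set (H → H)} {N : ℕ}
  {C : Set H}

theorem mono_left (h : Win Good S N C) : ∀ {S' : Set (H → H)}, S ⊆ S' → Win Good S' N C := by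
  induction h with
  | output N p h => exact fun _ => output N p h
  | mul ha hb _ ih => exact fun hS => mul (hS ha) (hS hb) (ih (Set.insert_subset_insert hS))
  | inv ha _ ih => exact fun hS => inv (hS ha) (ih (Set.insert_subset_insert hS))
  | test ha hb _ _ ih ih' => exact fun hS => test (hS ha) (hS hb) (ih hS) (ih' hS)

theorem mono_cost (h : Win Good S N C) : ∀ {N' : ℕ}, N ≤ N' → Win Good S N' C := by
  induction h with
  | output N p h => exact fun _ => output _ p h
  | mul ha hb _ ih =>
    rintro (_ | N') hN
    · omega
    · exact mul ha hb (ih (by omega))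
  | inv ha _ ih =>
    rintro (_ | N') hN
    · omega
    · exact inv ha (ih (by omega))
  | test ha hb _ _ ih ih' =>
    rintro (_ | N') hN
    · omega
    · exact test ha hb (ih (by omega)) (ih' (by omega))

theorem of_obtains {T : Set (H → H)} {c : ℕ} (h : Obtains S c T) :
    Win Good (S ∪ T) N C → Win Good S (c + N) C := by
  induction h with
  | of_subset c h =>
    exact fun h' => (h'.mono_left (Set.union_subset subset_rfl h)).mono_cost (by omega)
  | mul ha hb _ ih =>
    intro h'
    have := mul ha hb (ih (h'.mono_left (Set.union_subset_union_left _ (Set.subset_insert _ _))))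
    exact this.mono_cost (by omega)
  | inv ha _ ih =>
    intro h'
    have := inv ha (ih (h'.mono_left (Set.union_subset_union_left _ (Set.subset_insert _ _))))
    exact this.mono_cost (by omega)

/-- Testing whether two elements commute takes two multiplications and one equality test. -/
theorem commute {a b : H → H} (ha : a ∈ S) (hb : b ∈ S)
    (h : Win Good S N (C ∩ {g | a g * b g = b g * a g}))
    (h' : Win Good S N (C ∩ {g | a g * b g ≠ b g * a g})) : Win Good S (N + 3) C := by
  refine mul ha hb (mul (a := b) (b := a) (.inr hb) (.inr ha)
    (test (a := a * b) (b := b * a) (.inr (.inl rfl)) (.inl rfl) (h.mono_left ?_)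
      (h'.mono_left ?_))) <;>
  exact (Set.subset_insert _ _).trans (Set.subset_insert _ _)

/-- A winning position yields a strategy, stated here so that it applies after an arbitrary
sequence `h₀` of replies. -/
theorem exists_strategy [DecidableEq H] (hw : Win Good S N C) :
    ∀ (r : List (H → H)), (∀ a ∈ S, a ∈ r) → ∃ A : List (Option Bool) → Move k,
      ∀ g ∈ C, ∃ p, Good g p ∧ ∀ (A' : List (Option Bool) → Move k) (h₀ : List (Option Bool)),
        (∀ h, A' (h₀ ++ h) = A h) →
        play (· * ·) (·⁻¹) (fun a b => decide (a = b)) A' N h₀ (r.map fun f => f g) = some p := by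
  induction hw with
  | output N p h =>
    intro r _
    refine ⟨fun _ => .output p, fun g hg => ⟨p, h g hg, fun A' h₀ hA => ?_⟩⟩
    have := hA []
    rw [List.append_nil] at this
    cases N <;> simp [play, this]
  | @mul S N C a b ha hb _ ih =>
    intro r hr
    obtain ⟨i, hi⟩ := List.mem_iff_getElem?.1 (hr a ha)
    obtain ⟨j, hj⟩ := List.mem_iff_getElem?.1 (hr b hb)
    obtain ⟨A, hA⟩ := ih (r ++ [a * b]) (by
      intro z hz
      rcases hz with rfl | hz
      · simp
      · simp [hr z hz])
    refine ⟨fun h => match h with | [] => .mul i j | _ :: h => A h, fun g hg => ?_⟩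
    obtain ⟨p, hp, hrun⟩ := hA g hg
    refine ⟨p, hp, fun A' h₀ hA' => ?_⟩
    have h1 := hA' []
    rw [List.append_nil] at h1
    have h2 := hrun A' (h₀ ++ [none]) (fun h => by simpa using hA' (none :: h))
    simpa [play, h1, hi, hj] using h2
  | @inv S N C a ha _ ih =>
    intro r hr
    obtain ⟨i, hi⟩ := List.mem_iff_getElem?.1 (hr a ha)
    obtain ⟨A, hA⟩ := ih (r ++ [a⁻¹]) (by
      intro z hz
      rcases hz with rfl | hz
      · simp
      · simp [hr z hz])
    refine ⟨fun h => match h with | [] => .inv i | _ :: h => A h, fun g hg => ?_⟩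
    obtain ⟨p, hp, hrun⟩ := hA g hg
    refine ⟨p, hp, fun A' h₀ hA' => ?_⟩
    have h1 := hA' []
    rw [List.append_nil] at h1
    have h2 := hrun A' (h₀ ++ [none]) (fun h => by simpa using hA' (none :: h))
    simpa [play, h1, hi] using h2
  | @test S N C a b ha hb _ _ ih ih' =>
    intro r hr
    obtain ⟨i, hi⟩ := List.mem_iff_getElem?.1 (hr a ha)
    obtain ⟨j, hj⟩ := List.mem_iff_getElem?.1 (hr b hb)
    obtain ⟨A₁, hA₁⟩ := ih r hr
    obtain ⟨A₂, hA₂⟩ := ih' r hr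
    refine ⟨fun h => match h with
      | [] => .eqTest i j
      | some true :: h => A₁ h
      | _ :: h => A₂ h, fun g hg => ?_⟩
    by_cases hab : a g = b g
    · obtain ⟨p, hp, hrun⟩ := hA₁ g ⟨hg, hab⟩
      refine ⟨p, hp, fun A' h₀ hA' => ?_⟩
      have h1 := hA' []
      rw [List.append_nil] at h1
      have h2 := hrun A' (h₀ ++ [some true]) (fun h => by simpa using hA' (some true :: h))
      simpa [play, h1, hi, hj, hab] using h2
    · obtain ⟨p, hp, hrun⟩ := hA₂ g ⟨hg, hab⟩
      refine ⟨p, hp, fun A' h₀ hA' => ?_⟩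
      have h1 := hA' []
      rw [List.append_nil] at h1
      have h2 := hrun A' (h₀ ++ [some false]) (fun h => by simpa using hA' (some false :: h))
      simpa [play, h1, hi, hj, hab] using h2

/-- Find by exhaustive search an index `i` in a list with `g ∈ τ i`. -/
theorem search {ι : Type*} {m : ℕ} (τ : ι → Set H) (l : List ι)
    (hτ : ∀ i ∈ l, ∀ (C' : Set H) (N : ℕ), C' ⊆ C → Win Good S N (C' ∩ τ i) →
      Win Good S N (C' \ τ i) → Win Good S (N + m) C')
    (hcover : ∀ g ∈ C, ∃ i ∈ l, g ∈ τ i)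
    (hwin : ∀ i ∈ l, ∀ C' ⊆ C ∩ τ i, Win Good S N C') : Win Good S (N + l.length * m) C := by
  induction l generalizing C with
  | nil =>
    refine output _ [] fun g hg => ?_
    obtain ⟨i, hi, _⟩ := hcover g hg
    simp at hi
  | cons i l ih =>
    have h := hτ i (by simp) C (N + l.length * m) subset_rfl
      ((hwin i (by simp) _ subset_rfl).mono_cost (by omega)) (ih (C := C \ τ i) ?_ ?_ ?_)
    · exact h.mono_cost (by simp; ring_nf; omega)
    · exact fun j hj C' N' hC' => hτ j (by simp [hj]) C' N' (hC'.trans Set.sdiff_subset)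
    · rintro g ⟨hg, hgi⟩
      obtain ⟨j, hj, hgj⟩ := hcover g hg
      rcases List.mem_cons.1 hj with rfl | hj
      · exact absurd hgj hgi
      · exact ⟨j, hj, hgj⟩
    · exact fun j hj C' hC' => hwin j (by simp [hj]) C'
        (hC'.trans (Set.inter_subset_inter_left _ Set.sdiff_subset))

end Win

/-- `Separates Good S C₀ m R`: with `m` operations one can pass from a set of candidates in `C₀` to
a subset in which any two elements are related by `R`. -/
def Separates {H : Type*} [Group H] {k : ℕ} (Good : H → SLP k → Prop) (S : Set (H → H)) (C₀ : Set H)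
    (m : ℕ) (R : H → H → Prop) : Prop :=
  ∀ (N : ℕ) (C : Set H), C ⊆ C₀ →
    (∀ C' ⊆ C, (∀ g ∈ C', ∀ g' ∈ C', R g g') → Win Good S N C') → Win Good S (N + m) C

/-- Pairs of candidates can be separated by several criteria in turn. -/
theorem Separates.list {H : Type*} [Group H] {k : ℕ} {Good : H → SLP k → Prop} {S : Set (H → H)}
    {C₀ : Set H} {m : ℕ} {ι : Type*} {R : ι → H → H → Prop} (l : List ι)
    (h : ∀ i ∈ l, Separates Good S C₀ m (R i)) :
    Separates Good S C₀ (l.length * m) (fun g g' => ∀ i ∈ l, R i g g') := by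
  induction l with
  | nil =>
    intro N C hC hwin
    exact (hwin C subset_rfl (by simp)).mono_cost (by omega)
  | cons i l ih =>
    intro N C hC hwin
    have := h i (by simp) (N + l.length * m) C hC fun C' hC' hR =>
      ih (fun j hj => h j (by simp [hj])) N C' (hC'.trans hC) fun C'' hC'' hR' =>
        hwin C'' (hC''.trans hC') fun g hg g' hg' j hj => by
          rcases List.mem_cons.1 hj with rfl | hj
          · exact hR g (hC'' hg) g' (hC'' hg')
          · exact hR' g hg g' hg' j hj
    exact this.mono_cost (by simp; ring_nf; omega)

/-! ### The action of the standard generators on row vectors -/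

namespace SpGen

open Matrix

variable {n : ℕ} {F : Type*} [Field F]

theorem form_eq_sum (x y : Fin n ⊕ Fin n → F) :
    form x y = ∑ i, (x (.inr i) * y (.inl i) - x (.inl i) * y (.inr i)) := by
  simp [form, J, dotProduct, Matrix.mulVec, Fintype.sum_sum_type, Matrix.fromBlocks,
    Matrix.one_apply, Finset.sum_sub_distrib]
  ring

theorem form_neg_swap (x y : Fin n ⊕ Fin n → F) : form x y = -form y x := by
  rw [form_eq_sum, form_eq_sum, ← Finset.sum_neg_distrib]
  exact Finset.sum_congr rfl fun i _ => by ring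

theorem form_self (x : Fin n ⊕ Fin n → F) : form x x = 0 := by
  rw [form_eq_sum]
  exact Finset.sum_eq_zero fun i _ => by ring

theorem form_zero_left (x : Fin n ⊕ Fin n → F) : form 0 x = 0 := by simp [form]

theorem form_sub_left (x y z : Fin n ⊕ Fin n → F) : form (x - y) z = form x z - form y z := by
  rw [sub_eq_add_neg, form_add_left, form_neg_left, sub_eq_add_neg]

theorem form_e_left (i : Fin n) (y : Fin n ⊕ Fin n → F) : form (e F i) y = -y (.inr i) := by
  simp [form_eq_sum, e, Pi.single_apply]

theorem form_f_left (i : Fin n) (y : Fin n ⊕ Fin n → F) : form (f F i) y = y (.inl i) := by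
  simp [form_eq_sum, f, Pi.single_apply]

/-- The image of a row vector under an element of the symplectic group. -/
def act (y : Fin n ⊕ Fin n → F) (g : symplecticGroup (Fin n) F) : Fin n ⊕ Fin n → F :=
  y ᵥ* (g : Matrix (Fin n ⊕ Fin n) (Fin n ⊕ Fin n) F)

theorem act_add (y z : Fin n ⊕ Fin n → F) (g : symplecticGroup (Fin n) F) :
    act (y + z) g = act y g + act z g :=
  add_vecMul _ _ _

theorem act_smul (a : F) (y : Fin n ⊕ Fin n → F) (g : symplecticGroup (Fin n) F) :
    act (a • y) g = a • act y g :=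
  smul_vecMul _ _ _

theorem form_act (g : symplecticGroup (Fin n) F) (x y : Fin n ⊕ Fin n → F) :
    form (act x g) (act y g) = form x y := by
  have h := SymplecticGroup.mem_iff.1 g.2
  simp only [form, act]
  rw [← dotProduct_mulVec, ← mulVec_transpose _ y, mulVec_mulVec, mulVec_mulVec, h]

theorem act_mul (g h : symplecticGroup (Fin n) F) (y : Fin n ⊕ Fin n → F) :
    act y (g * h) =
      act (act y g) h := by
  simp only [act, vecMul_vecMul]
  rfl

theorem act_one (y : Fin n ⊕ Fin n → F) :
    act y 1 = y :=
  vecMul_one y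

theorem act_inv (g : symplecticGroup (Fin n) F) {y z : Fin n ⊕ Fin n → F}
    (h : act y g = z) :
    act z g⁻¹ = y := by
  rw [← h, ← act_mul, mul_inv_cancel, act_one]

theorem eq_of_act_eq {g h : symplecticGroup (Fin n) F}
    (H : ∀ y : Fin n ⊕ Fin n → F, act y g = act y h) : g = h := by
  apply Subtype.ext
  ext i j
  have := congrFun (H (Pi.single i 1)) j
  simpa [act] using this

theorem eq_sum_e_f (y : Fin n ⊕ Fin n → F) :
    y = ∑ i, y (.inl i) • e F i + ∑ i, y (.inr i) • f F i := by
  ext (c | c) <;> simp [e, f, Pi.single_apply]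

theorem eq_of_e_f {g h : symplecticGroup (Fin n) F}
    (h₁ : ∀ i, act (e F i) g = act (e F i) h)
    (h₂ : ∀ i, act (f F i) g = act (f F i) h) : g = h := by
  apply Subtype.ext
  ext i j
  rcases i with i | i
  · have := congrFun (h₁ i) j
    simpa [act, e] using this
  · have := congrFun (h₂ i) j
    simpa [act, f] using this

theorem vecMul_ofImages (y : Fin n ⊕ Fin n → F) (E E' : Fin n → (Fin n ⊕ Fin n → F)) :
    y ᵥ* ofImages E E' = ∑ i, y (.inl i) • E i + ∑ i, y (.inr i) • E' i := by
  ext c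
  simp [vecMul, dotProduct, ofImages, Fintype.sum_sum_type]

theorem act_s (hn : 2 ≤ n) (y : Fin n ⊕ Fin n → F) :
    act y (s F hn) =
      Sum.elim (fun i => if i = i₁ hn then -y (.inr i) else y (.inl i))
        (fun i => if i = i₁ hn then y (.inl i) else y (.inr i)) := by
  simp only [act, s, vecMul_ofImages]
  ext (c | c) <;> by_cases h : c = i₁ hn <;>
    simp [e, f, Pi.single_apply, h, apply_ite, Finset.sum_ite, Finset.filter_eq',
      Finset.filter_ne']

theorem act_δ (ω : Fˣ) (hn : 2 ≤ n) (y : Fin n ⊕ Fin n → F) :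
    act y (δ ω hn) =
      Sum.elim (fun i => if i = i₁ hn then y (.inl i) * ω else y (.inl i))
        (fun i => if i = i₁ hn then y (.inr i) * (ω : F)⁻¹ else y (.inr i)) := by
  simp only [act, δ, vecMul_ofImages]
  ext (c | c) <;> by_cases h : c = i₁ hn <;>
    simp [e, f, Pi.single_apply, h, apply_ite, Finset.sum_ite, Finset.filter_eq',
      Finset.filter_ne']

theorem act_x (hn : 2 ≤ n) (y : Fin n ⊕ Fin n → F) :
    act y (x F hn) =
      Sum.elim (fun i => if i = i₁ hn then y (.inl i) + y (.inr (i₂ hn))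
        else if i = i₂ hn then y (.inl i) + y (.inr (i₁ hn)) else y (.inl i))
        (fun i => y (.inr i)) := by
  have h12 := i₁_ne_i₂ hn
  have key : ∀ i, (if i = i₁ hn then f F (i₁ hn) + e F (i₂ hn)
        else if i = i₂ hn then f F (i₂ hn) + e F (i₁ hn) else f F i) =
      f F i + ((if i = i₁ hn then e F (i₂ hn) else 0) +
        (if i = i₂ hn then e F (i₁ hn) else 0)) := by
    intro i
    by_cases h1 : i = i₁ hn
    · subst h1
      simp [h12]
    · by_cases h2 : i = i₂ hn
      · subst h2
        simp [h12.symm]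
      · simp [h1, h2]
  have : act y (x F hn) =
      y + (y (.inr (i₁ hn)) • e F (i₂ hn) + y (.inr (i₂ hn)) • e F (i₁ hn)) := by
    simp only [act, x, vecMul_ofImages, key, smul_add, Finset.sum_add_distrib, smul_ite, smul_zero,
      Finset.sum_ite_eq', Finset.mem_univ, if_true]
    nth_rw 5 [eq_sum_e_f y]
    rw [add_assoc]
  rw [this]
  ext (c | c)
  · by_cases h1 : c = i₁ hn
    · subst h1
      simp [e, h12]
    · by_cases h2 : c = i₂ hn
      · subst h2
        simp [e, h12.symm]
      · simp [e, h1, h2]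
  · simp [e]

/-- `g` permutes the indices `1, …, n` of the hyperbolic pairs by `σ`. -/
def PermutesBy (g : symplecticGroup (Fin n) F) (σ : Equiv.Perm (Fin n)) : Prop :=
  ∀ (y : Fin n ⊕ Fin n → F) (i : Fin n),
    (act y g) (.inl (σ i)) = y (.inl i) ∧
    (act y g) (.inr (σ i)) = y (.inr i)

theorem PermutesBy.mul {g h : symplecticGroup (Fin n) F} {σ τ : Equiv.Perm (Fin n)}
    (hg : PermutesBy g σ) (hh : PermutesBy h τ) : PermutesBy (g * h) (τ * σ) := by
  intro y i
  rw [act_mul, Equiv.Perm.mul_apply]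
  exact ⟨(hh _ _).1.trans (hg _ _).1, (hh _ _).2.trans (hg _ _).2⟩

theorem PermutesBy.pow {g : symplecticGroup (Fin n) F} {σ : Equiv.Perm (Fin n)}
    (hg : PermutesBy g σ) (m : ℕ) : PermutesBy (g ^ m) (σ ^ m) := by
  induction m with
  | zero =>
    intro y i
    rw [pow_zero, act_one]
    exact ⟨rfl, rfl⟩
  | succ m ih =>
    rw [pow_succ, pow_succ']
    exact ih.mul hg

theorem permutesBy_of_ofImages (g : symplecticGroup (Fin n) F) (σ : Equiv.Perm (Fin n))
    (h : (g : Matrix _ _ F) = ofImages (fun i => e F (σ i)) (fun i => f F (σ i))) :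
    PermutesBy g σ := by
  intro y i
  rw [act, h, vecMul_ofImages]
  constructor <;> simp [e, f, Pi.single_apply]

theorem permutesBy_u (hn : 2 ≤ n) : PermutesBy (u F hn) (Equiv.swap (i₁ hn) (i₂ hn)) :=
  permutesBy_of_ofImages _ _ rfl

theorem permutesBy_v : PermutesBy (v n F) (finRotate n) :=
  permutesBy_of_ofImages _ _ rfl

theorem finRotate_pow_i₁ (hn : 2 ≤ n) {m : ℕ} (hm : m < n) :
    (finRotate n ^ m) (i₁ hn) = ⟨m, hm⟩ := by
  obtain ⟨k, rfl⟩ : ∃ k, n = k + 1 := ⟨n - 1, by omega⟩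
  induction m with
  | zero => rfl
  | succ m ih =>
    rw [pow_succ', Equiv.Perm.mul_apply, ih (by omega), finRotate_of_lt (by omega)]

/-- The permutation by which `v * u` acts: it fixes the first index and rotates the others. -/
def rot₂ (hn : 2 ≤ n) : Equiv.Perm (Fin n) := Equiv.swap (i₁ hn) (i₂ hn) * finRotate n

theorem permutesBy_v_mul_u (hn : 2 ≤ n) : PermutesBy (v n F * u F hn) (rot₂ hn) :=
  permutesBy_v.mul (permutesBy_u hn)

theorem rot₂_i₁ (hn : 2 ≤ n) : rot₂ hn (i₁ hn) = i₁ hn := by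
  have := finRotate_pow_i₁ hn (m := 1) (by omega)
  rw [pow_one] at this
  rw [rot₂, Equiv.Perm.mul_apply, this]
  exact Equiv.swap_apply_right _ _

theorem rot₂_pow_i₁ (hn : 2 ≤ n) (m : ℕ) : (rot₂ hn ^ m) (i₁ hn) = i₁ hn := by
  induction m with
  | zero => rfl
  | succ m ih => rw [pow_succ, Equiv.Perm.mul_apply, rot₂_i₁, ih]

theorem rot₂_pow_i₂ (hn : 2 ≤ n) {m : ℕ} (hm : m + 1 < n) :
    (rot₂ hn ^ m) (i₂ hn) = ⟨m + 1, hm⟩ := by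
  obtain ⟨k, rfl⟩ : ∃ k, n = k + 1 := ⟨n - 1, by omega⟩
  induction m with
  | zero => rfl
  | succ m ih =>
    rw [pow_succ', Equiv.Perm.mul_apply, ih (by omega), rot₂, Equiv.Perm.mul_apply,
      finRotate_of_lt (by omega)]
    exact Equiv.swap_apply_of_ne_of_ne (by simp [i₁]) (by simp [i₂])

/-! ### Transvections -/

/-- The matrix of `y ↦ y + a (v, y) v`. -/
def transvection (v : Fin n ⊕ Fin n → F) (a : F) : symplecticGroup (Fin n) F :=
  ⟨ofImages (fun i => e F i + (a * form v (e F i)) • v)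
      (fun i => f F i + (a * form v (f F i)) • v), by
    apply ofImages_mem <;> intro i j <;>
      simp only [form_add_left, form_add_right, form_smul_left, form_smul_right, form_e_e, form_f_f,
        form_e_f, form_f_e, form_self, form_neg_swap _ v] <;> ring⟩

theorem act_transvection (v : Fin n ⊕ Fin n → F) (a : F) (y : Fin n ⊕ Fin n → F) :
    act y (transvection v a) = y + (a * form v y) • v := by
  have hv : form v y = ∑ i, y (.inl i) * form v (e F i) + ∑ i, y (.inr i) * form v (f F i) := by
    simp only [form_neg_swap v (e F _), form_neg_swap v (f F _), form_e_left, form_f_left,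
      form_eq_sum v y, ← Finset.sum_add_distrib]
    exact Finset.sum_congr rfl fun i _ => by ring
  simp only [act, transvection, vecMul_ofImages, smul_add, Finset.sum_add_distrib]
  rw [hv, mul_add, Finset.mul_sum, Finset.mul_sum, add_smul, Finset.sum_smul, Finset.sum_smul]
  nth_rw 5 [eq_sum_e_f y]
  simp only [smul_smul, mul_left_comm]
  abel

theorem transvection_zero_left (a : F) : transvection (0 : Fin n ⊕ Fin n → F) a = 1 :=
  eq_of_act_eq fun y => by simp [act_transvection, act_one]

theorem transvection_add (v : Fin n ⊕ Fin n → F) (a b : F) :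
    transvection v (a + b) = transvection v a * transvection v b :=
  eq_of_act_eq fun y => by
    simp only [act_mul, act_transvection, form_add_right, form_smul_right, form_self,
      mul_zero, add_zero, add_mul, add_smul, add_assoc]

theorem transvection_smul (v : Fin n ⊕ Fin n → F) (b : F) :
    transvection (b • v) 1 = transvection v (b ^ 2) :=
  eq_of_act_eq fun y => by
    simp only [act_transvection, form_smul_left, smul_smul]
    congr 2
    ring

theorem conj_transvection (g : symplecticGroup (Fin n) F) (v : Fin n ⊕ Fin n → F) (a : F) :
    g⁻¹ * transvection v a * g = transvection (act v g) a := by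
  rw [mul_assoc, inv_mul_eq_iff_eq_mul]
  refine eq_of_act_eq fun y => ?_
  simp only [act_mul, act_transvection, form_act, act_add, act_smul]

theorem t_eq_transvection (hn : 2 ≤ n) : t F hn = transvection (f F (i₁ hn)) 1 := by
  apply Subtype.ext
  simp only [t, transvection]
  congr 1 <;> funext i
  · by_cases h : i = i₁ hn
    · subst h
      simp [form_f_e]
    · simp [form_f_e, h, Ne.symm h]
  · simp [form_f_f]

/-- Two transvections commute if and only if their centres are perpendicular. -/
theorem transvection_comm_iff {v w : Fin n ⊕ Fin n → F} (hv : v ≠ 0) :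
    transvection v 1 * transvection w 1 = transvection w 1 * transvection v 1 ↔ form v w = 0 := by
  have hL : ∀ y, act y (transvection v 1 * transvection w 1) =
      y + form v y • v + form w y • w + (form v y * form w v) • w := by
    intro y
    simp only [act_mul, act_transvection, form_add_right, form_smul_right, one_mul,
      add_smul]
    abel
  have hR : ∀ y, act y (transvection w 1 * transvection v 1) =
      y + form v y • v + form w y • w + (form w y * form v w) • v := by
    intro y
    simp only [act_mul, act_transvection, form_add_right, form_smul_right, one_mul,
      add_smul]
    abel
  constructor
  · intro h
    by_contra hvw
    have key : ∀ y, (form v y * form w v) • w = (form w y * form v w) • v := by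
      intro y
      have := hL y
      rw [h, hR y] at this
      exact (add_left_cancel this).symm
    -- Evaluate at `y = v`, where `(v, y) = 0`.
    have := key v
    rw [form_self, zero_mul, zero_smul, form_neg_swap w v] at this
    have h0 := smul_eq_zero.1 this.symm
    rcases h0 with h0 | h0
    · simp [hvw] at h0
    · exact hv h0
  · intro h
    refine eq_of_act_eq fun y => ?_
    rw [hL, hR, form_neg_swap w v, h]
    simp

theorem exists_form_ne_zero {v : Fin n ⊕ Fin n → F} (hv : v ≠ 0) :
    ∃ k, form v (Pi.single k 1) ≠ 0 := by
  by_contra! h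
  apply hv
  ext (i | i)
  · have := h (.inr i)
    rw [form_neg_swap] at this
    simpa [form_f_left, f] using (neg_eq_zero.1 this).symm ▸ (form_f_left i v).symm
  · have := h (.inl i)
    rw [form_neg_swap] at this
    have h2 := form_e_left i v
    rw [e, neg_eq_zero.1 this] at h2
    simpa using h2.symm

end SpGen

/-! ### Short programs for the elements of the symplectic group -/

namespace SpGen

open Matrix

variable {n : ℕ} {F : Type*} [Field F] {hn : 2 ≤ n} {ω : Fˣ}

/-- `g` can be computed from the standard generators with `c` operations. -/
def Cost (hn : 2 ≤ n) (ω : Fˣ) (c : ℕ) (g : symplecticGroup (Fin n) F) : Prop :=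
  Obtains (Set.range (stdGen hn ω)) c {g}

theorem Cost.mono {c d : ℕ} {g : symplecticGroup (Fin n) F} (h : Cost hn ω c g) (hcd : c ≤ d) :
    Cost hn ω d g :=
  Obtains.mono_cost h hcd

theorem Cost.mul {c d : ℕ} {g h : symplecticGroup (Fin n) F} (hg : Cost hn ω c g)
    (hh : Cost hn ω d h) : Cost hn ω (c + d + 1) (g * h) :=
  Obtains.mul_single hg hh

theorem Cost.inv {c : ℕ} {g : symplecticGroup (Fin n) F} (hg : Cost hn ω c g) :
    Cost hn ω (c + 1) g⁻¹ :=
  Obtains.inv_single hg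

theorem Cost.conj {c d : ℕ} {g h : symplecticGroup (Fin n) F} (hg : Cost hn ω c g)
    (hh : Cost hn ω d h) : Cost hn ω (c + d + 3) (h⁻¹ * g * h) :=
  Obtains.conj_single hg hh

theorem Cost.pow {c k q : ℕ} {g : symplecticGroup (Fin n) F} (hg : Cost hn ω c g) (hk : k < q) :
    Cost hn ω (c + (2 * Nat.log 2 q + 2)) (g ^ k) :=
  Obtains.pow_single hg hk

theorem cost_stdGen (i : Fin 6) : Cost hn ω 0 (stdGen hn ω i) :=
  Obtains.of_subset _ (by simp)

theorem cost_s : Cost hn ω 0 (s F hn) := cost_stdGen 0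
theorem cost_t : Cost hn ω 0 (t F hn) := cost_stdGen 1
theorem cost_δ : Cost hn ω 0 (δ ω hn) := cost_stdGen 2
theorem cost_u : Cost hn ω 0 (u F hn) := cost_stdGen 3
theorem cost_v : Cost hn ω 0 (v n F) := cost_stdGen 4
theorem cost_x : Cost hn ω 0 (x F hn) := cost_stdGen 5

theorem cost_one : Cost hn ω 2 (1 : symplecticGroup (Fin n) F) :=
  Obtains.one_of_mem (Set.mem_range_self 0)

theorem act_δ_pow (k : ℕ) (y : Fin n ⊕ Fin n → F) :
    act y (δ ω hn ^ k) =
      Sum.elim (fun i => if i = i₁ hn then y (.inl i) * (ω : F) ^ k else y (.inl i))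
        (fun i => if i = i₁ hn then y (.inr i) * ((ω : F)⁻¹) ^ k else y (.inr i)) := by
  induction k with
  | zero => ext (c | c) <;> simp [act_one]
  | succ k ih =>
    rw [pow_succ, act_mul, ih, act_δ]
    ext (c | c) <;> by_cases h : c = i₁ hn <;> simp [h, pow_succ, mul_assoc]

/-- `z` is the image of `y` under an element that has a program with `c` operations. -/
def Reach (hn : 2 ≤ n) (ω : Fˣ) (c : ℕ) (y z : Fin n ⊕ Fin n → F) : Prop :=
  ∃ g : symplecticGroup (Fin n) F, Cost hn ω c g ∧ act y g = z

theorem Reach.trans {c d : ℕ} {y z w : Fin n ⊕ Fin n → F} (h : Reach hn ω c y z)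
    (h' : Reach hn ω d z w) : Reach hn ω (c + d + 1) y w := by
  obtain ⟨g, hg, rfl⟩ := h
  obtain ⟨g', hg', rfl⟩ := h'
  exact ⟨g * g', hg.mul hg', act_mul _ _ _⟩

/-- The conjugate of `s` that moves the second hyperbolic pair. -/
def s₂ (F : Type*) [Field F] (hn : 2 ≤ n) : symplecticGroup (Fin n) F :=
  u F hn * s F hn * u F hn

theorem act_s₂ (y : Fin n ⊕ Fin n → F) :
    act y (s₂ F hn) =
      Sum.elim (fun i => if i = i₂ hn then -y (.inr i) else y (.inl i))
        (fun i => if i = i₂ hn then y (.inl i) else y (.inr i)) := by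
  have hu : ∀ (y : Fin n ⊕ Fin n → F), act y (u F hn) =
      Sum.elim (fun i => y (.inl (Equiv.swap (i₁ hn) (i₂ hn) i)))
        (fun i => y (.inr (Equiv.swap (i₁ hn) (i₂ hn) i))) := by
    intro y
    ext (c | c)
    · have := (permutesBy_u hn y (Equiv.swap (i₁ hn) (i₂ hn) c)).1
      simpa using this
    · have := (permutesBy_u hn y (Equiv.swap (i₁ hn) (i₂ hn) c)).2
      simpa using this
  have hc : ∀ c, Equiv.swap (i₁ hn) (i₂ hn) c = i₁ hn ↔ c = i₂ hn := by
    intro c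
    rw [Equiv.swap_apply_eq_iff, Equiv.swap_apply_left]
  rw [s₂, act_mul, act_mul, hu, act_s, hu]
  ext (c | c) <;> simp [hc]

theorem cost_s₂ : Cost hn ω 2 (s₂ F hn) :=
  (cost_u.mul cost_s).mul cost_u

variable [Finite F]

theorem exists_pow_eq (hω : ∀ a : Fˣ, a ∈ Subgroup.zpowers ω) {a : F} (ha : a ≠ 0) :
    ∃ k < Nat.card F, (ω : F) ^ k = a := by
  classical
  have h := hω (Units.mk0 a ha)
  rw [← mem_powers_iff_mem_zpowers, mem_powers_iff_mem_range_orderOf] at h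
  simp only [Finset.mem_image, Finset.mem_range] at h
  obtain ⟨k, hk, hk'⟩ := h
  refine ⟨k, hk.trans_le ?_, ?_⟩
  · exact (orderOf_le_card).trans (Nat.card_le_card_of_injective _ Units.val_injective)
  · simpa using congrArg Units.val hk'

/-- The element `f₁ ↦ f₁ + a e₂`, `f₂ ↦ f₂ + a e₁` has a short program: for `a = ω ^ k` it is the
conjugate of `x` by `δ ^ k`. -/
theorem exists_cost_act_add (hω : ∀ a : Fˣ, a ∈ Subgroup.zpowers ω) (a : F) :
    ∃ g : symplecticGroup (Fin n) F, Cost hn ω (2 * Nat.log 2 (Nat.card F) + 5) g ∧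
      ∀ y, act y g = Sum.elim (fun i => if i = i₁ hn then y (.inl i) + a * y (.inr (i₂ hn))
        else if i = i₂ hn then y (.inl i) + a * y (.inr (i₁ hn)) else y (.inl i))
        (fun i => y (.inr i)) := by
  rcases eq_or_ne a 0 with rfl | ha
  · refine ⟨1, cost_one.mono (by omega), fun y => ?_⟩
    ext (c | c) <;> simp [act_one]
  · obtain ⟨k, hk, rfl⟩ := exists_pow_eq hω ha
    refine ⟨(δ ω hn ^ k)⁻¹ * x F hn * δ ω hn ^ k, (cost_x.conj (cost_δ.pow hk)).mono (by omega),
      fun y => ?_⟩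
    have h12 := i₁_ne_i₂ hn
    have hω0 : (ω : F) ≠ 0 := ω.ne_zero
    obtain ⟨z, rfl⟩ : ∃ z, act z (δ ω hn ^ k) = y :=
      ⟨act y (δ ω hn ^ k)⁻¹, act_inv _ (z := y) (y := act y (δ ω hn ^ k)⁻¹) (by
        rw [← act_mul, inv_mul_cancel, act_one]) ▸ by rw [← act_mul, inv_mul_cancel, act_one]⟩
    rw [act_mul, act_mul, act_inv _ rfl, act_x, act_δ_pow, act_δ_pow]
    ext (c | c)
    · by_cases h1 : c = i₁ hn
      · subst h1
        simp [h12.symm]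
        ring
      · by_cases h2 : c = i₂ hn
        · subst h2
          simp [h12.symm]
          field_simp
        · simp [h1, h2]
    · simp

/-- A vector whose coefficient at `f₁` is not zero can be moved to one whose coefficients at `e₂`
and `f₂` vanish, changing otherwise only the coefficient at `e₁`. -/
theorem exists_reach_clear (hω : ∀ a : Fˣ, a ∈ Subgroup.zpowers ω) {y : Fin n ⊕ Fin n → F}
    (hy : y (.inr (i₁ hn)) ≠ 0) :
    ∃ z, Reach hn ω (4 * Nat.log 2 (Nat.card F) + 14) y z ∧ z (.inr (i₁ hn)) = y (.inr (i₁ hn)) ∧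
      z (.inl (i₂ hn)) = 0 ∧ z (.inr (i₂ hn)) = 0 ∧
      ∀ i, i ≠ i₁ hn → i ≠ i₂ hn → z (.inl i) = y (.inl i) ∧ z (.inr i) = y (.inr i) := by
  have h12 := i₁_ne_i₂ hn
  obtain ⟨g, hg, hg'⟩ := exists_cost_act_add (hn := hn) hω (-y (.inl (i₂ hn)) / y (.inr (i₁ hn)))
  obtain ⟨h, hh, hh'⟩ := exists_cost_act_add (hn := hn) hω (y (.inr (i₂ hn)) / y (.inr (i₁ hn)))
  refine ⟨_, ⟨_, ((hg.mul cost_s₂).mul hh).mono (by omega), rfl⟩, ?_⟩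
  rw [act_mul, act_mul, hg', act_s₂, hh']
  refine ⟨?_, ?_, ?_, ?_⟩
  · simp [h12]
  · simp [h12, h12.symm]
    field_simp
    ring
  · simp [h12.symm]
    field_simp
    ring
  · intro i hi1 hi2
    simp [hi1, hi2]

/-- A multiple of `f₁` can be reached from `a e₁ + b f₁` if `b ≠ 0`. Here the commutator of two
elements `f₁ ↦ f₁ + ⋯` changes the coefficient at `e₁`, which needs that `2` is invertible. -/
theorem exists_reach_clear_e₁ (hω : ∀ a : Fˣ, a ∈ Subgroup.zpowers ω) (h2 : (2 : F) ≠ 0)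
    {y : Fin n ⊕ Fin n → F} (hy : y (.inr (i₁ hn)) ≠ 0)
    (h0 : ∀ i, i ≠ i₁ hn → y (.inl i) = 0 ∧ y (.inr i) = 0) :
    Reach hn ω (8 * Nat.log 2 (Nat.card F) + 32) y (y (.inr (i₁ hn)) • f F (i₁ hn)) := by
  have h12 := i₁_ne_i₂ hn
  obtain ⟨g, hg, hg'⟩ := exists_cost_act_add (hn := hn) hω
    (-y (.inl (i₁ hn)) / (2 * y (.inr (i₁ hn))))
  obtain ⟨h, hh, hh'⟩ := exists_cost_act_add (hn := hn) hω 1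
  refine ⟨_, ((((((hg.mul cost_s₂).mul hh).mul cost_s₂).mul hg).mul cost_s₂).mul hh).mono
    (by omega), ?_⟩
  simp only [act_mul, hg', act_s₂, hh']
  have hz := h0 (i₂ hn) h12.symm
  ext (c | c)
  · by_cases h1 : c = i₁ hn
    · subst h1
      simp [h12, h12.symm, hz, f]
      field_simp
      ring
    · by_cases h2 : c = i₂ hn
      · subst h2
        simp [h12, h12.symm, hz, f]
      · simp [h1, h2, f, h0 c h1]
  · by_cases h1 : c = i₁ hn
    · subst h1
      simp [h12, h12.symm, f]
    · by_cases h2 : c = i₂ hn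
      · subst h2
        simp [h12, h12.symm, hz, f]
      · simp [h1, h2, f, h0 c h1]

end SpGen

/-! ### Reaching `f₁` from an arbitrary vector -/

namespace SpGen

open Matrix

variable {n : ℕ} {F : Type*} [Field F] {hn : 2 ≤ n} {ω : Fˣ}

theorem Reach.mono {c d : ℕ} {y z : Fin n ⊕ Fin n → F} (h : Reach hn ω c y z) (hcd : c ≤ d) :
    Reach hn ω d y z :=
  h.imp fun _ h => ⟨h.1.mono hcd, h.2⟩

theorem reach_refl (y : Fin n ⊕ Fin n → F) : Reach hn ω 2 y y :=
  ⟨1, cost_one, act_one y⟩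

theorem two_ne_zero_of_odd_card (hF : Odd (Nat.card F)) : (2 : F) ≠ 0 := by
  have : Finite F := Nat.finite_of_card_ne_zero (by rintro h; simp [h] at hF)
  have := Fintype.ofFinite F
  rw [Nat.card_eq_fintype_card] at hF
  apply Ring.two_ne_zero
  rintro h
  have := FiniteField.even_card_of_char_two h
  rw [← Nat.not_even_iff_odd] at hF
  exact hF (Nat.even_iff.2 this)

variable [Finite F]

/-- Clearing the coefficients at `e₂` and `f₂` and rotating the indices `2, …, n`, repeatedly. -/
theorem exists_reach_rotate (hω : ∀ a : Fˣ, a ∈ Subgroup.zpowers ω) {y : Fin n ⊕ Fin n → F}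
    (hy : y (.inr (i₁ hn)) ≠ 0) (k : ℕ) :
    ∃ z, Reach hn ω (k * (4 * Nat.log 2 (Nat.card F) + 17) + 2) y z ∧
      z (.inr (i₁ hn)) = y (.inr (i₁ hn)) ∧
      ∀ m, m < k → z (.inl ((rot₂ hn ^ (m + 1)) (i₂ hn))) = 0 ∧
        z (.inr ((rot₂ hn ^ (m + 1)) (i₂ hn))) = 0 := by
  induction k with
  | zero => exact ⟨y, (reach_refl y).mono (by omega), rfl, by omega⟩
  | succ k ih =>
    obtain ⟨z, hz, hz1, hz0⟩ := ih
    obtain ⟨w, hw, hw1, hwl, hwr, hw0⟩ := exists_reach_clear hω (hz1 ▸ hy)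
    refine ⟨act w (v n F * u F hn), ((hz.trans hw).trans ⟨_, cost_v.mul cost_u, rfl⟩).mono
      (by ring_nf; omega), ?_, ?_⟩
    · have := (permutesBy_v_mul_u hn w (i₁ hn)).2
      rw [rot₂_i₁] at this
      rw [this, hw1, hz1]
    · intro m hm
      rw [pow_succ', Equiv.Perm.mul_apply, (permutesBy_v_mul_u hn w _).1,
        (permutesBy_v_mul_u hn w _).2]
      by_cases h2 : (rot₂ hn ^ m) (i₂ hn) = i₂ hn
      · rw [h2]
        exact ⟨hwl, hwr⟩
      · obtain ⟨m, rfl⟩ : ∃ m', m = m' + 1 := ⟨m - 1, by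
          rcases m with _ | m
          · simp at h2
          · omega⟩
        have h1 : (rot₂ hn ^ (m + 1)) (i₂ hn) ≠ i₁ hn := by
          intro h
          rw [← rot₂_pow_i₁ hn (m + 1)] at h
          exact i₁_ne_i₂ hn ((rot₂ hn ^ (m + 1)).injective h).symm
        rw [(hw0 _ h1 h2).1, (hw0 _ h1 h2).2]
        exact hz0 m (by omega)

theorem one_le_log_card : 1 ≤ Nat.log 2 (Nat.card F) := by
  have : 1 < Nat.card F := Finite.one_lt_card
  exact Nat.log_pos (by norm_num) (by omega)

/-- Every non-zero vector can be moved to `f₁` with `O(n log q)` operations: a hyperbolic pair with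
a non-zero coefficient is rotated to the first place, then the coefficients at the other pairs and
at `e₁` are cleared, and the remaining coefficient is normalized with a power of `δ`. -/
theorem reach_f₁ (hω : ∀ a : Fˣ, a ∈ Subgroup.zpowers ω) (hF : Odd (Nat.card F))
    {y : Fin n ⊕ Fin n → F} (hy : y ≠ 0) :
    Reach hn ω (64 * (n * Nat.log 2 (Nat.card F))) y (f F (i₁ hn)) := by
  have h12 := i₁_ne_i₂ hn
  -- Rotate a hyperbolic pair with a non-zero coefficient to the first place.
  obtain ⟨z, hz, hz0⟩ : ∃ z, Reach hn ω (2 * Nat.log 2 n + 3) y z ∧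
      (z (.inl (i₁ hn)) ≠ 0 ∨ z (.inr (i₁ hn)) ≠ 0) := by
    obtain ⟨i, hi⟩ : ∃ i : Fin n, y (.inl i) ≠ 0 ∨ y (.inr i) ≠ 0 := by
      by_contra! h
      exact hy (by ext (c | c) <;> simp [h c])
    refine ⟨_, ⟨_, ((cost_v.pow i.2).inv).mono (by omega), rfl⟩, ?_⟩
    have h := permutesBy_v.pow i (act y (v n F ^ (i : ℕ))⁻¹) (i₁ hn)
    rw [finRotate_pow_i₁ hn i.2, ← act_mul, inv_mul_cancel, act_one] at h
    rwa [← h.1, ← h.2]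
  obtain ⟨w, hw, hw0⟩ : ∃ w, Reach hn ω 2 z w ∧ w (.inr (i₁ hn)) ≠ 0 := by
    by_cases h : z (.inr (i₁ hn)) = 0
    · exact ⟨_, ⟨_, cost_s.mono (by omega), rfl⟩, by simpa [act_s, h] using hz0⟩
    · exact ⟨z, reach_refl z, h⟩
  obtain ⟨a, ha, ha1, ha0⟩ := exists_reach_rotate hω hw0 (n - 2)
  rw [← ha1] at hw0
  obtain ⟨b, hb, hb1, hbl, hbr, hb0⟩ := exists_reach_clear hω hw0
  rw [← hb1] at hw0
  have hb0' : ∀ i, i ≠ i₁ hn → b (.inl i) = 0 ∧ b (.inr i) = 0 := by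
    intro i hi
    by_cases h2 : i = i₂ hn
    · rw [h2]
      exact ⟨hbl, hbr⟩
    · obtain ⟨m, hm⟩ : ∃ m, (i : ℕ) = m + 2 := ⟨i - 2, by
        have h1 : (i : ℕ) ≠ 0 := fun h => hi (Fin.ext h)
        have h2 : (i : ℕ) ≠ 1 := fun h => h2 (Fin.ext h)
        omega⟩
      have := ha0 m (by omega)
      rw [rot₂_pow_i₂ hn (m := m + 1) (by omega)] at this
      rw [(hb0 i hi h2).1, (hb0 i hi h2).2]
      have hi' : i = ⟨m + 1 + 1, by omega⟩ := Fin.ext hm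
      rwa [← hi'] at this
  have hc := exists_reach_clear_e₁ hω (two_ne_zero_of_odd_card hF) hw0 hb0'
  obtain ⟨k, hk, hk'⟩ := exists_pow_eq hω hw0
  have hd : Reach hn ω (2 * Nat.log 2 (Nat.card F) + 2) (b (.inr (i₁ hn)) • f F (i₁ hn))
      (f F (i₁ hn)) := by
    refine ⟨_, (cost_δ.pow hk).mono (by omega), ?_⟩
    rw [act_δ_pow, ← hk']
    ext (c | c)
    · simp [f]
    · by_cases h1 : c = i₁ hn
      · subst h1
        simp [f]
      · simp [h1, f]
  refine (((((hz.trans hw).trans ha).trans hb).trans hc).trans hd).mono ?_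
  have hL := one_le_log_card (F := F)
  have hlog := Nat.log_le_self 2 n
  generalize Nat.log 2 (Nat.card F) = L at *
  have h1 : n ≤ n * L := Nat.le_mul_of_pos_right _ hL
  have h2 : 2 * L ≤ n * L := Nat.mul_le_mul_right _ hn
  have h3 : (n - 2) * (4 * L + 17) ≤ n * (4 * L + 17) := Nat.mul_le_mul_right _ (by omega)
  have h4 : n * (4 * L + 17) = 4 * (n * L) + 17 * n := by ring
  omega

theorem exists_sq_add_sq (hF : Odd (Nat.card F)) (a : F) : ∃ b c : F, a = b ^ 2 + c ^ 2 := by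
  classical
  have := Fintype.ofFinite F
  rw [Nat.card_eq_fintype_card] at hF
  obtain ⟨b, c, h⟩ := FiniteField.exists_root_sum_quadratic (R := F) (f := Polynomial.X ^ 2)
    (g := Polynomial.X ^ 2 - Polynomial.C a) (by simp)
    (Polynomial.degree_X_pow_sub_C (by norm_num) _)
    (Nat.odd_iff.1 hF)
  refine ⟨b, c, ?_⟩
  simp at h
  linear_combination -h

/-- This transvection is conjugate to `t`. -/
theorem cost_transvection_one (hω : ∀ a : Fˣ, a ∈ Subgroup.zpowers ω) (hF : Odd (Nat.card F))
    (y : Fin n ⊕ Fin n → F) :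
    Cost hn ω (66 * (n * Nat.log 2 (Nat.card F))) (transvection y 1) := by
  have hnL : 2 * 1 ≤ n * Nat.log 2 (Nat.card F) := Nat.mul_le_mul hn (one_le_log_card (F := F))
  rcases eq_or_ne y 0 with rfl | hy
  · rw [transvection_zero_left]
    exact cost_one.mono (by omega)
  · obtain ⟨g, hg, hgy⟩ := reach_f₁ (hn := hn) hω hF hy
    have := (cost_t (hn := hn) (ω := ω)).conj hg.inv
    rw [t_eq_transvection, conj_transvection, act_inv g hgy] at this
    exact this.mono (by omega)

/-- A sum of two squares `a = b² + c²` makes a transvection a product of two conjugates of `t`. -/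
theorem cost_transvection (hω : ∀ a : Fˣ, a ∈ Subgroup.zpowers ω) (hF : Odd (Nat.card F))
    (y : Fin n ⊕ Fin n → F) (a : F) :
    Cost hn ω (133 * (n * Nat.log 2 (Nat.card F))) (transvection y a) := by
  have hnL : 2 * 1 ≤ n * Nat.log 2 (Nat.card F) := Nat.mul_le_mul hn (one_le_log_card (F := F))
  obtain ⟨b, c, rfl⟩ := exists_sq_add_sq hF a
  rw [transvection_add, ← transvection_smul, ← transvection_smul]
  exact ((cost_transvection_one hω hF _).mul (cost_transvection_one hω hF _)).mono (by omega)

end SpGen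

/-! ### Every element is a product of few transvections -/

namespace SpGen

open Matrix

variable {n : ℕ} {F : Type*} [Field F] {hn : 2 ≤ n} {ω : Fˣ}

/-- `g` fixes the first `k` hyperbolic pairs. -/
def FixesPairs (k : ℕ) (g : symplecticGroup (Fin n) F) : Prop :=
  ∀ i : Fin n, (i : ℕ) < k → act (e F i) g = e F i ∧ act (f F i) g = f F i

/-- `y` is perpendicular to the first `k` hyperbolic pairs. -/
def PerpPairs (k : ℕ) (y : Fin n ⊕ Fin n → F) : Prop :=
  ∀ i : Fin n, (i : ℕ) < k → form y (e F i) = 0 ∧ form y (f F i) = 0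

theorem PerpPairs.act_of_fixesPairs {k : ℕ} {y : Fin n ⊕ Fin n → F} (hy : PerpPairs k y)
    {g : symplecticGroup (Fin n) F} (hg : FixesPairs k g) : PerpPairs k (act y g) := by
  intro i hi
  have h₁ := form_act g y (e F i)
  have h₂ := form_act g y (f F i)
  rw [(hg i hi).1] at h₁
  rw [(hg i hi).2] at h₂
  exact ⟨h₁.trans (hy i hi).1, h₂.trans (hy i hi).2⟩

theorem PerpPairs.sub {k : ℕ} {y z : Fin n ⊕ Fin n → F} (hy : PerpPairs k y)
    (hz : PerpPairs k z) : PerpPairs k (y - z) := by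
  intro i hi
  simp [form_sub_left, hy i hi, hz i hi]

theorem PerpPairs.add {k : ℕ} {y z : Fin n ⊕ Fin n → F} (hy : PerpPairs k y)
    (hz : PerpPairs k z) : PerpPairs k (y + z) := by
  intro i hi
  simp [form_add_left, hy i hi, hz i hi]

theorem perpPairs_e (i : Fin n) : PerpPairs i (e F i) := by
  intro j hj
  have : i ≠ j := by rintro rfl; omega
  simp [form_e_e, form_e_f, this]

theorem perpPairs_f (i : Fin n) : PerpPairs i (f F i) := by
  intro j hj
  have : i ≠ j := by rintro rfl; omega
  simp [form_f_f, form_f_e, this]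

theorem fixesPairs_mul {k : ℕ} {g h : symplecticGroup (Fin n) F} (hg : FixesPairs k g)
    (hh : FixesPairs k h) : FixesPairs k (g * h) := by
  intro i hi
  simp [act_mul, hg i hi, hh i hi]

theorem exists_perpPairs_form_ne_zero {k : ℕ} {y : Fin n ⊕ Fin n → F} (hy : PerpPairs k y)
    (h0 : y ≠ 0) : ∃ z, PerpPairs k z ∧ form y z ≠ 0 := by
  obtain ⟨i | i, hi⟩ := exists_form_ne_zero h0
  · rcases lt_or_ge (i : ℕ) k with h | h
    · exact absurd (hy i h).1 hi
    · exact ⟨e F i, fun j hj => perpPairs_e i j (by omega), hi⟩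
  · rcases lt_or_ge (i : ℕ) k with h | h
    · exact absurd (hy i h).2 hi
    · exact ⟨f F i, fun j hj => perpPairs_f i j (by omega), hi⟩

/-- Given two non-zero vectors, some vector is perpendicular to neither of them. -/
theorem exists_perpPairs_form_ne_zero_ne_zero {k : ℕ} {y z : Fin n ⊕ Fin n → F}
    (hy : PerpPairs k y) (hy0 : y ≠ 0) (hz : PerpPairs k z) (hz0 : z ≠ 0) :
    ∃ w, PerpPairs k w ∧ form y w ≠ 0 ∧ form z w ≠ 0 := by
  obtain ⟨a, ha, hya⟩ := exists_perpPairs_form_ne_zero hy hy0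
  obtain ⟨b, hb, hzb⟩ := exists_perpPairs_form_ne_zero hz hz0
  by_cases hza : form z a = 0
  · by_cases hyb : form y b = 0
    · exact ⟨a + b, ha.add hb, by simpa [form_add_right, hyb] using hya,
        by simpa [form_add_right, hza] using hzb⟩
    · exact ⟨b, hb, hyb, hzb⟩
  · exact ⟨a, ha, hya, hza⟩

variable [Finite F]

/-- A transvection with centre `z - y` maps `y` to `z` if `y` and `z` are not perpendicular. -/
theorem exists_transvection_act_eq (hω : ∀ a : Fˣ, a ∈ Subgroup.zpowers ω)
    (hF : Odd (Nat.card F)) {y z : Fin n ⊕ Fin n → F} (h : form y z ≠ 0) :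
    ∃ g, Cost hn ω (133 * (n * Nat.log 2 (Nat.card F))) g ∧ act y g = z ∧
      ∀ w, form (z - y) w = 0 → act w g = w := by
  refine ⟨transvection (z - y) (form z y)⁻¹, cost_transvection hω hF _ _, ?_, fun w hw => ?_⟩
  · have : form z y ≠ 0 := by rwa [form_neg_swap, neg_ne_zero]
    rw [act_transvection, form_sub_left, form_self, sub_zero, inv_mul_cancel₀ this]
    simp
  · simp [act_transvection, hw]

/-- Transitivity on the non-zero vectors perpendicular to the first `k` hyperbolic pairs: pass
through a vector that is perpendicular neither to the source nor to the target. -/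
theorem exists_act_eq_of_perpPairs (hω : ∀ a : Fˣ, a ∈ Subgroup.zpowers ω)
    (hF : Odd (Nat.card F)) {k : ℕ} {y z : Fin n ⊕ Fin n → F} (hy : PerpPairs k y) (hy0 : y ≠ 0)
    (hz : PerpPairs k z) (hz0 : z ≠ 0) :
    ∃ g, Cost hn ω (266 * (n * Nat.log 2 (Nat.card F)) + 1) g ∧ act y g = z ∧ FixesPairs k g := by
  obtain ⟨w, hw, hyw, hzw⟩ := exists_perpPairs_form_ne_zero_ne_zero hy hy0 hz hz0
  rw [form_neg_swap, neg_ne_zero] at hzw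
  obtain ⟨g, hg, hgy, hgf⟩ := exists_transvection_act_eq (hn := hn) hω hF hyw
  obtain ⟨h, hh, hhw, hhf⟩ := exists_transvection_act_eq (hn := hn) hω hF hzw
  refine ⟨g * h, (hg.mul hh).mono (by omega), by rw [act_mul, hgy, hhw], ?_⟩
  apply fixesPairs_mul <;> intro i hi
  · exact ⟨hgf _ ((hw.sub hy) i hi).1, hgf _ ((hw.sub hy) i hi).2⟩
  · exact ⟨hhf _ ((hz.sub hw) i hi).1, hhf _ ((hz.sub hw) i hi).2⟩

/-- Transitivity on the second members of hyperbolic pairs with first member `e_i`. -/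
theorem exists_act_eq_f (hω : ∀ a : Fˣ, a ∈ Subgroup.zpowers ω)
    (hF : Odd (Nat.card F)) (i : Fin n) {y : Fin n ⊕ Fin n → F} (hy : PerpPairs i y)
    (hye : form y (e F i) = 1) :
    ∃ g, Cost hn ω (266 * (n * Nat.log 2 (Nat.card F)) + 1) g ∧ act y g = f F i ∧
      act (e F i) g = e F i ∧ FixesPairs i g := by
  have hfe : form (f F i) (e F i) = 1 := by simp [form_f_e]
  by_cases hyf : form y (f F i) = 0
  · -- Pass through `e_i + y`.
    obtain ⟨g, hg, hgy, hgf⟩ := exists_transvection_act_eq (hn := hn) hω hF (y := y)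
      (z := e F i + y) (by rw [form_add_right, hye, form_self]; simp)
    obtain ⟨h, hh, hhy, hhf⟩ := exists_transvection_act_eq (hn := hn) hω hF (y := e F i + y)
      (z := f F i) (by rw [form_add_left, hyf]; simp [form_e_f])
    refine ⟨g * h, (hg.mul hh).mono (by omega), by rw [act_mul, hgy, hhy], ?_, ?_⟩
    · rw [act_mul, hgf _ (by simp [form_e_e]), hhf]
      rw [form_sub_left, form_add_left, hfe, hye]
      simp [form_e_e]
    · have h1 := ((perpPairs_e i).add hy).sub hy
      have h2 := (perpPairs_f i).sub ((perpPairs_e (F := F) i).add hy)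
      apply fixesPairs_mul <;> intro j hj
      · exact ⟨hgf _ (h1 j hj).1, hgf _ (h1 j hj).2⟩
      · exact ⟨hhf _ (h2 j hj).1, hhf _ (h2 j hj).2⟩
  · obtain ⟨g, hg, hgy, hgf⟩ := exists_transvection_act_eq (hn := hn) hω hF hyf
    refine ⟨g, hg.mono (by omega), hgy, hgf _ (by rw [form_sub_left, hfe, hye, sub_self]), ?_⟩
    intro j hj
    have := (perpPairs_f i).sub hy
    exact ⟨hgf _ (this j hj).1, hgf _ (this j hj).2⟩

/-- The images of the hyperbolic pairs are moved back one pair after the other, with at most four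
transvections for each. -/
theorem cost_of_fixesPairs (hω : ∀ a : Fˣ, a ∈ Subgroup.zpowers ω)
    (hF : Odd (Nat.card F)) (j k : ℕ) (hjk : k + j = n) (g : symplecticGroup (Fin n) F)
    (hg : FixesPairs k g) :
    Cost hn ω (j * (532 * (n * Nat.log 2 (Nat.card F)) + 5) + 2) g := by
  induction j generalizing k g with
  | zero =>
    have : g = 1 := eq_of_e_f (fun i => by rw [(hg i (by omega)).1, act_one])
      (fun i => by rw [(hg i (by omega)).2, act_one])
    rw [this]
    exact cost_one.mono (by omega)
  | succ j ih =>
    have hk : k < n := by omega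
    obtain ⟨i, rfl⟩ : ∃ i : Fin n, (i : ℕ) = k := ⟨⟨k, hk⟩, rfl⟩
    have he : act (e F i) g ≠ 0 := by
      intro h
      have := form_act g (f F i) (e F i)
      rw [h, form_neg_swap, form_zero_left, neg_zero, form_f_e, if_pos rfl] at this
      exact zero_ne_one this
    have he0 : e F i ≠ 0 := by simp [e]
    obtain ⟨h, hh, hhe, hhf⟩ := exists_act_eq_of_perpPairs (hn := hn) hω hF
      ((perpPairs_e i).act_of_fixesPairs hg) he (perpPairs_e i) he0
    have hgh := fixesPairs_mul hg hhf
    obtain ⟨h', hh', hhe', hhf', hhp⟩ := exists_act_eq_f (hn := hn) hω hF i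
      ((perpPairs_f i).act_of_fixesPairs hgh) (by
        conv_lhs => rw [← hhe, ← act_mul, form_act]
        simp [form_f_e])
    have := ih (i + 1) (by omega) (g * h * h') (by
      intro l hl
      rcases Nat.lt_succ_iff_lt_or_eq.1 hl with hl | hl
      · exact fixesPairs_mul hgh hhp l hl
      · obtain rfl : l = i := Fin.ext hl
        rw [act_mul, act_mul, hhe, hhf', act_mul, hhe']
        exact ⟨rfl, rfl⟩)
    have := this.mul (hh.mul hh').inv
    rw [mul_assoc g, mul_inv_cancel_right] at this
    exact this.mono (by ring_nf; omega)

/-- Every element of the symplectic group has a program of length `O(n² log q)`. -/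
theorem cost_le (hω : ∀ a : Fˣ, a ∈ Subgroup.zpowers ω) (hF : Odd (Nat.card F))
    (g : symplecticGroup (Fin n) F) :
    Cost hn ω (536 * (n ^ 2 * Nat.log 2 (Nat.card F))) g := by
  refine (cost_of_fixesPairs hω hF n 0 (by omega) g (fun i hi => by omega)).mono ?_
  have hL := one_le_log_card (F := F)
  generalize Nat.log 2 (Nat.card F) = L at *
  have h1 : 2 * n ≤ n * n := Nat.mul_le_mul_right _ hn
  have h2 : n * n * 1 ≤ n * n * L := Nat.mul_le_mul_left _ hL
  ring_nf at *
  omega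

theorem closure_stdGen (hω : ∀ a : Fˣ, a ∈ Subgroup.zpowers ω) (hF : Odd (Nat.card F)) :
    Subgroup.closure (Set.range (stdGen hn ω)) = ⊤ := by
  rw [eq_top_iff]
  intro g _
  have key : ∀ {S T : Set (symplecticGroup (Fin n) F)} {c : ℕ}, Obtains S c T →
      T ⊆ Subgroup.closure S := by
    intro S T c h
    induction h with
    | of_subset c h => exact h.trans Subgroup.subset_closure
    | mul ha hb _ ih =>
      refine ih.trans ((Subgroup.closure_le _).2 (Set.insert_subset ?_ Subgroup.subset_closure))
      exact mul_mem (Subgroup.subset_closure ha) (Subgroup.subset_closure hb)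
    | inv ha _ ih =>
      refine ih.trans ((Subgroup.closure_le _).2 (Set.insert_subset ?_ Subgroup.subset_closure))
      exact inv_mem (Subgroup.subset_closure ha)
  exact key (cost_le hω hF g) rfl

end SpGen

/-! ### A table of transvections -/

namespace SpGen

open Matrix

variable {n : ℕ} {F : Type*} [Field F] {hn : 2 ≤ n} {ω : Fˣ}

theorem act_single_of_permutesBy {g : symplecticGroup (Fin n) F} {σ : Equiv.Perm (Fin n)}
    (hg : PermutesBy g σ) (k : Fin n ⊕ Fin n) :
    act (Pi.single k 1) g = Pi.single (k.map σ σ) 1 := by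
  ext (c | c) <;> obtain ⟨c, rfl⟩ := σ.surjective c
  · rw [(hg _ c).1]
    rcases k with k | k <;> simp [Pi.single_apply]
  · rw [(hg _ c).2]
    rcases k with k | k <;> simp [Pi.single_apply]

theorem act_e_δ_pow (a : ℕ) :
    act (Pi.single (Sum.inl (i₁ hn)) 1) (δ ω hn ^ a) =
      (ω : F) ^ a • Pi.single (Sum.inl (i₁ hn)) 1 := by
  rw [act_δ_pow]
  ext (c | c)
  · by_cases h : c = i₁ hn <;> simp [h, Pi.single_apply]
  · simp

theorem act_f_δ_pow (a : ℕ) :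
    act (Pi.single (Sum.inr (i₁ hn)) 1) (δ ω hn ^ a) =
      ((ω : F) ^ a)⁻¹ • Pi.single (Sum.inr (i₁ hn)) 1 := by
  rw [act_δ_pow]
  ext (c | c)
  · simp
  · by_cases h : c = i₁ hn <;> simp [h, Pi.single_apply]

theorem act_single_i₂_δ_pow (a : ℕ) {κ : Fin n → Fin n ⊕ Fin n} (hκ : κ = .inl ∨ κ = .inr) :
    act (Pi.single (κ (i₂ hn)) 1) (δ ω hn ^ a) = Pi.single (κ (i₂ hn)) 1 := by
  have h12 := i₁_ne_i₂ hn
  rw [act_δ_pow]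
  ext (c | c) <;> rcases hκ with rfl | rfl <;> by_cases h : c = i₁ hn <;> simp [h, h12]

/-- Two distinct indices can be moved to `1` and `2` by a power of `v * u` and a power of `v`. -/
theorem exists_rotation (hn : 2 ≤ n) {i j : Fin n} (hij : i ≠ j) :
    ∃ a < n, ∃ b < n, (finRotate n ^ b * rot₂ hn ^ a) (i₁ hn) = i ∧
      (finRotate n ^ b * rot₂ hn ^ a) (i₂ hn) = j := by
  obtain ⟨l, hl⟩ := (finRotate n ^ (i : ℕ)).surjective j
  have hl0 : (l : ℕ) ≠ 0 := by
    intro h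
    obtain rfl : l = i₁ hn := Fin.ext h
    rw [finRotate_pow_i₁ hn i.2] at hl
    exact hij hl
  refine ⟨l - 1, by omega, i, i.2, ?_, ?_⟩
  · rw [Equiv.Perm.mul_apply, rot₂_pow_i₁, finRotate_pow_i₁ hn i.2]
  · rw [Equiv.Perm.mul_apply, rot₂_pow_i₂ hn (m := l - 1) (by omega), ← hl]
    congr 1
    exact Fin.ext (by simp; omega)

/-- The vectors from which the table of transvections starts. Conjugation with `δ` changes the ratio
of the coefficients at `e₁` and `f₁` by a square, so that two combinations of these are needed. -/
def seeds (hn : 2 ≤ n) (ω : Fˣ) : List (Fin n ⊕ Fin n → F) :=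
  [Pi.single (.inl (i₁ hn)) 1 + Pi.single (.inl (i₂ hn)) 1,
    Pi.single (.inl (i₁ hn)) 1 + Pi.single (.inr (i₂ hn)) 1,
    Pi.single (.inr (i₁ hn)) 1 + Pi.single (.inl (i₂ hn)) 1,
    Pi.single (.inr (i₁ hn)) 1 + Pi.single (.inr (i₂ hn)) 1,
    Pi.single (.inl (i₁ hn)) 1 + Pi.single (.inr (i₁ hn)) 1,
    Pi.single (.inl (i₁ hn)) 1 + (ω : F)⁻¹ • Pi.single (.inr (i₁ hn)) 1,
    Pi.single (.inl (i₁ hn)) 1, Pi.single (.inr (i₁ hn)) 1]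

/-- A list of transvections that contains, up to a scalar factor of the centre, those with centre a
basis vector or a linear combination of two basis vectors. It arises from the seeds by conjugation
with `δ ^ a (v u) ^ b v ^ c`. -/
noncomputable def table (hn : 2 ≤ n) (ω : Fˣ) : List (symplecticGroup (Fin n) F) :=
  conjPowers (v n F) n (conjPowers (v n F * u F hn) n (conjPowers (δ ω hn) (Nat.card F)
    ((seeds hn ω).map fun w => transvection w 1)))

theorem mem_table {w : Fin n ⊕ Fin n → F} (hw : w ∈ seeds hn ω) {a b c : ℕ} (ha : a < Nat.card F)
    (hb : b < n) (hc : c < n) :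
    transvection (act (act w (δ ω hn ^ a)) ((v n F * u F hn) ^ b * v n F ^ c)) 1 ∈
      table hn ω := by
  have := mem_conjPowers (mem_conjPowers (mem_conjPowers (List.mem_map_of_mem
    (f := fun w => transvection w (1 : F)) hw) ha (b := δ ω hn)) hb (b := v n F * u F hn)) hc
    (b := v n F)
  rwa [conj_transvection, conj_transvection, conj_transvection, ← act_mul] at this

/-- The table contains a transvection whose centre is a multiple of `w`. -/
def InTable (hn : 2 ≤ n) (ω : Fˣ) (w : Fin n ⊕ Fin n → F) : Prop :=
  ∃ c : F, c ≠ 0 ∧ transvection (c • w) 1 ∈ table hn ω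

theorem InTable.of_smul {w : Fin n ⊕ Fin n → F} {c : F} (hc : c ≠ 0)
    (h : InTable hn ω (c • w)) : InTable hn ω w := by
  obtain ⟨d, hd, h⟩ := h
  exact ⟨d * c, mul_ne_zero hd hc, by rwa [← smul_smul]⟩

theorem permutesBy_rotation (hn : 2 ≤ n) (b c : ℕ) :
    PermutesBy ((v n F * u F hn) ^ b * v n F ^ c) (finRotate n ^ c * rot₂ hn ^ b) :=
  ((permutesBy_v_mul_u hn).pow b).mul (permutesBy_v.pow c)

variable [Finite F]

theorem inTable_of_ne (hω : ∀ a : Fˣ, a ∈ Subgroup.zpowers ω) {κ μ : Fin n → Fin n ⊕ Fin n}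
    (hκ : κ = .inl ∨ κ = .inr) (hμ : μ = .inl ∨ μ = .inr) {i j : Fin n} (hij : i ≠ j) {a : F}
    (ha : a ≠ 0) :
    InTable hn ω (Pi.single (κ i) 1 + a • Pi.single (μ j) 1 : Fin n ⊕ Fin n → F) := by
  obtain ⟨b, hb, c, hc, hi, hj⟩ := exists_rotation hn hij
  have hw : (Pi.single (κ (i₁ hn)) 1 + Pi.single (μ (i₂ hn)) 1 : Fin n ⊕ Fin n → F) ∈
      seeds hn ω := by
    rcases hκ with rfl | rfl <;> rcases hμ with rfl | rfl <;> simp [seeds]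
  have hP := permutesBy_rotation (F := F) hn b c
  have hi' : (κ (i₁ hn)).map (finRotate n ^ c * rot₂ hn ^ b) (finRotate n ^ c * rot₂ hn ^ b) =
      κ i := by
    rcases hκ with rfl | rfl <;> simp only [Sum.map_inl, Sum.map_inr, hi]
  have hj' : (μ (i₂ hn)).map (finRotate n ^ c * rot₂ hn ^ b) (finRotate n ^ c * rot₂ hn ^ b) =
      μ j := by
    rcases hμ with rfl | rfl <;> simp only [Sum.map_inl, Sum.map_inr, hj]
  obtain ⟨m, hm, hm'⟩ : ∃ m < Nat.card F, act (Pi.single (κ (i₁ hn)) 1) (δ ω hn ^ m) =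
      a⁻¹ • (Pi.single (κ (i₁ hn)) 1 : Fin n ⊕ Fin n → F) := by
    rcases hκ with rfl | rfl
    · obtain ⟨m, hm, h⟩ := exists_pow_eq hω (inv_ne_zero ha)
      exact ⟨m, hm, by rw [act_e_δ_pow, h]⟩
    · obtain ⟨m, hm, h⟩ := exists_pow_eq hω ha
      exact ⟨m, hm, by rw [act_f_δ_pow, h]⟩
  have := mem_table hw hm hb hc
  rw [act_add, hm', act_single_i₂_δ_pow _ hμ, act_add, act_smul, act_single_of_permutesBy hP,
    act_single_of_permutesBy hP, hi', hj'] at this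
  refine ⟨a⁻¹, inv_ne_zero ha, ?_⟩
  rwa [smul_add, smul_smul, inv_mul_cancel₀ ha, one_smul]

theorem inTable_e_add_f (hω : ∀ a : Fˣ, a ∈ Subgroup.zpowers ω) (i : Fin n) {a : F} (ha : a ≠ 0) :
    InTable hn ω (Pi.single (.inl i) 1 + a • Pi.single (.inr i) 1 : Fin n ⊕ Fin n → F) := by
  have hn0 : 0 < n := by omega
  have hω0 : (ω : F) ≠ 0 := ω.ne_zero
  have hP := permutesBy_rotation (F := F) hn 0 i
  have hi : (finRotate n ^ (i : ℕ) * rot₂ hn ^ 0) (i₁ hn) = i := by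
    rw [pow_zero, mul_one, finRotate_pow_i₁ hn i.2]
  obtain ⟨m, hm, hm'⟩ := exists_pow_eq hω (inv_ne_zero ha)
  rcases Nat.even_or_odd m with ⟨l, rfl⟩ | ⟨l, rfl⟩
  · have := mem_table (hn := hn) (ω := ω) (w := Pi.single (.inl (i₁ hn)) 1 +
      Pi.single (.inr (i₁ hn)) 1) (by simp [seeds]) (a := l) (by omega) hn0 i.2
    rw [act_add, act_e_δ_pow, act_f_δ_pow, act_add, act_smul, act_smul,
      act_single_of_permutesBy hP, act_single_of_permutesBy hP] at this
    simp only [Sum.map_inl, Sum.map_inr, hi] at this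
    refine ⟨ω ^ l, pow_ne_zero _ hω0, ?_⟩
    rw [smul_add, smul_smul]
    convert this using 4
    have : a = ((ω : F) ^ (l + l))⁻¹ := by rw [hm', inv_inv]
    rw [this]
    field_simp
    ring
  · have := mem_table (hn := hn) (ω := ω) (w := Pi.single (.inl (i₁ hn)) 1 +
      (ω : F)⁻¹ • Pi.single (.inr (i₁ hn)) 1) (by simp [seeds]) (a := l) (by omega) hn0 i.2
    rw [act_add, act_smul, act_e_δ_pow, act_f_δ_pow, act_add, act_smul, act_smul, act_smul,
      act_single_of_permutesBy hP, act_single_of_permutesBy hP] at this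
    simp only [Sum.map_inl, Sum.map_inr, hi] at this
    refine ⟨ω ^ l, pow_ne_zero _ hω0, ?_⟩
    rw [smul_add, smul_smul]
    rw [smul_smul] at this
    convert this using 4
    have : a = ((ω : F) ^ (2 * l + 1))⁻¹ := by rw [hm', inv_inv]
    rw [this]
    field_simp
    ring

theorem inTable_single (k : Fin n ⊕ Fin n) :
    InTable hn ω (Pi.single k 1 : Fin n ⊕ Fin n → F) := by
  have hn0 : 0 < n := by omega
  have hq : 0 < Nat.card F := Nat.card_pos
  refine ⟨1, one_ne_zero, ?_⟩
  rw [one_smul]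
  have key : ∀ (κ : Fin n → Fin n ⊕ Fin n) (i : Fin n), (κ = .inl ∨ κ = .inr) →
      transvection (Pi.single (κ i) 1) 1 ∈ table hn ω := by
    intro κ i hκ
    have hP := permutesBy_rotation (F := F) hn 0 i
    have hi : (finRotate n ^ (i : ℕ) * rot₂ hn ^ 0) (i₁ hn) = i := by
      rw [pow_zero, mul_one, finRotate_pow_i₁ hn i.2]
    have := mem_table (hn := hn) (ω := ω) (w := Pi.single (κ (i₁ hn)) 1)
      (by rcases hκ with rfl | rfl <;> simp [seeds]) hq hn0 i.2
    rw [pow_zero, act_one, act_single_of_permutesBy hP] at this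
    rcases hκ with rfl | rfl <;> simpa only [Sum.map_inl, Sum.map_inr, hi] using this
  rcases k with i | i
  · exact key .inl i (.inl rfl)
  · exact key .inr i (.inr rfl)

theorem inTable_add (hω : ∀ a : Fˣ, a ∈ Subgroup.zpowers ω) {k l : Fin n ⊕ Fin n} (hkl : k ≠ l)
    {a : F} (ha : a ≠ 0) :
    InTable hn ω (Pi.single k 1 + a • Pi.single l 1 : Fin n ⊕ Fin n → F) := by
  have swap : ∀ y z : Fin n ⊕ Fin n → F, y + a • z = a • (z + a⁻¹ • y) := by
    intro y z
    rw [smul_add, smul_smul, mul_inv_cancel₀ ha, one_smul, add_comm]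
  have hswap : ∀ y z : Fin n ⊕ Fin n → F, InTable hn ω (z + a⁻¹ • y) →
      InTable hn ω (y + a • z) := by
    intro y z h
    rw [swap]
    refine InTable.of_smul (inv_ne_zero ha) ?_
    rwa [smul_smul, inv_mul_cancel₀ ha, one_smul]
  rcases k with i | i <;> rcases l with j | j
  · exact inTable_of_ne hω (.inl rfl) (.inl rfl) (by rintro rfl; exact hkl rfl) ha
  · rcases eq_or_ne i j with rfl | hij
    · exact inTable_e_add_f hω i ha
    · exact inTable_of_ne hω (.inl rfl) (.inr rfl) hij ha
  · rcases eq_or_ne i j with rfl | hij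
    · exact hswap _ _ (inTable_e_add_f hω i (inv_ne_zero ha))
    · exact inTable_of_ne hω (.inr rfl) (.inl rfl) hij ha
  · exact inTable_of_ne hω (.inr rfl) (.inr rfl) (by rintro rfl; exact hkl rfl) ha

/-- The table can be computed with `O(n² q)` operations. -/
theorem obtains_table (hω : ∀ a : Fˣ, a ∈ Subgroup.zpowers ω) (hF : Odd (Nat.card F)) :
    Obtains (Set.range (stdGen hn ω)) (300 * (n ^ 2 * Nat.card F)) {a | a ∈ table hn ω} := by
  set S := Set.range (stdGen hn ω) with hS
  have h0 : Obtains S (8 * (66 * (n * Nat.log 2 (Nat.card F))))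
      {a | a ∈ (seeds hn ω).map fun w => transvection w (1 : F)} := by
    have := Obtains.of_forall_mem (S := S) ((seeds hn ω).map fun w => transvection w (1 : F))
      (c := 66 * (n * Nat.log 2 (Nat.card F))) (by
        intro a ha
        obtain ⟨w, _, rfl⟩ := List.mem_map.1 ha
        exact cost_transvection_one hω hF w)
    simpa [seeds] using this
  have hδ : δ ω hn ∈ S := ⟨2, rfl⟩
  have hu : u F hn ∈ S := ⟨3, rfl⟩
  have hv : v n F ∈ S := ⟨4, rfl⟩
  have h1 : Obtains S 4 {(δ ω hn)⁻¹, (v n F)⁻¹, v n F * u F hn, (v n F * u F hn)⁻¹} := by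
    refine .inv (c := 3) hδ (.inv (c := 2) (a := v n F) (.inr hv) (.mul (c := 1) (a := v n F)
      (b := u F hn) (.inr (.inr hv)) (.inr (.inr hu)) (.inv (c := 0) (a := v n F * u F hn)
        (.inl rfl) (.of_subset _ ?_))))
    rintro z (rfl | rfl | rfl | rfl) <;> simp
  have h2 := h0.union h1
  set T := {a | a ∈ (seeds hn ω).map fun w => transvection w (1 : F)} ∪
    {(δ ω hn)⁻¹, (v n F)⁻¹, v n F * u F hn, (v n F * u F hn)⁻¹} with hT
  let l₀ := (seeds hn ω).map fun w => transvection w (1 : F)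
  let l₁ := conjPowers (δ ω hn) (Nat.card F) l₀
  let l₂ := conjPowers (v n F * u F hn) n l₁
  have h3 := Obtains.conjPowers_of_mem (S := S ∪ T) (b := δ ω hn) (.inl hδ)
    (.inr (.inr (.inl rfl))) (Nat.card F) l₀ (fun z hz => .inr (.inl hz))
  have h4 := Obtains.conjPowers_of_mem (S := S ∪ T ∪ {a | a ∈ l₁}) (b := v n F * u F hn)
    (.inl (.inr (.inr (.inr (.inr (.inl rfl)))))) (.inl (.inr (.inr (.inr (.inr (.inr rfl)))))) n l₁
    Set.subset_union_right
  have h5 := Obtains.conjPowers_of_mem (S := S ∪ T ∪ {a | a ∈ l₁} ∪ {a | a ∈ l₂}) (b := v n F)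
    (.inl (.inl (.inl hv))) (.inl (.inl (.inr (.inr (.inr (.inl rfl)))))) n l₂
    Set.subset_union_right
  refine (h2.trans (h3.trans (h4.trans h5))).mono_cost ?_
  simp only [l₂, l₁, l₀, length_conjPowers, List.length_map]
  have h8 : (seeds hn ω).length = 8 := rfl
  rw [h8]
  have hq : Nat.log 2 (Nat.card F) ≤ Nat.card F := Nat.log_le_self _ _
  have hq1 : 1 ≤ Nat.card F := Nat.card_pos
  generalize Nat.log 2 (Nat.card F) = L at *
  generalize Nat.card F = q at *
  have a1 : n * L ≤ n * q := Nat.mul_le_mul_left _ hq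
  have a2 : 2 * (n * q) ≤ n * (n * q) := Nat.mul_le_mul_right _ hn
  have a3 : 2 * q ≤ n * q := Nat.mul_le_mul_right _ hn
  ring_nf at *
  omega

end SpGen

/-! ### Identifying an element up to the centre -/

namespace SpGen

open Matrix

variable {n : ℕ} {F : Type*} [Field F] {hn : 2 ≤ n} {ω : Fˣ}

theorem eq_zero_of_form_eq_zero {y : Fin n ⊕ Fin n → F} (h : ∀ k, form y (Pi.single k 1) = 0) :
    y = 0 := by
  by_contra h0
  obtain ⟨k, hk⟩ := exists_form_ne_zero h0
  exact hk (h k)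

theorem act_ne_zero {y : Fin n ⊕ Fin n → F} (hy : y ≠ 0) (g : symplecticGroup (Fin n) F) :
    act y g ≠ 0 := by
  intro h
  have := act_inv g h
  rw [act, zero_vecMul] at this
  exact hy this.symm

/-- If the images under `g` and `g'` are proportional for each basis vector and for each sum of the
basis vector with index `k₀` and another one, then `g` and `g'` differ by a scalar. -/
theorem inv_mul_mem_center {g g' : symplecticGroup (Fin n) F} (k₀ : Fin n ⊕ Fin n)
    (h₁ : ∀ k, ∃ c : F, act (Pi.single k 1) g' = c • act (Pi.single k 1) g)
    (h₂ : ∀ k, k ≠ k₀ → ∃ c : F, act (Pi.single k₀ 1 + Pi.single k 1) g' =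
      c • act (Pi.single k₀ 1 + Pi.single k 1) g) :
    g⁻¹ * g' ∈ Subgroup.center (symplecticGroup (Fin n) F) := by
  choose c hc using h₁
  have hcc : ∀ k, c k = c k₀ := by
    intro k
    rcases eq_or_ne k k₀ with rfl | hk
    · rfl
    obtain ⟨d, hd⟩ := h₂ k hk
    rw [act_add, act_add, hc, hc, smul_add, ← act_smul, ← act_smul, ← act_smul, ← act_smul,
      ← act_add, ← act_add] at hd
    have hd' := act_inv g hd
    rw [act_inv g rfl] at hd'
    have e₁ := congrFun hd' k₀
    have e₂ := congrFun hd' k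
    simp [hk, hk.symm] at e₁ e₂
    rw [← e₁, ← e₂]
  have hact : ∀ y, act y g' = c k₀ • act y g := by
    intro y
    have hy : y = ∑ k, y k • (Pi.single k 1 : Fin n ⊕ Fin n → F) := by
      ext j
      simp [Pi.single_apply]
    have hsum : ∀ h : symplecticGroup (Fin n) F,
        act y h = ∑ k, y k • act (Pi.single k 1) h := by
      intro h
      conv_lhs => rw [hy]
      simp only [act, sum_vecMul, smul_vecMul]
    rw [hsum, hsum, Finset.smul_sum]
    exact Finset.sum_congr rfl fun k _ => by rw [hc, hcc, smul_comm]
  have hz : ∀ y, act y (g⁻¹ * g') = c k₀ • y := by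
    intro y
    rw [act_mul, hact, ← act_mul, inv_mul_cancel, act_one]
  rw [Subgroup.mem_center_iff]
  intro h
  refine eq_of_act_eq fun y => ?_
  rw [act_mul, hz, act_mul, hz, act_smul]

variable {j : ℕ} {P : symplecticGroup (Fin n) F → SLP j → Prop}
  {S : Set (symplecticGroup (Fin n) F → symplecticGroup (Fin n) F)}

/-- The condition `(y g, w) = 0` on the unknown element `g` can be tested, because it says that
`g⁻¹ T g` and `T'` commute, where the transvections `T` and `T'` have centres `y` and `w`. -/
theorem win_of_form_eq_zero {y w : Fin n ⊕ Fin n → F} (hy : y ≠ 0)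
    (hyS : ∃ c : F, c ≠ 0 ∧ (fun g => g⁻¹ * transvection (c • y) 1 * g) ∈ S)
    (hwS : ∃ c : F, c ≠ 0 ∧ (fun _ => transvection (c • w) 1) ∈ S)
    {N : ℕ} {C : Set (symplecticGroup (Fin n) F)}
    (h : Win P S N (C ∩ {g | form (act y g) w = 0}))
    (h' : Win P S N (C ∩ {g | form (act y g) w ≠ 0})) : Win P S (N + 3) C := by
  obtain ⟨c, hc, hcS⟩ := hyS
  obtain ⟨d, hd, hdS⟩ := hwS
  have key : ∀ g : symplecticGroup (Fin n) F,
      g⁻¹ * transvection (c • y) 1 * g * transvection (d • w) 1 =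
        transvection (d • w) 1 * (g⁻¹ * transvection (c • y) 1 * g) ↔ form (act y g) w = 0 := by
    intro g
    rw [conj_transvection, transvection_comm_iff (act_ne_zero (smul_ne_zero hc hy) g),
      act_smul, form_smul_left, form_smul_right]
    simp [hc, hd]
  refine Win.commute hcS hdS ?_ ?_
  · simpa only [key] using h
  · simpa only [ne_eq, key] using h'

variable [Finite F]

/-- The point `⟨y g⟩` can be found with `O(n q)` operations: search for a basis vector `b₀` with
`(y g, b₀) ≠ 0`, and then for every other basis vector `b` for the scalar `a` with
`(y g, b - a b₀) = 0`. -/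
theorem separates_act (hω : ∀ a : Fˣ, a ∈ Subgroup.zpowers ω) {y : Fin n ⊕ Fin n → F} (hy : y ≠ 0)
    (hyS : ∃ c : F, c ≠ 0 ∧ (fun g => g⁻¹ * transvection (c • y) 1 * g) ∈ S)
    (htab : ∀ a ∈ table hn ω, (fun _ => a) ∈ S) :
    Separates P S Set.univ (12 * (n * Nat.card F))
      (fun g g' => ∃ c : F, act y g' = c • act y g) := by
  classical
  have := Fintype.ofFinite F
  have htab' : ∀ w, InTable hn ω w → ∃ c : F, c ≠ 0 ∧ (fun _ => transvection (c • w) 1) ∈ S :=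
    fun w ⟨c, hc, hw⟩ => ⟨c, hc, htab _ hw⟩
  have hlen : (Finset.univ : Finset (Fin n ⊕ Fin n)).toList.length = 2 * n := by
    simp; ring
  have hlenF : (Finset.univ : Finset F).toList.length = Nat.card F := by
    simp [Nat.card_eq_fintype_card]
  intro N C _ hwin
  have hsearch : Win P S (N + (Finset.univ : Finset (Fin n ⊕ Fin n)).toList.length *
      (Nat.card F * 3) + (Finset.univ : Finset (Fin n ⊕ Fin n)).toList.length * 3) C := by
    refine Win.search (fun k => {g | form (act y g) (Pi.single k 1) ≠ 0}) _ ?_ ?_ ?_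
    · intro k _ C' N' _ h h'
      refine win_of_form_eq_zero hy hyS (htab' _ (inTable_single k)) ?_ h
      convert h' using 1
      ext g
      simp
    · intro g _
      obtain ⟨k, hk⟩ := exists_form_ne_zero (act_ne_zero hy g)
      exact ⟨k, by simp, hk⟩
    · intro k₀ _ C' hC'
      have hsep := Separates.list (Good := P) (S := S)
        (C₀ := {g | form (act y g) (Pi.single k₀ 1) ≠ 0}) (m := Nat.card F * 3)
        (R := fun k g g' => form (act y g) (Pi.single k 1) * form (act y g') (Pi.single k₀ 1) =
          form (act y g') (Pi.single k 1) * form (act y g) (Pi.single k₀ 1))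
        (Finset.univ : Finset (Fin n ⊕ Fin n)).toList (by
          intro k _ N' C'' hC'' hwin'
          rcases eq_or_ne k k₀ with rfl | hk
          · exact (hwin' C'' subset_rfl fun g _ g' _ => mul_comm _ _).mono_cost (by omega)
          rw [← hlenF]
          refine Win.search (fun a => {g | form (act y g) (Pi.single k 1) =
            a * form (act y g) (Pi.single k₀ 1)}) _ ?_ ?_ ?_
          · intro a _ D M _ h h'
            have hw : InTable hn ω (Pi.single k 1 + (-a) • Pi.single k₀ 1 :
                Fin n ⊕ Fin n → F) := by
              rcases eq_or_ne a 0 with rfl | ha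
              · simpa using inTable_single k
              · exact inTable_add hω hk (neg_ne_zero.2 ha)
            have key : ∀ g : symplecticGroup (Fin n) F,
                form (act y g) (Pi.single k 1 + (-a) • Pi.single k₀ 1) = 0 ↔
                  form (act y g) (Pi.single k 1) = a * form (act y g) (Pi.single k₀ 1) := by
              intro g
              rw [form_add_right, form_smul_right, neg_mul, ← sub_eq_add_neg, sub_eq_zero]
            refine win_of_form_eq_zero hy hyS (htab' _ hw) ?_ ?_
            · simpa only [key] using h
            · simp only [ne_eq, key]
              exact h'
          · intro g hg
            have := hC'' hg
            exact ⟨form (act y g) (Pi.single k 1) / form (act y g) (Pi.single k₀ 1), by simp,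
              (div_mul_cancel₀ _ this).symm⟩
          · intro a _ D hD
            refine hwin' D (hD.trans Set.inter_subset_left) fun g hg g' hg' => ?_
            have h1 := (hD hg).2
            have h2 := (hD hg').2
            simp only [Set.mem_ofPred_eq] at h1 h2
            change form (act y g) _ * form (act y g') _ = form (act y g') _ * form (act y g) _
            rw [h1, h2]
            ring)
      refine hsep N C' (hC'.trans Set.inter_subset_right) fun D hD hR => ?_
      refine hwin D (hD.trans (hC'.trans Set.inter_subset_left)) fun g hg g' hg' => ?_
      have h0 : form (act y g) (Pi.single k₀ 1) ≠ 0 := (hC' (hD hg)).2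
      refine ⟨form (act y g') (Pi.single k₀ 1) / form (act y g) (Pi.single k₀ 1), ?_⟩
      rw [← sub_eq_zero]
      refine eq_zero_of_form_eq_zero fun k => ?_
      have := hR g hg g' hg' k (by simp)
      rw [form_sub_left, form_smul_left, div_mul_eq_mul_div, mul_comm (form (act y g') _), this,
        mul_div_cancel_right₀ _ h0, sub_self]
  refine hsearch.mono_cost ?_
  rw [hlen]
  have hq : 1 ≤ Nat.card F := Nat.card_pos
  have := Nat.mul_le_mul_left n hq
  generalize Nat.card F = q at *
  ring_nf at *
  omega

/-- A program `p` is good for `g` if it is short and evaluates to `g` up to the centre. -/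
def Good (hn : 2 ≤ n) (ω : Fˣ) (g : symplecticGroup (Fin n) F) (p : SLP 6) : Prop :=
  p.length ≤ 540 * (n ^ 2 * Nat.log 2 (Nat.card F)) ∧
    ∃ z, SLP.eval (stdGen hn ω) p = some z ∧
      z⁻¹ * g ∈ Subgroup.center (symplecticGroup (Fin n) F)

/-- The constructive membership problem can be solved with `O(n² q)` operations: compute the table
of transvections, conjugate those whose centres are basis vectors `b` or sums `b₀ + b` by the
unknown element, and determine from these conjugates the images of the centres up to scalars. -/
theorem win_univ (hω : ∀ a : Fˣ, a ∈ Subgroup.zpowers ω) (hF : Odd (Nat.card F)) :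
    Win (Good hn ω) (insert id (Set.range fun i _ => stdGen hn ω i))
      (360 * (n ^ 2 * Nat.card F)) Set.univ := by
  classical
  let H := symplecticGroup (Fin n) F
  set k₀ : Fin n ⊕ Fin n := .inl (i₁ hn)
  have hnL := Nat.mul_le_mul (Nat.pow_le_pow_left hn 2) (one_le_log_card (F := F))
  -- The vectors whose images are to be determined up to a scalar.
  set vs : List (Fin n ⊕ Fin n → F) :=
    (Finset.univ : Finset (Fin n ⊕ Fin n)).toList.map (fun k => Pi.single k 1) ++
    ((Finset.univ : Finset (Fin n ⊕ Fin n)).erase k₀).toList.map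
      (fun k => Pi.single k₀ 1 + Pi.single k 1) with hvs
  have hlen : vs.length ≤ 4 * n := by
    simp [hvs]
    omega
  have hvs0 : ∀ y ∈ vs, y ≠ 0 ∧ InTable hn ω y := by
    intro y hy
    rw [hvs, List.mem_append, List.mem_map, List.mem_map] at hy
    rcases hy with ⟨k, _, rfl⟩ | ⟨k, hk, rfl⟩
    · exact ⟨by simp, inTable_single k⟩
    · have hk : k ≠ k₀ := by simpa using hk
      refine ⟨fun h => ?_, ?_⟩
      · have := congrFun h k
        simp [hk] at this
      · simpa using inTable_add hω hk.symm (one_ne_zero (α := F))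
  choose! c hc htab using fun y hy => (hvs0 y hy).2
  -- The table of transvections.
  have h1 : Obtains (insert id (Set.range fun i (_ : H) => stdGen hn ω i)) _ _ :=
    ((obtains_table (hn := hn) hω hF).map (Pi.constMonoidHom H H)).mono_left (by
      rintro _ ⟨_, ⟨i, rfl⟩, rfl⟩
      exact .inr ⟨i, rfl⟩)
  -- The conjugates of some of these by the unknown element.
  have h2 := Obtains.conj_list (K := H → H)
    (S := insert id (Set.range fun i (_ : H) => stdGen hn ω i) ∪
      Pi.constMonoidHom H H '' {a | a ∈ table hn ω}) (b := id) (.inl (.inl rfl))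
    (vs.map fun y _ => transvection (c y • y) 1) (by
      intro a ha
      obtain ⟨y, hy, rfl⟩ := List.mem_map.1 ha
      exact .inr ⟨_, htab y hy, rfl⟩)
  rw [List.length_map] at h2
  have hW : Win (Good hn ω) (insert id (Set.range fun i (_ : H) => stdGen hn ω i) ∪
      Pi.constMonoidHom H H '' {a | a ∈ table hn ω} ∪
      {z | ∃ a ∈ vs.map fun y _ => transvection (c y • y) 1, z = id⁻¹ * a * id})
      (0 + vs.length * (12 * (n * Nat.card F))) Set.univ := by
    refine Separates.list (C₀ := Set.univ)
      (R := fun y g g' => ∃ c : F, act y g' = c • act y g) vs (fun y hy => ?_) 0 Set.univ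
      subset_rfl fun C _ hC => ?_
    · refine separates_act (hn := hn) hω (hvs0 y hy).1 ⟨c y, hc y hy, .inr ?_⟩ fun a ha => ?_
      · exact ⟨_, List.mem_map_of_mem hy, rfl⟩
      · exact .inl (.inr ⟨a, ha, rfl⟩)
    · rcases C.eq_empty_or_nonempty with rfl | ⟨g₀, hg₀⟩
      · exact .output _ [] (by simp)
      · obtain ⟨p, hp, hp'⟩ := SLP.exists_eval_of_obtains _ (cost_le (hn := hn) hω hF g₀)
        refine .output _ p fun g hg => ⟨by omega, g₀, hp', ?_⟩
        refine inv_mul_mem_center k₀ (fun k => hC g₀ hg₀ g hg _ ?_)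
          fun k hk => hC g₀ hg₀ g hg _ ?_
        · simp [hvs]
        · rw [hvs, List.mem_append]
          exact .inr (List.mem_map_of_mem (by simpa using hk))
  refine (Win.of_obtains h1 (Win.of_obtains h2 hW)).mono_cost ?_
  have hq : 1 ≤ Nat.card F := Nat.card_pos
  have a0 := Nat.mul_le_mul_right (12 * (n * Nat.card F)) hlen
  generalize Nat.card F = q at *
  generalize vs.length = l at *
  have a1 := Nat.mul_le_mul_left (n * n) hq
  have a2 : 2 * n ≤ n * n := Nat.mul_le_mul_right _ hn
  have a3 : 4 * n * (12 * (n * q)) = 48 * (n ^ 2 * q) := by ring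
  have a4 : n * n = n ^ 2 := by ring
  rw [a3] at a0
  rw [a4] at a1 a2
  omega

end SpGen

/-! ### Computing in a field given by tables -/

namespace SpParams

/-- The sum of two field elements, read off from the addition table. -/
def add (i : SpParams) (a b : ℕ) : ℕ := (i.2.2.1.getD a []).getD b 0

/-- The product of two field elements, read off from the multiplication table. -/
def mul (i : SpParams) (a b : ℕ) : ℕ := (i.2.2.2.1.getD a []).getD b 0

/-- The number of the zero element, the only solution of `z + z = z`. -/
def zero (i : SpParams) : ℕ := (List.range i.2.1).findIdx fun z => decide (i.add z z = z)

/-- The number of the unit element, the only non-zero solution of `z * z = z`. -/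
def one (i : SpParams) : ℕ :=
  (List.range i.2.1).findIdx fun z => decide (i.mul z z = z) && !decide (z = i.zero)

/-- The negative of a field element, found by search. -/
def neg (i : SpParams) (a : ℕ) : ℕ :=
  (List.range i.2.1).findIdx fun b => decide (i.add b a = i.zero)

/-- The inverse of a non-zero field element, found by search. -/
def inv (i : SpParams) (a : ℕ) : ℕ :=
  (List.range i.2.1).findIdx fun b => decide (i.mul a b = i.one)

/-- The powers of the distinguished element. -/
def pow (i : SpParams) (k : ℕ) : ℕ := (i.mul i.2.2.2.2)^[k] i.one

/-- The logarithm of a field element to the base of the distinguished element, found by search. -/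
def log (i : SpParams) (a : ℕ) : ℕ := (List.range i.2.1).findIdx fun k => decide (i.pow k = a)

/-- The axioms of a field and of a primitive element for the elements with numbers `a`, `b`, `c`. -/
def Axioms (i : SpParams) (a b c : ℕ) : Prop :=
  (i.add a b < i.2.1 ∧ i.mul a b < i.2.1 ∧ i.neg a < i.2.1) ∧
  (i.add (i.add a b) c = i.add a (i.add b c) ∧ i.add i.zero a = a ∧ i.add (i.neg a) a = i.zero) ∧
  (i.mul (i.mul a b) c = i.mul a (i.mul b c) ∧ i.mul a b = i.mul b a ∧ i.mul i.one a = a) ∧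
  i.mul a (i.add b c) = i.add (i.mul a b) (i.mul a c) ∧
  (a = i.zero ∨ (i.inv a < i.2.1 ∧ i.mul a (i.inv a) = i.one ∧ i.pow (i.log a) = a))

/-- The parameters are those of a symplectic group over a finite field of odd order. -/
def Valid (i : SpParams) : Prop :=
  (2 ≤ i.1 ∧ i.2.1 % 2 = 1) ∧
  (i.2.2.1 = (List.range i.2.1).map (fun a => (List.range i.2.1).map fun b => i.add a b) ∧
    i.2.2.2.1 = (List.range i.2.1).map (fun a => (List.range i.2.1).map fun b => i.mul a b)) ∧
  (i.2.2.2.2 < i.2.1 ∧ i.zero < i.2.1 ∧ i.one < i.2.1) ∧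
  (i.zero ≠ i.one ∧ i.2.2.2.2 ≠ i.zero) ∧
  ∀ a < i.2.1, ∀ b < i.2.1, ∀ c < i.2.1, i.Axioms a b c

section Primrec

variable {α : Type*} [Primcodable α] {f : α → SpParams} {a b c : α → ℕ}

theorem primrec_n (hf : Primrec f) : Primrec fun x => (f x).1 := Primrec.fst.comp hf

theorem primrec_q (hf : Primrec f) : Primrec fun x => (f x).2.1 :=
  Primrec.fst.comp (Primrec.snd.comp hf)

theorem primrec_addTable (hf : Primrec f) : Primrec fun x => (f x).2.2.1 :=
  Primrec.fst.comp (Primrec.snd.comp (Primrec.snd.comp hf))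

theorem primrec_mulTable (hf : Primrec f) : Primrec fun x => (f x).2.2.2.1 :=
  Primrec.fst.comp (Primrec.snd.comp (Primrec.snd.comp (Primrec.snd.comp hf)))

theorem primrec_ω (hf : Primrec f) : Primrec fun x => (f x).2.2.2.2 :=
  Primrec.snd.comp (Primrec.snd.comp (Primrec.snd.comp (Primrec.snd.comp hf)))

theorem primrec_add (hf : Primrec f) (ha : Primrec a) (hb : Primrec b) :
    Primrec fun x => (f x).add (a x) (b x) :=
  (Primrec.list_getD 0).comp ((Primrec.list_getD []).comp (primrec_addTable hf) ha) hb

theorem primrec_mul (hf : Primrec f) (ha : Primrec a) (hb : Primrec b) :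
    Primrec fun x => (f x).mul (a x) (b x) :=
  (Primrec.list_getD 0).comp ((Primrec.list_getD []).comp (primrec_mulTable hf) ha) hb

theorem primrec_decide_eq (ha : Primrec a) (hb : Primrec b) :
    Primrec fun x => decide (a x = b x) :=
  Primrec.eq.decide.comp ha hb

theorem primrec_findIdx_range {p : α → ℕ → Bool} (ha : Primrec a) (hp : Primrec₂ p) :
    Primrec fun x => (List.range (a x)).findIdx (p x) :=
  Primrec.list_findIdx (Primrec.list_range.comp ha) hp

theorem primrec_zero (hf : Primrec f) : Primrec fun x => (f x).zero :=
  primrec_findIdx_range (primrec_q hf)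
    (primrec_decide_eq (primrec_add (hf.comp .fst) .snd .snd) .snd)

theorem primrec_one (hf : Primrec f) : Primrec fun x => (f x).one :=
  primrec_findIdx_range (primrec_q hf) (Primrec.and.comp
    (primrec_decide_eq (primrec_mul (hf.comp .fst) .snd .snd) .snd)
    (Primrec.not.comp (primrec_decide_eq .snd (primrec_zero (hf.comp .fst)))))

theorem primrec_neg (hf : Primrec f) (ha : Primrec a) : Primrec fun x => (f x).neg (a x) :=
  primrec_findIdx_range (primrec_q hf) (primrec_decide_eq
    (primrec_add (hf.comp .fst) .snd (ha.comp .fst)) (primrec_zero (hf.comp .fst)))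

theorem primrec_inv (hf : Primrec f) (ha : Primrec a) : Primrec fun x => (f x).inv (a x) :=
  primrec_findIdx_range (primrec_q hf) (primrec_decide_eq
    (primrec_mul (hf.comp .fst) (ha.comp .fst) .snd) (primrec_one (hf.comp .fst)))

theorem primrec_pow (hf : Primrec f) (ha : Primrec a) : Primrec fun x => (f x).pow (a x) :=
  Primrec.nat_iterate ha (primrec_one hf)
    (primrec_mul (hf.comp .fst) (primrec_ω (hf.comp .fst)) .snd)

theorem primrec_log (hf : Primrec f) (ha : Primrec a) : Primrec fun x => (f x).log (a x) :=
  primrec_findIdx_range (primrec_q hf)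
    (primrec_decide_eq (primrec_pow (hf.comp .fst) .snd) (ha.comp .fst))

theorem primrecPred_axioms (hf : Primrec f) (ha : Primrec a) (hb : Primrec b) (hc : Primrec c) :
    PrimrecPred fun x => (f x).Axioms (a x) (b x) (c x) := by
  have hq := primrec_q hf
  have h0 := primrec_zero hf
  have h1 := primrec_one hf
  have hab := primrec_add hf ha hb
  have hab' := primrec_mul hf ha hb
  have hna := primrec_neg hf ha
  have hia := primrec_inv hf ha
  refine .and (.and ?_ (.and ?_ ?_)) (.and (.and ?_ (.and ?_ ?_)) (.and (.and ?_ (.and ?_ ?_))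
    (.and ?_ (.or ?_ (.and ?_ (.and ?_ ?_))))))
  · exact Primrec.nat_lt.comp hab hq
  · exact Primrec.nat_lt.comp hab' hq
  · exact Primrec.nat_lt.comp hna hq
  · exact Primrec.eq.comp (primrec_add hf hab hc) (primrec_add hf ha (primrec_add hf hb hc))
  · exact Primrec.eq.comp (primrec_add hf h0 ha) ha
  · exact Primrec.eq.comp (primrec_add hf hna ha) h0
  · exact Primrec.eq.comp (primrec_mul hf hab' hc) (primrec_mul hf ha (primrec_mul hf hb hc))
  · exact Primrec.eq.comp hab' (primrec_mul hf hb ha)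
  · exact Primrec.eq.comp (primrec_mul hf h1 ha) ha
  · exact Primrec.eq.comp (primrec_mul hf ha (primrec_add hf hb hc))
      (primrec_add hf hab' (primrec_mul hf ha hc))
  · exact Primrec.eq.comp ha h0
  · exact Primrec.nat_lt.comp hia hq
  · exact Primrec.eq.comp (primrec_mul hf ha hia) h1
  · exact Primrec.eq.comp (primrec_pow hf (primrec_log hf ha)) ha

theorem _root_.PrimrecRel.forall_lt_of_primrec {R : ℕ → α → Prop} (hR : PrimrecRel R)
    (ha : Primrec a) : PrimrecPred fun x => ∀ y < a x, R y x :=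
  (hR.forall_mem_list.comp (Primrec.list_range.comp ha) Primrec.id).of_eq fun x => by simp

theorem primrecPred_valid : PrimrecPred Valid := by
  have hi : Primrec (id : SpParams → SpParams) := .id
  refine .and (.and ?_ ?_) (.and (.and ?_ ?_) (.and (.and ?_ (.and ?_ ?_)) (.and (.and ?_ ?_) ?_)))
  · exact Primrec.nat_le.comp (.const 2) (primrec_n hi)
  · exact Primrec.eq.comp (Primrec.nat_mod.comp (primrec_q hi) (.const 2)) (.const 1)
  · refine Primrec.eq.comp (primrec_addTable hi) (Primrec.list_map (Primrec.list_range.comp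
      (primrec_q hi)) (Primrec.list_map (Primrec.list_range.comp (primrec_q .fst)) ?_))
    exact primrec_add (.comp .fst .fst) (.comp .snd .fst) .snd
  · refine Primrec.eq.comp (primrec_mulTable hi) (Primrec.list_map (Primrec.list_range.comp
      (primrec_q hi)) (Primrec.list_map (Primrec.list_range.comp (primrec_q .fst)) ?_))
    exact primrec_mul (.comp .fst .fst) (.comp .snd .fst) .snd
  · exact Primrec.nat_lt.comp (primrec_ω hi) (primrec_q hi)
  · exact Primrec.nat_lt.comp (primrec_zero hi) (primrec_q hi)
  · exact Primrec.nat_lt.comp (primrec_one hi) (primrec_q hi)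
  · exact (Primrec.eq.comp (primrec_zero hi) (primrec_one hi)).not
  · exact (Primrec.eq.comp (primrec_ω hi) (primrec_zero hi)).not
  · have h₃ : PrimrecPred fun x : (SpParams × ℕ) × ℕ =>
        ∀ c < x.1.1.2.1, x.1.1.Axioms x.1.2 x.2 c := by
      refine PrimrecRel.forall_lt_of_primrec (R := fun c (x : (SpParams × ℕ) × ℕ) =>
        x.1.1.Axioms x.1.2 x.2 c) ?_ (primrec_q (.comp .fst .fst))
      exact primrecPred_axioms (.comp .fst (.comp .fst .snd)) (.comp .snd (.comp .fst .snd))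
        (.comp .snd .snd) .fst
    have h₂ : PrimrecPred fun x : SpParams × ℕ =>
        ∀ b < x.1.2.1, ∀ c < x.1.2.1, x.1.Axioms x.2 b c := by
      refine PrimrecRel.forall_lt_of_primrec (R := fun b (x : SpParams × ℕ) =>
        ∀ c < x.1.2.1, x.1.Axioms x.2 b c) ?_ (primrec_q .fst)
      exact h₃.comp (Primrec.pair .snd .fst)
    refine PrimrecRel.forall_lt_of_primrec (R := fun a (x : SpParams) =>
        ∀ b < x.2.1, ∀ c < x.2.1, x.Axioms a b c) ?_ (primrec_q hi)
    exact h₂.comp (Primrec.pair .snd .fst)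

end Primrec

/-! ### Tables of actual fields -/

theorem findIdx_range_eq {q m : ℕ} (hm : m < q) {p : ℕ → Bool}
    (hp : ∀ z < q, p z = true ↔ z = m) : (List.range q).findIdx p = m := by
  rw [List.findIdx_eq (by simpa using hm)]
  refine ⟨by simpa using (hp m hm).2 rfl, fun j hj => ?_⟩
  have := hp j (hj.trans hm)
  simp only [List.getElem_range, Bool.eq_false_iff, ne_eq, this]
  omega

theorem exists_eq_of_lt {q : ℕ} {F : Type*} (e : F ≃ Fin q) {z : ℕ} (hz : z < q) :
    ∃ a : F, z = e a :=
  ⟨e.symm ⟨z, hz⟩, by simp⟩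

theorem coe_inj {q : ℕ} {F : Type*} (e : F ≃ Fin q) {a b : F} : (e a : ℕ) = e b ↔ a = b := by
  rw [← Fin.ext_iff, e.apply_eq_iff_eq]

section Field

variable {n q : ℕ} {F : Type*} [Field F] (e : F ≃ Fin q) (ω : Fˣ)

theorem add_spParams (a b : F) : (spParams n e ω).add (e a) (e b) = e (a + b) := by
  simp [add, spParams, List.getD_eq_getElem?_getD]

theorem mul_spParams (a b : F) : (spParams n e ω).mul (e a) (e b) = e (a * b) := by
  simp [mul, spParams, List.getD_eq_getElem?_getD]

theorem zero_spParams : (spParams n e ω).zero = e 0 := by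
  refine findIdx_range_eq (e 0).2 fun z hz => ?_
  obtain ⟨a, rfl⟩ := exists_eq_of_lt e hz
  rw [add_spParams, decide_eq_true_iff, coe_inj, coe_inj]
  simp

theorem one_spParams : (spParams n e ω).one = e 1 := by
  refine findIdx_range_eq (e 1).2 fun z hz => ?_
  obtain ⟨a, rfl⟩ := exists_eq_of_lt e hz
  rw [mul_spParams, zero_spParams, Bool.and_eq_true, decide_eq_true_iff, Bool.not_eq_true',
    decide_eq_false_iff_not, coe_inj, coe_inj, coe_inj]
  constructor
  · rintro ⟨h, h0⟩
    exact mul_left_cancel₀ h0 (h.trans (mul_one a).symm)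
  · rintro rfl
    simp

theorem neg_spParams (a : F) : (spParams n e ω).neg (e a) = e (-a) := by
  refine findIdx_range_eq (e (-a)).2 fun z hz => ?_
  obtain ⟨b, rfl⟩ := exists_eq_of_lt e hz
  rw [add_spParams, zero_spParams, decide_eq_true_iff, coe_inj, coe_inj]
  exact ⟨fun h => eq_neg_of_add_eq_zero_left h, by rintro rfl; simp⟩

theorem inv_spParams {a : F} (ha : a ≠ 0) : (spParams n e ω).inv (e a) = e a⁻¹ := by
  refine findIdx_range_eq (e a⁻¹).2 fun z hz => ?_
  obtain ⟨b, rfl⟩ := exists_eq_of_lt e hz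
  rw [mul_spParams, one_spParams, decide_eq_true_iff, coe_inj, coe_inj]
  exact ⟨fun h => eq_inv_of_mul_eq_one_right h, by rintro rfl; exact mul_inv_cancel₀ ha⟩

theorem pow_spParams (k : ℕ) : (spParams n e ω).pow k = e ((ω : F) ^ k) := by
  induction k with
  | zero => simpa [pow] using one_spParams e ω
  | succ k ih =>
    rw [pow, Function.iterate_succ_apply', ← pow, ih, pow_succ']
    exact mul_spParams e ω _ _

theorem valid_spParams (hn : 2 ≤ n) (hq : Odd q) (hω : ∀ a : Fˣ, a ∈ Subgroup.zpowers ω) :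
    (spParams n e ω).Valid := by
  have hcard : Nat.card F = q := Nat.card_eq_of_equiv_fin e
  have : Finite F := Finite.of_equiv _ e.symm
  refine ⟨⟨hn, Nat.odd_iff.1 hq⟩, ⟨?_, ?_⟩, ⟨(e ω).2, ?_, ?_⟩, ⟨?_, ?_⟩, ?_⟩
  · refine List.ext_getElem (by simp [spParams]) fun r h₁ h₂ => ?_
    refine List.ext_getElem (by simp [spParams]) fun c h₃ h₄ => ?_
    replace h₂ : r < q := by simpa [spParams] using h₂
    replace h₄ : c < q := by simpa [spParams] using h₄
    obtain ⟨a, ha⟩ := exists_eq_of_lt e h₂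
    obtain ⟨b, hb⟩ := exists_eq_of_lt e h₄
    subst ha hb
    simp only [List.getElem_map, List.getElem_range, add_spParams]
    simp [spParams]
  · refine List.ext_getElem (by simp [spParams]) fun r h₁ h₂ => ?_
    refine List.ext_getElem (by simp [spParams]) fun c h₃ h₄ => ?_
    replace h₂ : r < q := by simpa [spParams] using h₂
    replace h₄ : c < q := by simpa [spParams] using h₄
    obtain ⟨a, ha⟩ := exists_eq_of_lt e h₂
    obtain ⟨b, hb⟩ := exists_eq_of_lt e h₄
    subst ha hb
    simp only [List.getElem_map, List.getElem_range, mul_spParams]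
    simp [spParams]
  · rw [zero_spParams]; exact (e 0).2
  · rw [one_spParams]; exact (e 1).2
  · rw [zero_spParams, one_spParams, ne_eq, coe_inj]
    exact zero_ne_one
  · rw [zero_spParams]
    change (e (ω : F) : ℕ) ≠ e 0
    rw [ne_eq, coe_inj]
    exact ω.ne_zero
  · intro a ha b hb c hc
    obtain ⟨a, rfl⟩ := exists_eq_of_lt e ha
    obtain ⟨b, rfl⟩ := exists_eq_of_lt e hb
    obtain ⟨c, rfl⟩ := exists_eq_of_lt e hc
    simp only [Axioms, add_spParams, mul_spParams, neg_spParams, zero_spParams, one_spParams,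
      coe_inj]
    refine ⟨⟨(e _).2, (e _).2, (e _).2⟩, ⟨add_assoc _ _ _, zero_add _, neg_add_cancel _⟩,
      ⟨mul_assoc _ _ _, mul_comm _ _, one_mul _⟩, mul_add _ _ _, ?_⟩
    by_cases ha0 : a = 0
    · exact .inl ha0
    · right
      rw [inv_spParams e ω ha0, mul_spParams, mul_inv_cancel₀ ha0]
      refine ⟨(e _).2, rfl, ?_⟩
      obtain ⟨k, hk, hk'⟩ := SpGen.exists_pow_eq hω ha0
      rw [hcard] at hk
      have hlt : ((List.range q).findIdx fun k => decide ((spParams n e ω).pow k = e a)) <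
          (List.range q).length :=
        List.findIdx_lt_length_of_exists ⟨k, List.mem_range.2 hk, by simp [pow_spParams, hk']⟩
      have := List.findIdx_getElem (w := hlt)
      rw [decide_eq_true_iff, List.getElem_range] at this
      exact this

end Field

/-! ### Valid tables come from fields -/

/-- The numbers of the field elements, as a type of their own. -/
@[ext] structure Elements (i : SpParams) : Type where
  /-- the number of the element -/
  num : ℕ
  num_lt : num < i.2.1

/-- The field described by valid parameters. -/
@[reducible] noncomputable def toField {i : SpParams} (h : i.Valid) : Field i.Elements :=
  have hA : ∀ a b c : i.Elements, i.Axioms a.1 b.1 c.1 :=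
    fun a b c => h.2.2.2.2 a.1 a.2 b.1 b.2 c.1 c.2
  letI : Add i.Elements := ⟨fun a b => ⟨i.add a.1 b.1, (hA a b b).1.1⟩⟩
  letI : Mul i.Elements := ⟨fun a b => ⟨i.mul a.1 b.1, (hA a b b).1.2.1⟩⟩
  letI : Neg i.Elements := ⟨fun a => ⟨i.neg a.1, (hA a a a).1.2.2⟩⟩
  letI : Zero i.Elements := ⟨⟨i.zero, h.2.2.1.2.1⟩⟩
  letI : One i.Elements := ⟨⟨i.one, h.2.2.1.2.2⟩⟩
  letI : Inv i.Elements := ⟨fun a => open Classical in if h0 : a = 0 then 0 else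
    ⟨i.inv a.1, ((hA a a a).2.2.2.2.resolve_left fun h => h0 (Elements.ext h)).1⟩⟩
  Field.ofMinimalAxioms i.Elements
    (fun a b c => Elements.ext (hA a b c).2.1.1)
    (fun a => Elements.ext (hA a a a).2.1.2.1)
    (fun a => Elements.ext (hA a a a).2.1.2.2)
    (fun a b c => Elements.ext (hA a b c).2.2.1.1)
    (fun a b => Elements.ext (hA a b b).2.2.1.2.1)
    (fun a => Elements.ext (hA a a a).2.2.1.2.2)
    (fun a h0 => by
      classical
      change a * (if h0 : a = 0 then 0 else _) = 1
      rw [dif_neg h0]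
      exact Elements.ext ((hA a a a).2.2.2.2.resolve_left fun h => h0 (Elements.ext h)).2.1)
    (by
      classical
      change (if h0 : (0 : i.Elements) = 0 then 0 else _) = (0 : i.Elements)
      rw [dif_pos rfl])
    (fun a b c => Elements.ext (hA a b c).2.2.2.1)
    ⟨0, 1, fun h' => h.2.2.2.1.1 (congrArg Elements.num h')⟩

theorem exists_eq_spParams {i : SpParams} (h : i.Valid) :
    ∃ (n q : ℕ) (_ : 2 ≤ n) (_ : Odd q) (F : Type) (_ : Field F) (e : F ≃ Fin q) (ω : Fˣ),
      (∀ a : Fˣ, a ∈ Subgroup.zpowers ω) ∧ i = spParams n e ω := by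
  let := toField h
  let e : i.Elements ≃ Fin i.2.1 :=
    ⟨fun a => ⟨a.1, a.2⟩, fun a => ⟨a.1, a.2⟩, fun _ => rfl, fun _ => rfl⟩
  let w : i.Elements := ⟨i.2.2.2.2, h.2.2.1.1⟩
  have hω0 : w ≠ 0 :=
    fun h' => h.2.2.2.1.2 (congrArg Elements.num h')
  have hi : i = spParams i.1 e (Units.mk0 w hω0) := by
    refine Prod.ext rfl (Prod.ext rfl (Prod.ext ?_ (Prod.ext ?_ rfl)))
    · refine h.2.1.1.trans ?_
      simp only [spParams]
      refine List.ext_getElem (by simp) fun r h₁ h₂ => ?_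
      refine List.ext_getElem (by simp) fun c h₃ h₄ => ?_
      simp
      rfl
    · refine h.2.1.2.trans ?_
      refine List.ext_getElem (by simp [spParams]) fun r h₁ h₂ => ?_
      refine List.ext_getElem (by simp [spParams]) fun c h₃ h₄ => ?_
      simp [spParams]
      rfl
  refine ⟨i.1, i.2.1, h.1.1, Nat.odd_iff.2 h.1.2, i.Elements, inferInstance, e,
    Units.mk0 w hω0, fun a => ?_, hi⟩
  have hp := (h.2.2.2.2 a.1.1 a.1.2 a.1.1 a.1.2 a.1.1 a.1.2).2.2.2.2.resolve_left
    (fun h' => a.ne_zero (Elements.ext h'))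
  refine ⟨(i.log a.1.1 : ℤ), ?_⟩
  beta_reduce
  rw [zpow_natCast]
  refine Units.ext (e.injective (Fin.ext ?_))
  rw [Units.val_pow_eq_pow_val]
  rw [← pow_spParams (n := i.1), ← hi]
  exact hp.2.2

end SpParams

/-! ### Symplectic matrices as tables -/

open Matrix in
/-- The inverse of a symplectic matrix with blocks `a, b, c, d` has blocks `dᵀ, -bᵀ, -cᵀ, aᵀ`. -/
theorem SymplecticGroup.inv_apply {n : ℕ} {F : Type*} [Field F]
    (A : symplecticGroup (Fin n) F) (r c : Fin n ⊕ Fin n) :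
    (A⁻¹ : symplecticGroup (Fin n) F).1 r c =
      if r.isLeft = c.isLeft then A.1 c.swap r.swap else -A.1 c.swap r.swap := by
  rw [SymplecticGroup.coe_inv]
  rcases r with r | r <;> rcases c with c | c <;>
    simp [J, Matrix.mul_apply, Matrix.one_apply]

namespace SpParams

/-- A matrix over a field given by tables: the list of its rows of numbers of field elements. -/
abbrev Mat : Type := List (List ℕ)

/-- The entry of a matrix; `0` outside of its bounds. -/
def entry (A : Mat) (r c : ℕ) : ℕ := (A.getD r []).getD c 0

/-- The `2n × 2n` matrix with the entries `f r c`. -/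
def mk (i : SpParams) (f : ℕ → ℕ → ℕ) : Mat :=
  (List.range (i.1 + i.1)).map fun r => (List.range (i.1 + i.1)).map fun c => f r c

/-- Matrix multiplication. -/
def mmul (i : SpParams) (A B : Mat) : Mat :=
  i.mk fun r c => (List.range (i.1 + i.1)).foldr
    (fun k s => i.add (i.mul (entry A r k) (entry B k c)) s) i.zero

/-- The involution of the indices that exchanges `e_j` and `f_j`. -/
def dual (i : SpParams) (r : ℕ) : ℕ := if r < i.1 then i.1 + r else r - i.1

/-- Inversion of symplectic matrices. -/
def minv (i : SpParams) (A : Mat) : Mat :=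
  i.mk fun r c => if decide (r < i.1) = decide (c < i.1) then entry A (i.dual c) (i.dual r)
    else i.neg (entry A (i.dual c) (i.dual r))

/-- The entries of the identity matrix. -/
def unit (i : SpParams) (r c : ℕ) : ℕ := if r = c then i.one else i.zero

/-- The standard generators. -/
def gens (i : SpParams) : List Mat :=
  [i.mk fun r c => if r = 0 then i.unit i.1 c
      else if r = i.1 then (if c = 0 then i.neg i.one else i.zero) else i.unit r c,
    i.mk fun r c => if r = 0 ∧ c = i.1 then i.one else i.unit r c,
    i.mk fun r c => if r = 0 ∧ c = 0 then i.2.2.2.2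
      else if r = i.1 ∧ c = i.1 then i.inv i.2.2.2.2 else i.unit r c,
    i.mk fun r c => i.unit (if r = 0 then 1 else if r = 1 then 0 else if r = i.1 then i.1 + 1
      else if r = i.1 + 1 then i.1 else r) c,
    i.mk fun r c => i.unit (if r + 1 = i.1 then 0 else if r + 1 = i.1 + i.1 then i.1
      else r + 1) c,
    i.mk fun r c => if (r = i.1 ∧ c = 1) ∨ (r = i.1 + 1 ∧ c = 0) then i.one else i.unit r c]

section Primrec

variable {α : Type*} [Primcodable α] {f : α → SpParams} {A B : α → Mat} {a b : α → ℕ}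

theorem primrec_entry (hA : Primrec A) (ha : Primrec a) (hb : Primrec b) :
    Primrec fun x => entry (A x) (a x) (b x) :=
  (Primrec.list_getD 0).comp ((Primrec.list_getD []).comp hA ha) hb

theorem primrec_dim (hf : Primrec f) : Primrec fun x => (f x).1 + (f x).1 :=
  Primrec.nat_add.comp (primrec_n hf) (primrec_n hf)

theorem primrec_mk {g : α → ℕ → ℕ → ℕ} (hf : Primrec f)
    (hg : Primrec fun x : (α × ℕ) × ℕ => g x.1.1 x.1.2 x.2) : Primrec fun x => (f x).mk (g x) :=
  Primrec.list_map (Primrec.list_range.comp (primrec_dim hf))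
    (Primrec.list_map (Primrec.list_range.comp (primrec_dim (hf.comp .fst))) hg)

theorem primrec_mmul (hf : Primrec f) (hA : Primrec A) (hB : Primrec B) :
    Primrec fun x => (f x).mmul (A x) (B x) := by
  have h₁ : Primrec fun x : (α × ℕ) × ℕ => x.1.1 := .comp .fst .fst
  have h₂ : Primrec fun x : ((α × ℕ) × ℕ) × ℕ × ℕ => x.1.1.1 := h₁.comp .fst
  refine primrec_mk hf (Primrec.list_foldr (Primrec.list_range.comp (primrec_dim (hf.comp h₁)))
    (primrec_zero (hf.comp h₁)) (h := fun x p => (f x.1.1).add ((f x.1.1).mul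
      (entry (A x.1.1) x.1.2 p.1) (entry (B x.1.1) p.1 x.2)) p.2) ?_)
  refine primrec_add (hf.comp h₂) (primrec_mul (hf.comp h₂) (primrec_entry (hA.comp h₂) ?_ ?_)
    (primrec_entry (hB.comp h₂) ?_ ?_)) (.comp .snd .snd)
  · exact .comp .snd (.comp .fst .fst)
  · exact .comp .fst .snd
  · exact .comp .fst .snd
  · exact .comp .snd .fst

theorem primrec_dual (hf : Primrec f) (ha : Primrec a) : Primrec fun x => (f x).dual (a x) :=
  .ite (Primrec.nat_lt.comp ha (primrec_n hf)) (Primrec.nat_add.comp (primrec_n hf) ha)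
    (Primrec.nat_sub.comp ha (primrec_n hf))

theorem primrec_minv (hf : Primrec f) (hA : Primrec A) : Primrec fun x => (f x).minv (A x) := by
  have h₁ : Primrec fun x : (α × ℕ) × ℕ => x.1.1 := .comp .fst .fst
  have hr : Primrec fun x : (α × ℕ) × ℕ => x.1.2 := .comp .snd .fst
  have hc : Primrec fun x : (α × ℕ) × ℕ => x.2 := .snd
  have he := primrec_entry (hA.comp h₁) (primrec_dual (hf.comp h₁) hc)
    (primrec_dual (hf.comp h₁) hr)
  refine primrec_mk hf (.ite (Primrec.eq.comp ?_ ?_) he (primrec_neg (hf.comp h₁) he))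
  · exact Primrec.nat_lt.decide.comp hr (primrec_n (hf.comp h₁))
  · exact Primrec.nat_lt.decide.comp hc (primrec_n (hf.comp h₁))

theorem primrec_unit (hf : Primrec f) (ha : Primrec a) (hb : Primrec b) :
    Primrec fun x => (f x).unit (a x) (b x) :=
  .ite (Primrec.eq.comp ha hb) (primrec_one hf) (primrec_zero hf)

theorem primrec_gens : Primrec gens := by
  have hf : Primrec fun x : (SpParams × ℕ) × ℕ => x.1.1 := .comp .fst .fst
  have hr : Primrec fun x : (SpParams × ℕ) × ℕ => x.1.2 := .comp .snd .fst
  have hc : Primrec fun x : (SpParams × ℕ) × ℕ => x.2 := .snd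
  have hn := primrec_n hf
  have hn1 : Primrec fun x : (SpParams × ℕ) × ℕ => x.1.1.1 + 1 := Primrec.succ.comp hn
  have hr1 : Primrec fun x : (SpParams × ℕ) × ℕ => x.1.2 + 1 := Primrec.succ.comp hr
  have h0 := primrec_zero hf
  have h1 := primrec_one hf
  have hu := primrec_unit hf hr hc
  have eq {a b : (SpParams × ℕ) × ℕ → ℕ} (ha : Primrec a) (hb : Primrec b) :
    PrimrecPred fun x => a x = b x := Primrec.eq.comp ha hb
  have cons {α : Type} [Primcodable α] {a : SpParams → α} {l : SpParams → List α}
    (ha : Primrec a) (hl : Primrec l) : Primrec fun x => a x :: l x := Primrec.list_cons.comp ha hl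
  refine cons (primrec_mk .id ?_) (cons (primrec_mk .id ?_) (cons (primrec_mk .id ?_)
    (cons (primrec_mk .id ?_) (cons (primrec_mk .id ?_) (cons (primrec_mk .id ?_) (.const []))))))
  · exact .ite (eq hr (.const 0)) (primrec_unit hf hn hc) (.ite (eq hr hn)
      (.ite (eq hc (.const 0)) (primrec_neg hf h1) h0) hu)
  · exact .ite ((eq hr (.const 0)).and (eq hc hn)) h1 hu
  · exact .ite ((eq hr (.const 0)).and (eq hc (.const 0))) (primrec_ω hf)
      (.ite ((eq hr hn).and (eq hc hn)) (primrec_inv hf (primrec_ω hf)) hu)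
  · exact primrec_unit hf (.ite (eq hr (.const 0)) (.const 1) (.ite (eq hr (.const 1)) (.const 0)
      (.ite (eq hr hn) hn1 (.ite (eq hr hn1) hn hr)))) hc
  · exact primrec_unit hf (.ite (eq hr1 hn) (.const 0) (.ite (eq hr1 (Primrec.nat_add.comp hn hn))
      hn hr1)) hc
  · exact .ite (((eq hr hn).and (eq hc (.const 1))).or ((eq hr hn1).and (eq hc (.const 0)))) h1 hu

end Primrec

section Field

open Matrix

variable {n q : ℕ} {F : Type*} [Field F] (e : F ≃ Fin q) (ω : Fˣ)

/-- The number of a basis vector, in the order `e_1, …, e_n, f_1, …, f_n`. -/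
def num (r : Fin n ⊕ Fin n) : ℕ := finSumFinEquiv r

theorem num_inl (r : Fin n) : num (.inl r) = r := by simp [num]

theorem num_inr (r : Fin n) : num (.inr r) = n + r := by
  simp [num, add_comm]

/-- The table of a symplectic matrix. -/
def enc (A : symplecticGroup (Fin n) F) : Mat :=
  List.ofFn fun r : Fin (n + n) => List.ofFn fun c : Fin (n + n) =>
    (e (A.1 (finSumFinEquiv.symm r) (finSumFinEquiv.symm c)) : ℕ)

theorem entry_enc (A : symplecticGroup (Fin n) F) (r c : Fin n ⊕ Fin n) :
    entry (enc e A) (num r) (num c) = e (A.1 r c) := by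
  simp [entry, enc, num, List.getD_eq_getElem?_getD]

theorem enc_injective : Function.Injective (enc e : symplecticGroup (Fin n) F → _) := by
  intro A B h
  refine Subtype.ext (Matrix.ext fun r c => ?_)
  rw [← coe_inj e, ← entry_enc, ← entry_enc, h]

theorem mk_eq_enc {A : symplecticGroup (Fin n) F} {f : ℕ → ℕ → ℕ}
    (h : ∀ r c, f (num r) (num c) = e (A.1 r c)) : (spParams n e ω).mk f = enc e A := by
  refine List.ext_getElem (by simp [spParams, mk, enc]) fun r h₁ h₂ => ?_
  refine List.ext_getElem (by simp [spParams, mk, enc]) fun c h₃ h₄ => ?_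
  have hr : r < n + n := by simpa [enc] using h₂
  have hc : c < n + n := by simpa [enc] using h₄
  have := h (finSumFinEquiv.symm ⟨r, hr⟩) (finSumFinEquiv.symm ⟨c, hc⟩)
  simp only [num, Equiv.apply_symm_apply] at this
  simp [mk, enc, this]

theorem foldr_add_spParams {m : ℕ} {f : Fin m → F} {g : ℕ → ℕ} (h : ∀ k : Fin m, g k = e (f k)) :
    (List.range m).foldr (fun k s => (spParams n e ω).add (g k) s) (spParams n e ω).zero =
      e (∑ k, f k) := by
  induction m generalizing g with
  | zero => simpa using zero_spParams e ω
  | succ m ih =>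
    have h0 := h 0
    rw [Fin.val_zero] at h0
    rw [List.range_succ_eq_map, List.foldr_cons, List.foldr_map, Fin.sum_univ_succ, ← add_spParams,
      ih (f := fun k => f k.succ) (g := fun k => g k.succ) fun k => h k.succ, h0]

theorem mmul_enc (A B : symplecticGroup (Fin n) F) :
    (spParams n e ω).mmul (enc e A) (enc e B) = enc e (A * B) := by
  refine mk_eq_enc e ω fun r c => ?_
  refine (foldr_add_spParams (m := n + n) e ω (f := fun k => A.1 r (finSumFinEquiv.symm k) *
    B.1 (finSumFinEquiv.symm k) c) fun k => ?_).trans ?_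
  · have := mul_spParams (n := n) e ω (A.1 r (finSumFinEquiv.symm k))
      (B.1 (finSumFinEquiv.symm k) c)
    rw [← entry_enc, ← entry_enc] at this
    simpa [num] using this
  · rw [Equiv.sum_comp finSumFinEquiv.symm fun k => A.1 r k * B.1 k c]
    rfl

theorem dual_num (r : Fin n ⊕ Fin n) : (spParams n e ω).dual (num r) = num r.swap := by
  rcases r with r | r <;> simp [dual, spParams, num_inl, num_inr]

theorem num_lt_iff (r : Fin n ⊕ Fin n) : num r < n ↔ r.isLeft := by
  rcases r with r | r <;> simp [num_inl, num_inr]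

theorem minv_enc (A : symplecticGroup (Fin n) F) :
    (spParams n e ω).minv (enc e A) = enc e A⁻¹ := by
  refine mk_eq_enc e ω fun r c => ?_
  rw [SymplecticGroup.inv_apply, dual_num, dual_num, entry_enc, neg_spParams]
  change (if decide (num r < n) = decide (num c < n) then _ else _) = _
  simp only [num_lt_iff, Bool.decide_eq_true]
  split_ifs <;> rfl

theorem num_inj {r c : Fin n ⊕ Fin n} : num r = num c ↔ r = c := by
  rw [num, num, ← Fin.ext_iff, finSumFinEquiv.apply_eq_iff_eq]

theorem unit_num (r c : Fin n ⊕ Fin n) :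
    (spParams n e ω).unit (num r) (num c) = e (if r = c then 1 else 0 : F) := by
  rw [unit, one_spParams, zero_spParams]
  simp only [num_inj]
  split_ifs <;> rfl

theorem val_finRotate (r : Fin n) :
    (finRotate n r : ℕ) = if (r : ℕ) + 1 = n then 0 else (r : ℕ) + 1 := by
  rcases n with - | m
  · exact r.elim0
  split_ifs with h
  · obtain rfl : r = Fin.last m := Fin.ext (by simpa using h)
    simp
  · exact coe_finRotate_of_ne_last fun h' => h (by simp [h'])

theorem gens_spParams (hn : 2 ≤ n) :
    (spParams n e ω).gens = List.ofFn fun k => enc e (stdGen hn ω k) := by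
  have e₁ : (spParams n e ω).1 = num (.inr (SpGen.i₁ hn)) := by simp [num_inr, spParams, SpGen.i₁]
  have h0 : 0 = num (.inl (SpGen.i₁ hn)) := by simp [num_inl, SpGen.i₁]
  have h1 : 1 = num (.inl (SpGen.i₂ hn)) := by simp [num_inl, SpGen.i₂]
  have e₂ : (spParams n e ω).1 + 1 = num (.inr (SpGen.i₂ hn)) := by
    simp [num_inr, spParams, SpGen.i₂]
  have hω : (spParams n e ω).2.2.2.2 = e (ω : F) := rfl
  have hne := SpGen.i₁_ne_i₂ hn
  rw [show (List.ofFn fun k => enc e (stdGen hn ω k)) = [enc e (SpGen.s F hn), enc e (SpGen.t F hn),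
    enc e (SpGen.δ ω hn), enc e (SpGen.u F hn), enc e (SpGen.v n F), enc e (SpGen.x F hn)] by
      simp [List.ofFn_succ, stdGen]]
  simp only [gens, List.cons.injEq, and_true]
  refine ⟨mk_eq_enc e ω fun r c => ?_, mk_eq_enc e ω fun r c => ?_, mk_eq_enc e ω fun r c => ?_,
    mk_eq_enc e ω fun r c => ?_, mk_eq_enc e ω fun r c => ?_, mk_eq_enc e ω fun r c => ?_⟩
  · simp only [e₁, h0, num_inj, unit_num, one_spParams, neg_spParams, zero_spParams]
    clear e₁ e₂ h0 h1 hω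
    rcases r with r | r <;> rcases c with c | c <;>
      simp [SpGen.s, SpGen.ofImages, SpGen.e, SpGen.f, Pi.single_apply, ite_apply] <;>
      split_ifs <;> grind [neg_zero]
  · simp only [e₁, h0, num_inj, unit_num, one_spParams]
    clear e₁ e₂ h0 h1 hω
    rcases r with r | r <;> rcases c with c | c <;>
      simp [SpGen.t, SpGen.ofImages, SpGen.e, SpGen.f, Pi.single_apply, ite_apply] <;>
      split_ifs <;> grind [neg_zero]
  · simp only [e₁, h0, num_inj, unit_num, hω, inv_spParams e ω ω.ne_zero]
    clear e₁ e₂ h0 h1 hω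
    rcases r with r | r <;> rcases c with c | c <;>
      simp [SpGen.δ, SpGen.ofImages, SpGen.e, SpGen.f, Pi.single_apply, ite_apply] <;>
      split_ifs <;> grind [neg_zero]
  · have key : (if num r = 0 then 1 else if num r = 1 then 0 else if num r = (spParams n e ω).1 then
        (spParams n e ω).1 + 1 else if num r = (spParams n e ω).1 + 1 then (spParams n e ω).1
        else num r) = num (r.map (Equiv.swap (SpGen.i₁ hn) (SpGen.i₂ hn))
          (Equiv.swap (SpGen.i₁ hn) (SpGen.i₂ hn))) := by
      rw [e₂, e₁, h0, h1]
      simp only [num_inj]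
      clear e₁ e₂ h0 h1 hω
      rcases r with r | r <;> simp [Equiv.swap_apply_def] <;>
        split_ifs <;> simp_all
    rw [key, unit_num]
    clear e₁ e₂ h0 h1 hω
    rcases r with r | r <;> rcases c with c | c <;>
      simp [SpGen.u, SpGen.ofImages, SpGen.e, SpGen.f, Pi.single_apply, eq_comm]
  · have key : (if num r + 1 = n then 0 else if num r + 1 = n + n then n else num r + 1) =
        num (r.map (finRotate n) (finRotate n)) := by
      rcases r with r | r
      · rw [Sum.map_inl, num_inl, num_inl, val_finRotate]
        split_ifs <;> omega
      · rw [Sum.map_inr, num_inr, num_inr, val_finRotate]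
        split_ifs <;> omega
    refine (congrArg (fun m => (spParams n e ω).unit m (num c)) key).trans ?_
    rw [unit_num]
    clear e₁ e₂ h0 h1 hω
    rcases r with r | r <;> rcases c with c | c <;>
      simp [SpGen.v, SpGen.ofImages, SpGen.e, SpGen.f, Pi.single_apply, eq_comm]
  · simp only [e₂]
    simp only [e₁, h0, h1, num_inj, one_spParams, unit_num]
    clear e₁ e₂ h0 h1 hω
    rcases r with r | r <;> rcases c with c | c <;>
      simp [SpGen.x, SpGen.ofImages, SpGen.e, SpGen.f, Pi.single_apply, ite_apply] <;>
      split_ifs <;> grind [neg_zero]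

end Field

end SpParams

/-! ### Case distinctions and searches in primitive recursive functions -/

theorem Primrec.slpInstr_cases {α σ : Type*} [Primcodable α] [Primcodable σ] {k : ℕ}
    {I : α → SLPInstr k} {f : α → SLPInstr k → σ} (hI : Primrec I)
    (h₁ : Primrec fun x : α × Fin k => f x.1 (.gen x.2))
    (h₂ : Primrec fun x : α × ℕ × ℕ => f x.1 (.mul x.2.1 x.2.2))
    (h₃ : Primrec fun x : α × ℕ => f x.1 (.inv x.2)) : Primrec fun a => f a (I a) := by
  have hI' : Primrec fun a => SLPInstr.equivSum k (I a) := Primrec.of_equiv.comp hI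
  have h₂₃ : Primrec₂ fun a (s : (ℕ × ℕ) ⊕ ℕ) =>
      (Sum.casesOn s (fun b => f a (.mul b.1 b.2)) fun b => f a (.inv b) : σ) :=
    Primrec.sumCasesOn .snd (h₂.comp (.pair (.comp .fst .fst) .snd))
      (h₃.comp (.pair (.comp .fst .fst) .snd))
  refine (Primrec.sumCasesOn (g := fun a b => f a (.gen b)) hI' h₁ h₂₃).of_eq fun a => ?_
  cases I a <;> rfl

theorem Primrec.move_cases {α σ : Type*} [Primcodable α] [Primcodable σ] {k : ℕ}
    {I : α → Move k} {f : α → Move k → σ} (hI : Primrec I)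
    (h₁ : Primrec fun x : α × ℕ × ℕ => f x.1 (.mul x.2.1 x.2.2))
    (h₂ : Primrec fun x : α × ℕ => f x.1 (.inv x.2))
    (h₃ : Primrec fun x : α × ℕ × ℕ => f x.1 (.eqTest x.2.1 x.2.2))
    (h₄ : Primrec fun x : α × SLP k => f x.1 (.output x.2)) : Primrec fun a => f a (I a) := by
  have hI' : Primrec fun a => Move.equivSum k (I a) := Primrec.of_equiv.comp hI
  have h₃₄ : Primrec₂ fun a (s : (ℕ × ℕ) ⊕ SLP k) =>
      (Sum.casesOn s (fun b => f a (.eqTest b.1 b.2)) fun b => f a (.output b) : σ) :=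
    Primrec.sumCasesOn .snd (h₃.comp (.pair (.comp .fst .fst) .snd))
      (h₄.comp (.pair (.comp .fst .fst) .snd))
  have h₂₄ : Primrec₂ fun a (s : ℕ ⊕ (ℕ × ℕ) ⊕ SLP k) =>
      (Sum.casesOn s (fun b => f a (.inv b)) fun s => Sum.casesOn s
        (fun b => f a (.eqTest b.1 b.2)) fun b => f a (.output b) : σ) :=
    Primrec.sumCasesOn .snd (h₂.comp (.pair (.comp .fst .fst) .snd))
      (h₃₄.comp (.comp .fst .fst) .snd)
  refine (Primrec.sumCasesOn (g := fun a (b : ℕ × ℕ) => f a (.mul b.1 b.2)) hI' h₁ h₂₄).of_eq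
    fun a => ?_
  cases I a <;> rfl

theorem PrimrecRel.forall_mem_of_primrec {α β : Type*} [Primcodable α] [Primcodable β]
    {R : α → β → Prop} {l : α → List β} (hl : Primrec l) (hR : PrimrecRel R) :
    PrimrecPred fun a => ∀ b ∈ l a, R a b :=
  (PrimrecRel.forall_mem_list (R := fun b a => R a b)
    (hR.comp Primrec.snd Primrec.fst)).comp hl Primrec.id

theorem PrimrecRel.exists_mem_of_primrec {α β : Type*} [Primcodable α] [Primcodable β]
    {R : α → β → Prop} {l : α → List β} (hl : Primrec l) (hR : PrimrecRel R) :
    PrimrecPred fun a => ∃ b ∈ l a, R a b :=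
  (PrimrecRel.exists_mem_list (R := fun b a => R a b)
    (hR.comp Primrec.snd Primrec.fst)).comp hl Primrec.id

/-- Objects with a decidable property, if they always exist, can be found by unbounded search. -/
theorem PrimrecRel.exists_computable {α β : Type*} [Primcodable α] [Primcodable β]
    {R : α → β → Prop} (hR : PrimrecRel R) (h : ∀ a, ∃ b, R a b) :
    ∃ f : α → β, Computable f ∧ ∀ a, R a (f a) := by
  classical
  let F : α → ℕ → Option β := fun a k =>
    (Encodable.decode k).bind fun b => if R a b then some b else none
  have hF : Primrec₂ F := by
    refine Primrec.option_bind (Primrec.decode.comp .snd) ?_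
    exact .ite (hR.comp (.comp .fst .fst) .snd) (Primrec.option_some.comp .snd) (.const none)
  have hdom : ∀ a, (Nat.rfindOpt (F a)).Dom := by
    intro a
    obtain ⟨b, hb⟩ := h a
    exact Nat.rfindOpt_dom.2 ⟨Encodable.encode b, b, by simp [F, hb]⟩
  refine ⟨fun a => (Nat.rfindOpt (F a)).get (hdom a),
    (Partrec.rfindOpt hF.to_comp).of_eq_tot fun a => Part.get_mem _, fun a => ?_⟩
  obtain ⟨k, hk⟩ := Nat.rfindOpt_spec (Part.get_mem (hdom a))
  obtain ⟨b, -, hb⟩ := Option.bind_eq_some_iff.1 hk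
  by_cases hRb : R a b
  · rw [if_pos hRb, Option.some_inj] at hb
    rwa [hb] at hRb
  · simp [hRb] at hb

/-! ### Simulating an algorithm on matrices -/

/-- The strategy described by a finite table. -/
def tableStrategy {k : ℕ} (T : List (List (Option Bool) × Move k)) (h : List (Option Bool)) :
    Move k :=
  (T.lookup h).getD (.output [])

theorem primrec_tableStrategy {k : ℕ} :
    Primrec₂ (tableStrategy : List (List (Option Bool) × Move k) → _) :=
  Primrec.option_getD.comp ((Primrec.listLookup.comp .snd .fst).of_eq fun x => by
    rw [lawful_beq_subsingleton instBEqOfDecidableEq List.instBEq]) (.const _)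

namespace SpParams

/-- A strategy as a finite table of histories and moves. -/
abbrev Table : Type := List (List (Option Bool) × Move 6)

/-- A table with a list of matrices on which it has been tried out. -/
abbrev Certificate : Type := Table × List Mat

/-- The value of an instruction in the matrix group. -/
def evalInstr (i : SpParams) (w : List Mat) : SLPInstr 6 → Option Mat
  | .gen a => i.gens[(a : ℕ)]?
  | .mul a b => w[a]?.bind fun x => w[b]?.map fun y => i.mmul x y
  | .inv a => w[a]?.map i.minv

/-- The value of a straight-line program in the matrix group. -/
def evalSLP (i : SpParams) (p : SLP 6) : Option Mat :=
  (p.foldl (fun o I => o.bind fun w => (i.evalInstr w I).map fun a => w ++ [a]) (some [])).bind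
    fun w => w[w.length - 1]?

/-- A state of the simulation: the replies and the registers, or the output. -/
abbrev State : Type := (List (Option Bool) × List Mat) ⊕ SLP 6

/-- The effect of a move in the matrix group. -/
def respond (i : SpParams) (c : List (Option Bool) × List Mat) : Move 6 → Option State
  | .mul a b => c.2[a]?.bind fun x => c.2[b]?.map fun y =>
      .inl (c.1 ++ [none], c.2 ++ [i.mmul x y])
  | .inv a => c.2[a]?.map fun x => .inl (c.1 ++ [none], c.2 ++ [i.minv x])
  | .eqTest a b => c.2[a]?.bind fun x => c.2[b]?.map fun y =>
      .inl (c.1 ++ [some (decide (x = y))], c.2)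
  | .output p => some (.inr p)

/-- One step of the simulation; `none` is the state after an error. -/
def step (i : SpParams) (T : Table) (s : Option State) : Option State :=
  s.bind fun s => Sum.casesOn s (fun c => i.respond c (tableStrategy T c.1)) fun p => some (.inr p)

/-- The output that is read off from a state. -/
def State.output (s : Option State) : Option (SLP 6) :=
  s.bind fun s => Sum.casesOn s (fun _ => none) some

/-- The bound for the number of operations. -/
def maxOps (i : SpParams) : ℕ := 360 * (i.1 ^ 2 * i.2.1)

/-- The output for the matrix `g` of the strategy that is given by the table `T`. -/
def simulate (i : SpParams) (T : Table) (g : Mat) :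
    Option (SLP 6) :=
  State.output ((i.step T)^[i.maxOps + 1] (some (.inl ([], i.gens ++ [g]))))

theorem output_iterate_step (i : SpParams) (T : Table) (N : ℕ)
    (h : List (Option Bool)) (r : List Mat) :
    State.output ((i.step T)^[N + 1] (some (.inl (h, r)))) =
      play i.mmul i.minv (fun a b => decide (a = b)) (tableStrategy T) N h r := by
  have hnone : ∀ N, (i.step T)^[N] none = none := fun N => Function.iterate_fixed rfl N
  have hout : ∀ N p, (i.step T)^[N] (some (.inr p)) = some (.inr p) :=
    fun N p => Function.iterate_fixed rfl N
  induction N generalizing h r with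
  | zero =>
    rw [Function.iterate_succ_apply, Function.iterate_zero_apply]
    change State.output (i.respond (h, r) (tableStrategy T h)) = _
    rw [play]
    rcases tableStrategy T h with ⟨a, b⟩ | a | ⟨a, b⟩ | p
    · simp only [respond]
      rcases r[a]? with - | x <;> rcases r[b]? with - | y <;> rfl
    · simp only [respond]
      rcases r[a]? with - | x <;> rfl
    · simp only [respond]
      rcases r[a]? with - | x <;> rcases r[b]? with - | y <;> rfl
    · rfl
  | succ N ih =>
    rw [Function.iterate_succ_apply]
    change State.output ((i.step T)^[N + 1] (i.respond (h, r) (tableStrategy T h))) = _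
    rw [play]
    rcases tableStrategy T h with ⟨a, b⟩ | a | ⟨a, b⟩ | p
    · simp only [respond]
      rcases r[a]? with - | x
      · exact congrArg _ (hnone _)
      rcases r[b]? with - | y
      · exact congrArg _ (hnone _)
      exact ih _ _
    · simp only [respond]
      rcases r[a]? with - | x
      · exact congrArg _ (hnone _)
      exact ih _ _
    · simp only [respond]
      rcases r[a]? with - | x
      · exact congrArg _ (hnone _)
      rcases r[b]? with - | y
      · exact congrArg _ (hnone _)
      exact ih _ _
    · exact congrArg _ (hout _ p)

/-- The table `T` solves the problem for the matrix `g`: its output `p` has the right length, it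
can be evaluated, and its value agrees with `g` up to a matrix that commutes with all generators.
The bound for the length avoids logarithms. -/
def Solves (i : SpParams) (T : Table) (g : Mat) : Prop :=
  ∃ p ∈ (i.simulate T g).toList, 2 ^ p.length ≤ i.2.1 ^ (540 * i.1 ^ 2) ∧
    ∃ z ∈ (i.evalSLP p).toList, ∀ s ∈ i.gens,
      i.mmul (i.mmul (i.minv z) g) s = i.mmul s (i.mmul (i.minv z) g)

/-- The list `d.2` contains the generators and is closed under multiplication by them, and the table
`d.1` solves the problem for its members. -/
def Check (i : SpParams) (d : Certificate) : Prop :=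
  (∀ s ∈ i.gens, ∃ h ∈ d.2, h = s) ∧ (∀ g ∈ d.2, ∀ s ∈ i.gens, ∃ h ∈ d.2, h = i.mmul g s) ∧
    ∀ g ∈ d.2, i.Solves d.1 g

section Primrec

variable {α : Type*} [Primcodable α] {f : α → SpParams}
  {T : α → Table} {A : α → Mat}

theorem primrec_evalInstr {w : α → List Mat} {I : α → SLPInstr 6} (hf : Primrec f)
    (hw : Primrec w) (hI : Primrec I) : Primrec fun x => (f x).evalInstr (w x) (I x) := by
  refine Primrec.slpInstr_cases (f := fun x I => (f x).evalInstr (w x) I) hI ?_ ?_ ?_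
  · exact Primrec.list_getElem?.comp (primrec_gens.comp (hf.comp .fst))
      (Primrec.fin_val.comp .snd)
  · refine Primrec.option_bind (Primrec.list_getElem?.comp (hw.comp .fst) (.comp .fst .snd)) ?_
    refine Primrec.option_map (Primrec.list_getElem?.comp (hw.comp (.comp .fst .fst))
      (.comp .snd (.comp .snd .fst))) ?_
    exact primrec_mmul (hf.comp (.comp .fst (.comp .fst .fst))) (.comp .snd .fst) .snd
  · refine Primrec.option_map (Primrec.list_getElem?.comp (hw.comp .fst) .snd) ?_
    exact primrec_minv (hf.comp (.comp .fst .fst)) .snd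

theorem primrec_evalSLP {p : α → SLP 6} (hf : Primrec f) (hp : Primrec p) :
    Primrec fun x => (f x).evalSLP (p x) := by
  refine Primrec.option_bind (Primrec.list_foldl hp (.const _) (h := fun x
    (y : Option (List Mat) × SLPInstr 6) => y.1.bind fun w =>
    ((f x).evalInstr w y.2).map fun a => w ++ [a]) ?_) ?_
  · refine Primrec.option_bind (.comp .fst .snd) (Primrec.option_map ?_ ?_)
    · exact primrec_evalInstr (hf.comp (.comp .fst .fst)) .snd (.comp .snd (.comp .snd .fst))
    · exact Primrec.list_concat.comp (.comp .snd .fst) .snd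
  · exact Primrec.list_getElem?.comp .snd
      (Primrec.nat_sub.comp (Primrec.list_length.comp .snd) (.const 1))

theorem primrec_respond {c : α → List (Option Bool) × List Mat} {m : α → Move 6}
    (hf : Primrec f) (hc : Primrec c) (hm : Primrec m) :
    Primrec fun x => (f x).respond (c x) (m x) := by
  have hget {β : Type _} [Primcodable β] {g : β → α} {k : β → ℕ} (hg : Primrec g)
      (hk : Primrec k) : Primrec fun x => (c (g x)).2[k x]? :=
    Primrec.list_getElem?.comp (.comp .snd (hc.comp hg)) hk
  refine Primrec.move_cases (f := fun x I => (f x).respond (c x) I) hm ?_ ?_ ?_ ?_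
  · refine Primrec.option_bind (hget .fst (.comp .fst .snd)) (Primrec.option_map
      (hget (.comp .fst .fst) (.comp .snd (.comp .snd .fst))) ?_)
    have hα : Primrec fun x : ((α × ℕ × ℕ) × Mat) × Mat => x.1.1.1 :=
      .comp .fst (.comp .fst .fst)
    exact Primrec.sumInl.comp (.pair (Primrec.list_concat.comp (.comp .fst (hc.comp hα)) (.const _))
      (Primrec.list_concat.comp (.comp .snd (hc.comp hα))
        (primrec_mmul (hf.comp hα) (.comp .snd .fst) .snd)))
  · refine Primrec.option_map (hget .fst .snd) ?_
    have hα : Primrec fun x : (α × ℕ) × Mat => x.1.1 := .comp .fst .fst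
    exact Primrec.sumInl.comp (.pair (Primrec.list_concat.comp (.comp .fst (hc.comp hα)) (.const _))
      (Primrec.list_concat.comp (.comp .snd (hc.comp hα)) (primrec_minv (hf.comp hα) .snd)))
  · refine Primrec.option_bind (hget .fst (.comp .fst .snd)) (Primrec.option_map
      (hget (.comp .fst .fst) (.comp .snd (.comp .snd .fst))) ?_)
    have hα : Primrec fun x : ((α × ℕ × ℕ) × Mat) × Mat => x.1.1.1 :=
      .comp .fst (.comp .fst .fst)
    exact Primrec.sumInl.comp (.pair (Primrec.list_concat.comp (.comp .fst (hc.comp hα))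
      (Primrec.option_some.comp (Primrec.eq.decide.comp (.comp .snd .fst) .snd)))
      (.comp .snd (hc.comp hα)))
  · exact Primrec.option_some.comp (Primrec.sumInr.comp .snd)

theorem primrec_step {s : α → Option State} (hf : Primrec f) (hT : Primrec T) (hs : Primrec s) :
    Primrec fun x => (f x).step (T x) (s x) := by
  refine Primrec.option_bind hs (Primrec.sumCasesOn .snd ?_ ?_)
  · have hα : Primrec fun x : (α × State) × List (Option Bool) × List Mat => x.1.1 :=
      .comp .fst .fst
    exact primrec_respond (hf.comp hα) .snd
      (primrec_tableStrategy.comp (hT.comp hα) (.comp .fst .snd))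
  · exact Primrec.option_some.comp (Primrec.sumInr.comp .snd)

theorem primrec_natPow {a b : α → ℕ} (ha : Primrec a) (hb : Primrec b) :
    Primrec fun x => a x ^ b x :=
  (Primrec₂.unpaired'.1 Nat.Primrec.pow).comp ha hb

theorem primrec_simulate (hf : Primrec f) (hT : Primrec T) (hA : Primrec A) :
    Primrec fun x => (f x).simulate (T x) (A x) := by
  refine Primrec.option_bind (Primrec.nat_iterate (Primrec.succ.comp ?_) ?_ ?_)
    (Primrec.sumCasesOn .snd (Primrec.const _).to₂ (Primrec.option_some.comp .snd))
  · exact Primrec.nat_mul.comp (.const 360) (Primrec.nat_mul.comp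
      (primrec_natPow (primrec_n hf) (.const 2)) (primrec_q hf))
  · exact Primrec.option_some.comp (Primrec.sumInl.comp (.pair (.const _)
      (Primrec.list_concat.comp (primrec_gens.comp hf) hA)))
  · exact primrec_step (hf.comp .fst) (hT.comp .fst) .snd

theorem primrecPred_solves (hf : Primrec f) (hT : Primrec T) (hA : Primrec A) :
    PrimrecPred fun x => (f x).Solves (T x) (A x) := by
  refine PrimrecRel.exists_mem_of_primrec (R := fun x p =>
    2 ^ p.length ≤ (f x).2.1 ^ (540 * (f x).1 ^ 2) ∧ ∃ z ∈ ((f x).evalSLP p).toList,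
      ∀ s ∈ (f x).gens, (f x).mmul ((f x).mmul ((f x).minv z) (A x)) s =
        (f x).mmul s ((f x).mmul ((f x).minv z) (A x)))
    (Primrec.optionToList.comp (primrec_simulate hf hT hA)) (.and ?_ ?_)
  · exact Primrec.nat_le.comp (primrec_natPow (.const 2) (Primrec.list_length.comp .snd))
      (primrec_natPow (primrec_q (hf.comp .fst)) (Primrec.nat_mul.comp (.const 540)
        (primrec_natPow (primrec_n (hf.comp .fst)) (.const 2))))
  refine PrimrecRel.exists_mem_of_primrec (R := fun (x : α × SLP 6) z =>
      ∀ s ∈ (f x.1).gens, (f x.1).mmul ((f x.1).mmul ((f x.1).minv z) (A x.1)) s =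
        (f x.1).mmul s ((f x.1).mmul ((f x.1).minv z) (A x.1)))
    (Primrec.optionToList.comp (primrec_evalSLP (hf.comp .fst) .snd)) ?_
  refine PrimrecRel.forall_mem_of_primrec (R := fun (x : (α × SLP 6) × Mat) s =>
      (f x.1.1).mmul ((f x.1.1).mmul ((f x.1.1).minv x.2) (A x.1.1)) s =
        (f x.1.1).mmul s ((f x.1.1).mmul ((f x.1.1).minv x.2) (A x.1.1)))
    (primrec_gens.comp (hf.comp (.comp .fst .fst))) ?_
  have hα : Primrec fun x : ((α × SLP 6) × Mat) × Mat => x.1.1.1 :=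
    .comp .fst (.comp .fst .fst)
  have hz := primrec_mmul (hf.comp hα) (primrec_minv (hf.comp hα) (.comp .snd .fst)) (hA.comp hα)
  exact Primrec.eq.comp (primrec_mmul (hf.comp hα) hz .snd) (primrec_mmul (hf.comp hα) .snd hz)

theorem primrecRel_check : PrimrecRel Check := by
  have h₂ : Primrec fun x : SpParams × Certificate => x.2.2 := .comp .snd .snd
  refine .and (PrimrecRel.forall_mem_of_primrec
      (R := fun (x : SpParams × Certificate) s => ∃ h ∈ x.2.2, h = s) (primrec_gens.comp .fst) ?_)
    (.and (PrimrecRel.forall_mem_of_primrec (R := fun (x : SpParams × Certificate) g =>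
        ∀ s ∈ x.1.gens, ∃ h ∈ x.2.2, h = x.1.mmul g s) h₂ ?_)
      (PrimrecRel.forall_mem_of_primrec (R := fun (x : SpParams × Certificate) g =>
        x.1.Solves x.2.1 g) h₂ ?_))
  · exact PrimrecRel.exists_mem_of_primrec (R := fun (x : (SpParams × Certificate) × Mat) h =>
      h = x.2) (h₂.comp .fst) (Primrec.eq.comp .snd (.comp .snd .fst))
  · refine PrimrecRel.forall_mem_of_primrec (R := fun (x : (SpParams × Certificate) × Mat) s =>
      ∃ h ∈ x.1.2.2, h = x.1.1.mmul x.2 s) (primrec_gens.comp (.comp .fst .fst)) ?_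
    refine PrimrecRel.exists_mem_of_primrec
      (R := fun (x : ((SpParams × Certificate) × Mat) × Mat) h => h = x.1.1.1.mmul x.1.2 x.2)
      (h₂.comp (.comp .fst .fst)) (Primrec.eq.comp .snd ?_)
    exact primrec_mmul (.comp .fst (.comp .fst (.comp .fst .fst))) (.comp .snd (.comp .fst .fst))
      (.comp .snd .fst)
  · exact primrecPred_solves (.comp .fst .fst) (.comp .fst (.comp .snd .fst)) .snd

end Primrec

end SpParams

/-! ### The existence of a table that passes the check -/

theorem List.lookup_map_self {α β : Type*} [BEq α] [LawfulBEq α] (f : α → β) {l : List α} {a : α}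
    (ha : a ∈ l) : (l.map fun b => (b, f b)).lookup a = some (f a) := by
  induction l with
  | nil => simp at ha
  | cons b l ih =>
    rw [List.map_cons, List.lookup_cons]
    by_cases hab : a = b
    · simp [hab]
    · rw [beq_false_of_ne hab]
      exact ih (by simpa [hab] using ha)

/-- A strategy is determined by its moves after the histories that can occur. -/
theorem play_congr {k : ℕ} {M : Type*} {mul : M → M → M} {inv : M → M} {eq : M → M → Bool}
    {A A' : List (Option Bool) → Move k} {L : ℕ} (hA : ∀ h, h.length ≤ L → A h = A' h) (N : ℕ)
    (h : List (Option Bool)) (r : List M) (hN : h.length + N ≤ L) :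
    play mul inv eq A N h r = play mul inv eq A' N h r := by
  induction N generalizing h r with
  | zero => rw [play, play, hA h (by omega)]
  | succ N ih =>
    have ih' : ∀ b r, play mul inv eq A N (h ++ [b]) r = play mul inv eq A' N (h ++ [b]) r :=
      fun b r => ih _ _ (by simp; omega)
    rw [play, play, hA h (by omega)]
    simp only [ih']

theorem exists_tableStrategy_eq {k : ℕ} (A : List (Option Bool) → Move k) (N : ℕ) :
    ∃ T, ∀ h, h.length ≤ N → tableStrategy T h = A h := by
  refine ⟨(List.finite_length_le (Option Bool) N).toFinset.toList.map fun h => (h, A h),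
    fun h hh => ?_⟩
  rw [tableStrategy, List.lookup_map_self A (by simpa using hh), Option.getD_some]

namespace SpParams

section Field

open Matrix

variable {n q : ℕ} {F : Type*} [Field F] (e : F ≃ Fin q) {ω : Fˣ}

theorem evalInstr_spParams (hn : 2 ≤ n) (w : List (symplecticGroup (Fin n) F)) (I : SLPInstr 6) :
    (spParams n e ω).evalInstr (w.map (enc e)) I = (I.eval (stdGen hn ω) w).map (enc e) := by
  rcases I with a | ⟨a, b⟩ | a
  · rw [evalInstr, gens_spParams e ω hn, List.getElem?_ofFn]
    simp only [a.2, SLPInstr.eval]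
    rfl
  · simp only [evalInstr, SLPInstr.eval, List.getElem?_map]
    rcases w[a]? with - | x <;> rcases w[b]? with - | y <;> simp [mmul_enc]
  · simp only [evalInstr, SLPInstr.eval, List.getElem?_map]
    rcases w[a]? with - | x <;> simp [minv_enc]

theorem evalSLP_spParams (hn : 2 ≤ n) (p : SLP 6) :
    (spParams n e ω).evalSLP p = (SLP.eval (stdGen hn ω) p).map (enc e) := by
  have hnone : ∀ p : SLP 6, p.foldl (fun o I => o.bind fun w =>
      ((spParams n e ω).evalInstr w I).map fun a => w ++ [a]) none = none := by
    intro p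
    induction p with
    | nil => rfl
    | cons I p ih => exact ih
  have key : ∀ (p : SLP 6) (w : List (symplecticGroup (Fin n) F)),
      p.foldl (fun o I => o.bind fun w => ((spParams n e ω).evalInstr w I).map fun a => w ++ [a])
        (some (w.map (enc e))) = (SLP.values (stdGen hn ω) w p).map (List.map (enc e)) := by
    intro p
    induction p with
    | nil => intro w; rfl
    | cons I p ih =>
      intro w
      rw [List.foldl_cons, Option.bind_some, evalInstr_spParams e hn, SLP.values]
      rcases I.eval (stdGen hn ω) w with - | a
      · exact hnone p
      · rw [Option.bind_some, ← ih]
        simp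
  have h := key p []
  rw [List.map_nil] at h
  rw [evalSLP, h, SLP.eval]
  rcases SLP.values (stdGen hn ω) [] p with - | w
  · rfl
  · simp [List.getLast?_eq_getElem?]

theorem simulate_spParams (hn : 2 ≤ n) (T : Table) (g : symplecticGroup (Fin n) F) :
    (spParams n e ω).simulate T (enc e g) = play (spParams n e ω).mmul (spParams n e ω).minv
      (fun a b => decide (a = b)) (tableStrategy T) (360 * (n ^ 2 * q)) []
      ((List.ofFn (stdGen hn ω) ++ [g]).map (enc e)) := by
  rw [simulate, output_iterate_step, gens_spParams e ω hn]
  simp [maxOps, spParams]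

theorem solves_of_good (hn : 2 ≤ n) [Finite F] {T : Table} {g : symplecticGroup (Fin n) F}
    {p : SLP 6} (hT : (spParams n e ω).simulate T (enc e g) = some p) (hp : SpGen.Good hn ω g p) :
    (spParams n e ω).Solves T (enc e g) := by
  have hcard : Nat.card F = q := Nat.card_eq_of_equiv_fin e
  obtain ⟨hlen, z, hz, hzg⟩ := hp
  refine ⟨p, by simp [hT], ?_, enc e z, by simp [evalSLP_spParams e hn, hz], fun s hs => ?_⟩
  · rw [hcard] at hlen
    have hq : q ≠ 0 := hcard ▸ Nat.card_pos.ne'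
    calc 2 ^ p.length ≤ 2 ^ (540 * (n ^ 2 * Nat.log 2 q)) := Nat.pow_le_pow_right (by norm_num) hlen
      _ = (2 ^ Nat.log 2 q) ^ (540 * n ^ 2) := by rw [← pow_mul]; congr 1; ring
      _ ≤ q ^ (540 * n ^ 2) := Nat.pow_le_pow_left (Nat.pow_log_le_self 2 hq) _
  · rw [gens_spParams e ω hn, List.mem_ofFn] at hs
    obtain ⟨k, rfl⟩ := hs
    rw [minv_enc, mmul_enc, mmul_enc, mmul_enc]
    exact congrArg _ (Subgroup.mem_center_iff.1 hzg (stdGen hn ω k)).symm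

/-- The strategy obtained from `SpGen.win_univ`, together with the list of all symplectic matrices,
passes the check. -/
theorem exists_check (hn : 2 ≤ n) (hω : ∀ a : Fˣ, a ∈ Subgroup.zpowers ω) (hq : Odd q) :
    ∃ d, (spParams n e ω).Check d := by
  classical
  have : Finite F := Finite.of_equiv _ e.symm
  have : Finite (symplecticGroup (Fin n) F) := inferInstance
  have hcard : Nat.card F = q := Nat.card_eq_of_equiv_fin e
  obtain ⟨A, hA⟩ := (SpGen.win_univ (hn := hn) hω (hcard.symm ▸ hq)).exists_strategy
    ((List.ofFn fun k _ => stdGen hn ω k) ++ [id]) (by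
      rintro a (rfl | ⟨k, rfl⟩)
      · simp
      · exact List.mem_append_left _ (List.mem_ofFn.2 ⟨k, rfl⟩))
  rw [hcard] at hA
  obtain ⟨T, hT⟩ := exists_tableStrategy_eq A (360 * (n ^ 2 * q))
  obtain ⟨l, hl⟩ : ∃ l : List (symplecticGroup (Fin n) F), ∀ g, g ∈ l :=
    ⟨Set.finite_univ.toFinset.toList, by simp⟩
  refine ⟨(T, l.map (enc e)), fun s hs => ?_, fun g hg s hs => ?_, fun g hg => ?_⟩
  · rw [gens_spParams e ω hn, List.mem_ofFn] at hs
    obtain ⟨k, rfl⟩ := hs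
    exact ⟨_, List.mem_map_of_mem (hl _), rfl⟩
  · rw [gens_spParams e ω hn, List.mem_ofFn] at hs
    obtain ⟨k, rfl⟩ := hs
    obtain ⟨g, -, rfl⟩ := List.mem_map.1 hg
    exact ⟨_, List.mem_map_of_mem (hl _), (mmul_enc e ω _ _).symm⟩
  · obtain ⟨g, -, rfl⟩ := List.mem_map.1 hg
    obtain ⟨p, hp, hplay⟩ := hA g (Set.mem_univ g)
    refine solves_of_good e hn ?_ hp
    rw [simulate_spParams e hn, play_map (eq := fun a b => decide (a = b)) (enc e)
      (mmul_enc e ω) (minv_enc e ω)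
      (fun a b => decide_eq_decide.2 (enc_injective e).eq_iff),
      play_congr hT _ _ _ (by simp), ← hplay A [] fun h => rfl]
    simp

/-- A list of matrices that passes the check contains all symplectic matrices, because the
generators generate the finite symplectic group. -/
theorem solves_of_check (hn : 2 ≤ n) (hω : ∀ a : Fˣ, a ∈ Subgroup.zpowers ω) (hq : Odd q)
    {d : Certificate} (hd : (spParams n e ω).Check d) (g : symplecticGroup (Fin n) F) :
    (spParams n e ω).Solves d.1 (enc e g) := by
  have : Finite F := Finite.of_equiv _ e.symm
  have : Finite (symplecticGroup (Fin n) F) := inferInstance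
  have hcard : Nat.card F = q := Nat.card_eq_of_equiv_fin e
  obtain ⟨h₁, h₂, h₃⟩ := hd
  have hgen : ∀ k, enc e (stdGen hn ω k) ∈ (spParams n e ω).gens := fun k => by
    rw [gens_spParams e ω hn]
    exact List.mem_ofFn.2 ⟨k, rfl⟩
  have hmul : ∀ g k, enc e g ∈ d.2 → enc e (g * stdGen hn ω k) ∈ d.2 := by
    intro g k hg
    obtain ⟨h, hh, hh'⟩ := h₂ _ hg _ (hgen k)
    rwa [hh', mmul_enc] at hh
  have hcl : ∀ g h : symplecticGroup (Fin n) F, enc e g ∈ d.2 → enc e (g * h) ∈ d.2 := by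
    intro g h hg
    have hh : h ∈ Submonoid.closure (Set.range (stdGen hn ω)) := by
      have : h ∈ Subgroup.closure (Set.range (stdGen hn ω)) := by
        rw [SpGen.closure_stdGen hω (hcard.symm ▸ hq)]
        trivial
      rwa [← Subgroup.mem_toSubmonoid, Subgroup.closure_toSubmonoid_of_finite] at this
    induction hh using Submonoid.closure_induction generalizing g with
    | mem x hx =>
      obtain ⟨k, rfl⟩ := hx
      exact hmul g k hg
    | one => rwa [mul_one]
    | mul x y _ _ hx hy =>
      rw [← mul_assoc]
      exact hy _ (hx _ hg)
  obtain ⟨x, hx, hx'⟩ := h₁ _ (hgen 0)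
  rw [hx'] at hx
  have := hcl _ ((stdGen hn ω 0)⁻¹ * g) hx
  rw [mul_inv_cancel_left] at this
  exact h₃ _ this

/-- What the check verifies on tables holds in the symplectic group. An element that commutes with
the generators is central. -/
theorem good_of_solves (hn : 2 ≤ n) (hω : ∀ a : Fˣ, a ∈ Subgroup.zpowers ω) (hq : Odd q) {T : Table}
    {g : symplecticGroup (Fin n) F} (h : (spParams n e ω).Solves T (enc e g)) :
    ∃ p, (spParams n e ω).simulate T (enc e g) = some p ∧ 2 ^ p.length ≤ q ^ (540 * n ^ 2) ∧
      ∃ z, SLP.eval (stdGen hn ω) p = some z ∧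
        z⁻¹ * g ∈ Subgroup.center (symplecticGroup (Fin n) F) := by
  have : Finite F := Finite.of_equiv _ e.symm
  have hcard : Nat.card F = q := Nat.card_eq_of_equiv_fin e
  obtain ⟨p, hp, hlen, z, hz, hzg⟩ := h
  rw [Option.mem_toList] at hp hz
  rw [evalSLP_spParams e hn, Option.map_eq_some_iff] at hz
  obtain ⟨z, hz, rfl⟩ := hz
  refine ⟨p, hp, hlen, z, hz, ?_⟩
  have hcomm : ∀ k, stdGen hn ω k ∈ Subgroup.centralizer {z⁻¹ * g} := by
    intro k
    have := hzg (enc e (stdGen hn ω k)) (by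
      rw [gens_spParams e ω hn]
      exact List.mem_ofFn.2 ⟨k, rfl⟩)
    rw [minv_enc, mmul_enc, mmul_enc, mmul_enc] at this
    rw [Subgroup.mem_centralizer_singleton_iff]
    exact ((enc_injective e) this).symm
  have htop : Subgroup.centralizer {z⁻¹ * g} = ⊤ := by
    rw [eq_top_iff, ← SpGen.closure_stdGen (hn := hn) hω (hcard.symm ▸ hq), Subgroup.closure_le]
    rintro _ ⟨k, rfl⟩
    exact hcomm k
  rw [Subgroup.mem_center_iff]
  intro h
  have : h ∈ Subgroup.centralizer {z⁻¹ * g} := htop ▸ Subgroup.mem_top h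
  exact Subgroup.mem_centralizer_singleton_iff.1 this

end Field

end SpParams

/-! ### The algorithm -/

namespace SpParams

/-- The tables that solve the problem for all elements form a decidable set that is never empty for
valid parameters, so that one of them can be computed. -/
theorem exists_computable_table : ∃ f : SpParams → Table, Computable f ∧
    ∀ {n q : ℕ} (_ : 2 ≤ n) (_ : Odd q) {F : Type*} [Field F] (e : F ≃ Fin q) (ω : Fˣ)
      (_ : ∀ a : Fˣ, a ∈ Subgroup.zpowers ω) (g : Matrix.symplecticGroup (Fin n) F),
      (spParams n e ω).Solves (f (spParams n e ω)) (enc e g) := by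
  obtain ⟨f, hf, hf'⟩ := PrimrecRel.exists_computable
    (R := fun i d => ¬i.Valid ∨ Check i d)
    (PrimrecPred.or (primrecPred_valid.comp .fst).not primrecRel_check) fun i => by
      by_cases hi : i.Valid
      · obtain ⟨n, q, hn, hq, F, _, e, ω, hω, rfl⟩ := exists_eq_spParams hi
        obtain ⟨d, hd⟩ := exists_check e hn hω hq
        exact ⟨d, .inr hd⟩
      · exact ⟨([], []), .inl hi⟩
  refine ⟨fun i => (f i).1, Computable.fst.comp hf, fun {n q} hn hq F _ e ω hω g => ?_⟩
  exact solves_of_check e hn hω hq ((hf' _).resolve_left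
    (not_not.2 (valid_spParams e ω hn hq hω))) g

end SpParams

theorem mainTheorem1 :
    ∃ (A : BlackBoxAlgorithm SpParams 6) (C : ℝ),
      ∀ (n : ℕ) (hn : 2 ≤ n) (q : ℕ) (_ : Odd q)
        (F : Type*) [Field F] (e : F ≃ Fin q)
        (ω : Fˣ) (_ : ∀ a : Fˣ, a ∈ Subgroup.zpowers ω)
        (G : Type*) [Group G] (B : BlackBoxGroup G) (c : Fin 6 → B.Code)
        (φ : Matrix.symplecticGroup (Fin n) F ≃* G) (_ : ∀ i, B.val (c i) = φ (stdGen hn ω i))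
        (w : B.Code),
        ∃ (N : ℕ) (p : SLP 6) (z : G),
          A.OutputsWithin (spParams n e ω) B c w N p ∧
          (N : ℝ) ≤ C * (n : ℝ) ^ 2 * (q : ℝ) ∧
          SLP.eval (fun i => B.val (c i)) p = some z ∧
          z⁻¹ * B.val w ∈ Subgroup.center G ∧
          (p.length : ℝ) ≤ C * (n : ℝ) ^ 2 * Real.log (q : ℝ) := by
  obtain ⟨f, hf, hsolves⟩ := SpParams.exists_computable_table
  refine ⟨⟨fun i => tableStrategy (f i), primrec_tableStrategy.to_comp.comp
    (hf.comp .fst) .snd⟩, 1080, fun n hn q hq F _ e ω hω G _ B c φ hc w => ?_⟩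
  obtain ⟨g, hg⟩ := φ.surjective (B.val w)
  obtain ⟨p, hp, hlen, z, hz, hzg⟩ := SpParams.good_of_solves e hn hω hq (hsolves hn hq e ω hω g)
  refine ⟨360 * (n ^ 2 * q), p, φ z, ?_, ?_, ?_, ?_, ?_⟩
  · -- the black-box group is compared with the matrix group through `a ↦ φ⁻¹ (val a)`
    rw [BlackBoxAlgorithm.OutputsWithin, runStrategy_eq_play]
    rw [SpParams.simulate_spParams e hn] at hp
    rw [← hp]
    refine Eq.trans ?_ (congrArg _ ?_) (b := play _ _ _ _ _ _
      ((List.ofFn c ++ [w]).map fun a => SpParams.enc e (φ.symm (B.val a))))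
    · refine (play_map (mul := B.mul) (inv := B.inv) (eq := B.eqTest)
        (fun a => SpParams.enc e (φ.symm (B.val a))) (fun a b => ?_) (fun a => ?_)
        (fun a b => ?_) _ _ _ _).symm
      · rw [SpParams.mmul_enc, B.val_mul, map_mul]
      · rw [SpParams.minv_enc, B.val_inv, map_inv]
      · rw [Bool.eq_iff_iff, decide_eq_true_iff, (SpParams.enc_injective e).eq_iff,
          φ.symm.injective.eq_iff, B.eqTest_iff]
    · simp [hc, ← hg]
  · push_cast
    have : (0 : ℝ) ≤ n ^ 2 * q := by positivity
    linarith
  · simp only [hc]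
    exact (SLP.eval_map φ.toMonoidHom (stdGen hn ω) p).trans (by rw [hz]; rfl)
  · rw [← hg, ← map_inv, ← map_mul, Subgroup.mem_center_iff]
    intro h
    obtain ⟨h, rfl⟩ := φ.surjective h
    rw [← map_mul, ← map_mul, Subgroup.mem_center_iff.1 hzg h]
  · -- `2 ^ length ≤ q ^ (540 n²)` and `log 2 ≥ 1 / 2`
    have hq0 : (0 : ℝ) < q := by exact_mod_cast hq.pos
    have h₁ : (p.length : ℝ) * Real.log 2 ≤ (540 * n ^ 2 : ℕ) * Real.log q := by
      rw [← Real.log_pow, ← Real.log_pow]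
      exact Real.log_le_log (by positivity) (by exact_mod_cast hlen)
    have h₂ : (p.length : ℝ) * (1 / 2) ≤ p.length * Real.log 2 :=
      mul_le_mul_of_nonneg_left (by linarith [Real.log_two_gt_d9]) (Nat.cast_nonneg _)
    push_cast at h₁
    linarith
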